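/- All graphs are finite and simple. For a graph $G$ and $C\subseteq V(G)$ let $N(C)$ be the set of vertices outside $C$ with a neighbour in $C$, and $N[C]=C\cup N(C)$. A \emph{separation} of $G$ is a pair $(X,Y)$ with $X\cup Y=V(G)$ and no edge between $X\setminus Y$ and $Y\setminus X$; its \emph{order} is $|X\cap Y|$. A set $A\subseteq V(G)$ is \emph{$(q,k)$-unbreakable} if every separation $(X,Y)$ of order at most $k$ satisfies $|(X\setminus Y)\cap A|\le q$ or $|(Y\setminus X)\cap A|\le q$. An \emph{$X$–$Y$ separator} is a set $W\subseteq V(G)$ (possibly meeting $X$ or $Y$) such that no component of $G\setminus W$ meets both $X$ and $Y$; let $R_{G\setminus W}(X\setminus W)$ be the set of vertices reachable from $X\setminus W$ in $G\setminus W$. An inclusionwise minimal $X$–$Y$ separator $W$ is \emph{important} if there is no $X$–$Y$ separator $W'$ with $|W'|\le|W|$ and $R_{G\setminus W}(X\setminus W)\subsetneq R_{G\setminus W'}(X\setminus W')$. Given $S\subseteq V(G)$ and an integer $k\ge 0$, a \emph{chip} is a set $C\subseteq V(G)$ such that $G[C]$ is connected (in particular $C\ne\emptyset$), $|N(C)|\le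 3k$, and $N(C)$ is an important $C$–$S$ separator; let $\mathcal C$ be the family of inclusionwise maximal chips. Put $\eta=3k(3k\cdot 4^{3k}+1)$ and $\tau=(3k)^2\cdot 8^{3k}+2k$. **Theorem.** There is an algorithm that, given a connected graph $G$ with $n$ vertices and $m$ edges (by adjacency lists), an integer $k\ge 0$ and a $(2k,k)$-unbreakable set $S\subseteq V(G)$, computes in time $O(2^{O(k)}nm)$ the set $$A=\Bigl(\bigcap_{C\in\mathcal C}\bigl(V(G)\setminus N[C]\bigr)\Bigr)\cup\bigcup_{C\in\mathcal C}N(C)$$ (with $A=V(G)$ if $\mathcal C=\emptyset$), and this set satisfies: (a) $S\subseteq A$; (b) $|N(D)|\le\eta$ for every connected component $D$ of $G\setminus A$; (c) $A$ is $(\tau,k)$-unbreakable in $G$; (d) if $|S|>3k$, $G\setminus S$ is connected and $N(V(G)\setminus S)=S$, then $S\ne A$. Here time is the number of steps of a unit-cost random access machine with addition and subtraction, and the bound means: at most $c\,2^{ck}(nm+1)$ steps for one absolute constant $c$ (the $+1$ matters only for the one-vertex graph, where $m=0$). -/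

import Mathlib

namespace LocalDecomp

/-! ## Separations, separators, unbreakable sets, chips -/

section Graph

variable {V : Type*}

/-- The open neighbourhood `N_G(C)` of a vertex set `C`. -/
def nbhd (G : SimpleGraph V) (C : Set V) : Set V :=
  {v | v ∉ C ∧ ∃ u ∈ C, G.Adj u v}

/-- `(X, Y)` is a separation of `G`. -/
def IsSeparation (G : SimpleGraph V) (X Y : Set V) : Prop :=
  X ∪ Y = Set.univ ∧ ∀ x ∈ X \ Y, ∀ y ∈ Y \ X, ¬ G.Adj x y

/-- `A` is `(q, k)`-unbreakable in `G` (used for finite graphs only). -/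
def IsUnbreakable (G : SimpleGraph V) (q k : ℕ) (A : Set V) : Prop :=
  ∀ X Y : Set V, IsSeparation G X Y → (X ∩ Y).ncard ≤ k →
    ((X \ Y) ∩ A).ncard ≤ q ∨ ((Y \ X) ∩ A).ncard ≤ q

/-- The set of vertices reachable in `G \ W` from `X \ W`. -/
def reach (G : SimpleGraph V) (W X : Set V) : Set V :=
  {v | ∃ (x : V) (hx : x ∈ Wᶜ) (hv : v ∈ Wᶜ),
    x ∈ X ∧ (G.induce Wᶜ).Reachable ⟨x, hx⟩ ⟨v, hv⟩}

/-- `W` is an `X`-`Y` separator: no component of `G \ W` meets both `X` and `Y`. The set `W` may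
intersect `X` and `Y`. -/
def IsSeparator (G : SimpleGraph V) (X Y W : Set V) : Prop :=
  ∀ D : (G.induce Wᶜ).ConnectedComponent,
    ¬ ((∃ x ∈ D.supp, (x : V) ∈ X) ∧ ∃ y ∈ D.supp, (y : V) ∈ Y)

/-- `W` is an important `X`-`Y` separator (used for finite graphs only). -/
def IsImportantSeparator (G : SimpleGraph V) (X Y W : Set V) : Prop :=
  Minimal (IsSeparator G X Y) W ∧
    ¬ ∃ W' : Set V, IsSeparator G X Y W' ∧ W'.ncard ≤ W.ncard ∧ reach G W X ⊂ reach G W' X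

/-- `C` is a chip with respect to `S`. -/
def IsChip (G : SimpleGraph V) (k : ℕ) (S C : Set V) : Prop :=
  (G.induce C).Connected ∧ (nbhd G C).ncard ≤ 3 * k ∧ IsImportantSeparator G C S (nbhd G C)

/-- The family of all inclusionwise maximal chips. -/
def maxChips (G : SimpleGraph V) (k : ℕ) (S : Set V) : Set (Set V) :=
  {C | Maximal (IsChip G k S) C}

/-- What remains after cutting away all maximal chips: the vertices outside `N[C]` for every
maximal chip `C`, together with the neighbourhoods `N(C)` of the maximal chips. -/
def chipBag (G : SimpleGraph V) (k : ℕ) (S : Set V) : Set V :=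
  (⋂ C ∈ maxChips G k S, (C ∪ nbhd G C)ᶜ) ∪ ⋃ C ∈ maxChips G k S, nbhd G C

end Graph

/-- `η = 3k (3k · 4^{3k} + 1)`. -/
def eta (k : ℕ) : ℕ := 3 * k * (3 * k * 4 ^ (3 * k) + 1)

/-- `τ = (3k)² · 8^{3k} + 2k`. -/
def tau (k : ℕ) : ℕ := (3 * k) ^ 2 * 8 ^ (3 * k) + 2 * k

/-! ## A unit-cost random access machine

Memory consists of arrays of natural numbers. A program is a finite piece of code; it refers to
arrays by fixed names, so it uses finitely many of them, and it addresses cells indirectly by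
computed indices. The only arithmetic operations are addition and truncated subtraction. -/

/-- Memory contents: `σ a i` is cell `i` of array `a`. -/
abbrev Store := ℕ → ℕ → ℕ

inductive Expr where
  /-- a constant -/
  | lit (c : ℕ)
  /-- the content of cell `i` of array `a` -/
  | get (a : ℕ) (i : Expr)
  | add (x y : Expr)
  /-- truncated subtraction -/
  | sub (x y : Expr)

namespace Expr

def eval (σ : Store) : Expr → ℕ
  | lit c => c
  | get a i => σ a (i.eval σ)
  | add x y => x.eval σ + y.eval σ
  | sub x y => x.eval σ - y.eval σ

/-- Number of elementary operations in the evaluation of an expression. -/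
def cost : Expr → ℕ
  | lit _ => 1
  | get _ i => i.cost + 1
  | add x y => x.cost + y.cost + 1
  | sub x y => x.cost + y.cost + 1

end Expr

inductive Prog where
  | skip
  /-- `a[i] := e` -/
  | assign (a : ℕ) (i e : Expr)
  | seq (p q : Prog)
  /-- run `p` if `b ≠ 0`, otherwise `q` -/
  | cond (b : Expr) (p q : Prog)
  /-- run `p` as long as `b ≠ 0` -/
  | loop (b : Expr) (p : Prog)

/-- Write `x` into cell `i` of array `a`. -/
def Store.write (σ : Store) (a i x : ℕ) : Store :=
  Function.update σ a (Function.update (σ a) i x)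

/-- `Exec p σ t σ'`: started in memory `σ`, the program `p` halts after exactly `t` elementary steps
with memory `σ'`. -/
inductive Exec : Prog → Store → ℕ → Store → Prop where
  | skip (σ : Store) : Exec .skip σ 1 σ
  | assign (σ : Store) (a : ℕ) (i e : Expr) :
      Exec (.assign a i e) σ (i.cost + e.cost + 1) (σ.write a (i.eval σ) (e.eval σ))
  | seq {p q : Prog} {σ σ' σ'' : Store} {t t' : ℕ} (hp : Exec p σ t σ') (hq : Exec q σ' t' σ'') :
      Exec (.seq p q) σ (t + t') σ''
  | cond_true {b : Expr} {p q : Prog} {σ σ' : Store} {t : ℕ} (hb : b.eval σ ≠ 0)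
      (hp : Exec p σ t σ') : Exec (.cond b p q) σ (b.cost + 1 + t) σ'
  | cond_false {b : Expr} {p q : Prog} {σ σ' : Store} {t : ℕ} (hb : b.eval σ = 0)
      (hq : Exec q σ t σ') : Exec (.cond b p q) σ (b.cost + 1 + t) σ'
  | loop_done {b : Expr} {p : Prog} {σ : Store} (hb : b.eval σ = 0) :
      Exec (.loop b p) σ (b.cost + 1) σ
  | loop_step {b : Expr} {p : Prog} {σ σ' σ'' : Store} {t t' : ℕ} (hb : b.eval σ ≠ 0)
      (hp : Exec p σ t σ') (hl : Exec (.loop b p) σ' t' σ'') :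
      Exec (.loop b p) σ (b.cost + 1 + t + t') σ''

/-! ## Input and output -/

/-- `adj` lists, for every vertex, its neighbours once each, in an arbitrary order. -/
def IsAdjList {n : ℕ} (G : SimpleGraph (Fin n)) (adj : Fin n → List (Fin n)) : Prop :=
  ∀ v, (adj v).Nodup ∧ ∀ w, w ∈ adj v ↔ G.Adj v w

/-- Initial memory. Array `0` holds `n, k`. Array `2` holds the concatenated adjacency lists of the
vertices `0, …, n - 1`; the list of `v` occupies the cells from `off[v]` up to (not including)
`off[v + 1]`, where `off` is array `1`, of length `n + 1`. Array `3` is the characteristic vector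
of `S`. All other cells are `0`. -/
def inputStore {n : ℕ} (adj : Fin n → List (Fin n)) (k : ℕ) (S : Finset (Fin n)) : Store
  | 0, 0 => n
  | 0, 1 => k
  | 1, i => if i ≤ n then (((List.finRange n).take i).map fun u => (adj u).length).sum else 0
  | 2, i => (((List.finRange n).flatMap adj).map Fin.val).getD i 0
  | 3, i => if ∃ v ∈ S, (v : ℕ) = i then 1 else 0
  | _, _ => 0

/-- The computed vertex set, read off array `4`, its characteristic vector. -/
def outputSet (n : ℕ) (σ : Store) : Set (Fin n) := {v | σ 4 v ≠ 0}

end LocalDecomp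

/-! Importance of separators can be traded for maximality. Call a set free if it is connected,
avoids `S` and has at most `3k` neighbours. Chips are free. Conversely, let `C` be a maximal free
set and `W` a separator disjoint from `C` with `|W| ≤ |N(C)|`: what `C` reaches outside `W` is again
free, hence equal to `C`. So the maximal chips are the maximal free sets (`maxChips_eq`). In
particular, a maximal chip that meets another one, `C`, but misses `N(C)`, is equal to `C`.

For (b), a component `D` of `G ∖ A` lies in one maximal chip `C`, and a neighbour of `D` inside `C`
is adjacent to a maximal chip that meets `N(C)`. For (c), if a separation of order at most `k` has
at most `2k` terminals on the side `X ∖ Y`, then the other vertices of this side have at most `3k`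
neighbours in total. Hence each of them lies in a maximal chip, and those in the bag are adjacent to
a maximal chip that meets `X ∩ Y`. Both counts need a bound on the number of maximal chips through a
vertex.

This bound and the algorithm come from one branching procedure (`enum`). For a connected set `Z` and
a forbidden set `T ⊇ S`, submodularity of `|N(·)|` yields a furthest minimum cut `R`, and `R` is
contained in every maximal free set `C ⊇ Z` that avoids `T`. Take `x` in `N(R) ∖ T`. If `x ∈ C`,
replace `Z` by `R ∪ {x}`, which raises the minimum cut. If `x ∉ C`, then `x` is a neighbour of `C`
and joins `T`. Neither can happen usefully more than `3k` times, so `6k` binary decisions find `C`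
(`enum_complete`), and a vertex lies in at most `4^{3k}` maximal chips.

The program tries every root `v` and every string of decisions, and keeps the results that are in no
larger result for the same root; these are the maximal chips through `v` (`good_iff`). Furthest cuts
come from at most `3k + 1` rounds of augmenting disjoint paths, coded as a matching: weak duality is
`IsFlow.ncard_le`, and a failed search certifies the cut (`IsFlow.isFar`). Each search is linear in
the input, so a root costs `2^{O(k)}(n + m)`; connectedness gives `n ≤ m + 1`, which absorbs the
quadratic term in `n`. -/

namespace LocalDecomp

/-! ## Connected sets and components -/

section Combinatorics

variable {V : Type*} {G : SimpleGraph V}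

/-- `C` is nonempty and connected: a set that meets `C` and is closed under adjacency inside `C`
contains `C`. -/
def Conn (G : SimpleGraph V) (C : Set V) : Prop :=
  C.Nonempty ∧ ∀ X : Set V, (∃ u ∈ C, u ∈ X) →
    (∀ u ∈ C, u ∈ X → ∀ w ∈ C, G.Adj u w → w ∈ X) → C ⊆ X

/-- The component of `v` in `G[R]`, as the least set that contains `v` and is closed under
adjacency to vertices of `R`. -/
def comp (G : SimpleGraph V) (R : Set V) (v : V) : Set V :=
  {u | ∀ X : Set V, v ∈ X → (∀ a ∈ X, ∀ b ∈ R, G.Adj a b → b ∈ X) → u ∈ X}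

theorem mem_comp_self {R : Set V} {v : V} : v ∈ comp G R v := fun _ h _ => h

theorem comp_subset {R X : Set V} {v : V} (hv : v ∈ X)
    (hX : ∀ a ∈ X, ∀ b ∈ R, G.Adj a b → b ∈ X) : comp G R v ⊆ X := fun _ hu => hu X hv hX

theorem comp_subset_self {R : Set V} {v : V} (hv : v ∈ R) : comp G R v ⊆ R :=
  comp_subset hv fun _ _ _ hb _ => hb

theorem comp_closed {R : Set V} {v a b : V} (ha : a ∈ comp G R v) (hb : b ∈ R)
    (hab : G.Adj a b) : b ∈ comp G R v :=
  fun X hv hX => hX a (ha X hv hX) b hb hab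

theorem conn_comp {R : Set V} {v : V} : Conn G (comp G R v) := by
  refine ⟨⟨v, mem_comp_self⟩, fun X ⟨u, hu, huX⟩ hX => ?_⟩
  have hvX : v ∈ X := by
    by_contra hvX
    -- Otherwise the part of the component outside `X` contains `v` and is closed, so by leastness
    -- it is everything, contradicting `u ∈ X`.
    have := comp_subset (G := G) (R := R) (v := v) (X := comp G R v \ X) ⟨mem_comp_self, hvX⟩
      (fun a ha b hb hab => ⟨comp_closed ha.1 hb hab, fun hbX =>
        ha.2 (hX b (comp_closed ha.1 hb hab) hbX a ha.1 hab.symm)⟩)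
    exact (this hu).2 huX
  have := comp_subset (G := G) (R := R) (v := v) (X := comp G R v ∩ X) ⟨mem_comp_self, hvX⟩
      (fun a ha b hb hab => ⟨comp_closed ha.1 hb hab,
        hX a ha.1 ha.2 b (comp_closed ha.1 hb hab) hab⟩)
  exact fun w hw => (this hw).2

theorem nbhd_comp_subset {R : Set V} {v : V} (hv : v ∈ R) :
    nbhd G (comp G R v) ⊆ nbhd G R := by
  rintro w ⟨hw, u, hu, huw⟩
  exact ⟨fun hwR => hw (comp_closed hu hwR huw), u, comp_subset_self hv hu, huw⟩

theorem Conn.subset_comp {R Z : Set V} {v : V} (hZ : Conn G Z) (hv : v ∈ Z) (hZR : Z ⊆ R) :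
    Z ⊆ comp G R v :=
  hZ.2 _ ⟨v, hv, mem_comp_self⟩ fun _ _ hu _ hw huw => comp_closed hu (hZR hw) huw

theorem Conn.singleton (v : V) : Conn G {v} :=
  ⟨⟨v, rfl⟩, fun X ⟨u, hu, huX⟩ _ w hw => by
    rw [Set.mem_singleton_iff] at hu hw; rwa [hw, ← hu]⟩

theorem Conn.union {A B : Set V} (hA : Conn G A) (hB : Conn G B) (h : (A ∩ B).Nonempty) :
    Conn G (A ∪ B) := by
  obtain ⟨x, hxA, hxB⟩ := h
  have key : ∀ X : Set V, (∀ u ∈ A ∪ B, u ∈ X → ∀ w ∈ A ∪ B, G.Adj u w → w ∈ X) →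
      ((∃ u ∈ A, u ∈ X) → A ⊆ X) ∧ ((∃ u ∈ B, u ∈ X) → B ⊆ X) := fun X hX =>
    ⟨fun h => hA.2 X h fun u hu huX w hw => hX u (.inl hu) huX w (.inl hw),
     fun h => hB.2 X h fun u hu huX w hw => hX u (.inr hu) huX w (.inr hw)⟩
  refine ⟨⟨x, .inl hxA⟩, fun X ⟨u, hu, huX⟩ hX => ?_⟩
  obtain ⟨kA, kB⟩ := key X hX
  rcases hu with hu | hu
  · exact Set.union_subset (kA ⟨u, hu, huX⟩) (kB ⟨x, hxB, kA ⟨u, hu, huX⟩ hxA⟩)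
  · exact Set.union_subset (kA ⟨x, hxA, kB ⟨u, hu, huX⟩ hxB⟩) (kB ⟨u, hu, huX⟩)

theorem Conn.insert {A : Set V} (hA : Conn G A) {x : V} (hx : x ∈ nbhd G A) :
    Conn G (insert x A) := by
  obtain ⟨-, a, ha, hax⟩ := hx
  refine ⟨⟨x, .inl rfl⟩, fun X ⟨u, hu, huX⟩ hX => ?_⟩
  have h1 : (∃ u ∈ A, u ∈ X) → A ⊆ X := fun h =>
    hA.2 X h fun u hu huX w hw => hX u (.inr hu) huX w (.inr hw)
  have haX : a ∈ X := by
    rcases hu with rfl | hu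
    · exact hX u (.inl rfl) huX a (.inr ha) hax.symm
    · exact h1 ⟨u, hu, huX⟩ ha
  rintro w (rfl | hw)
  · exact hX a (.inr ha) haX w (.inl rfl) hax
  · exact h1 ⟨a, ha, haX⟩ hw

/-! ### Reachability and separators in terms of components -/

theorem reachable_induce_iff {R : Set V} {x y : V} (hx : x ∈ R) (hy : y ∈ R) :
    (G.induce R).Reachable ⟨x, hx⟩ ⟨y, hy⟩ ↔ y ∈ comp G R x := by
  constructor
  · rintro ⟨p⟩
    have : ∀ (a b : R), (G.induce R).Walk a b → (a : V) ∈ comp G R x → (b : V) ∈ comp G R x := by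
      intro a b p
      induction p with
      | nil => exact id
      | cons h _ ih => exact fun ha => ih (comp_closed ha (Subtype.coe_prop _) h)
    exact this _ _ p mem_comp_self
  · intro hy'
    obtain ⟨_, h⟩ := hy' {z | ∃ h : z ∈ R, (G.induce R).Reachable ⟨x, hx⟩ ⟨z, h⟩}
      ⟨hx, SimpleGraph.Reachable.refl _⟩
      (fun a ⟨ha, hr⟩ b hb hab => ⟨hb, hr.trans (SimpleGraph.Adj.reachable
        (show (G.induce R).Adj ⟨a, ha⟩ ⟨b, hb⟩ from hab))⟩)
    exact h

theorem induce_connected_iff {C : Set V} : (G.induce C).Connected ↔ Conn G C := by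
  constructor
  · intro h
    obtain ⟨v, hv⟩ := h.nonempty
    have : comp G C v = C := (comp_subset_self hv).antisymm fun u hu =>
      (reachable_induce_iff hv hu).1 (h.preconnected _ _)
    rw [← this]; exact conn_comp
  · intro h
    obtain ⟨v, hv⟩ := h.1
    have : Nonempty C := ⟨⟨v, hv⟩⟩
    exact ⟨fun a b => (reachable_induce_iff a.2 b.2).2 (h.subset_comp a.2 subset_rfl b.2)⟩

theorem reach_eq_comp {C W : Set V} {v : V} (hC : Conn G C) (hv : v ∈ C) (hCW : Disjoint C W) :
    reach G W C = comp G Wᶜ v := by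
  have hCW' : C ⊆ Wᶜ := fun x hx => Set.disjoint_left.1 hCW hx
  ext u
  constructor
  · rintro ⟨x, hx, hu, hxC, hr⟩
    refine (reachable_induce_iff (hCW' hv) hu).1 (.trans ?_ hr)
    exact (reachable_induce_iff _ _).2 (hC.subset_comp hv hCW' hxC)
  · intro hu
    have hu' := comp_subset_self (hCW' hv) hu
    exact ⟨v, hCW' hv, hu', hv, (reachable_induce_iff _ hu').2 hu⟩

theorem isSeparator_iff {X Y W : Set V} :
    IsSeparator G X Y W ↔ Disjoint (reach G W X) Y := by
  rw [Set.disjoint_left]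
  constructor
  · rintro h u ⟨x, hx, hu, hxX, hr⟩ huY
    exact h ((G.induce Wᶜ).connectedComponentMk ⟨u, hu⟩)
      ⟨⟨⟨x, hx⟩, SimpleGraph.ConnectedComponent.sound hr, hxX⟩, ⟨⟨u, hu⟩, rfl, huY⟩⟩
  · rintro h D ⟨⟨x, hx, hxX⟩, ⟨y, hy, hyY⟩⟩
    refine h ⟨x, x.2, y.2, hxX, ?_⟩ hyY
    exact SimpleGraph.ConnectedComponent.exact (hx.trans hy.symm)

theorem comp_nbhd_compl {C : Set V} {v : V} (hC : Conn G C) (hv : v ∈ C) :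
    comp G (nbhd G C)ᶜ v = C := by
  refine Set.Subset.antisymm (comp_subset hv fun a ha b hb hab => ?_)
    (hC.subset_comp hv fun x hx h => h.1 hx)
  by_contra h
  exact hb ⟨h, a, ha, hab⟩

theorem Conn.reach_nbhd {C : Set V} (hC : Conn G C) : reach G (nbhd G C) C = C := by
  obtain ⟨v, hv⟩ := hC.1
  rw [reach_eq_comp hC hv (Set.disjoint_right.2 fun _ h => h.1), comp_nbhd_compl hC hv]

theorem nbhd_comp_compl_subset {W : Set V} {v : V} : nbhd G (comp G Wᶜ v) ⊆ W :=
  fun w ⟨hw, u, hu, huw⟩ => by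
    by_contra h
    exact hw (comp_closed hu h huw)

theorem ncard_nbhd_add [Finite V] (A : Set V) :
    (nbhd G A).ncard + A.ncard = (nbhd G A ∪ A).ncard :=
  (Set.ncard_union_eq (Set.disjoint_left.2 fun _ h => h.1) (Set.toFinite _) (Set.toFinite _)).symm

/-- The size of the neighbourhood is submodular. -/
theorem ncard_nbhd_submodular [Finite V] (A B : Set V) :
    (nbhd G (A ∪ B)).ncard + (nbhd G (A ∩ B)).ncard ≤ (nbhd G A).ncard + (nbhd G B).ncard := by
  have hU : nbhd G (A ∪ B) ∪ (A ∪ B) = (nbhd G A ∪ A) ∪ (nbhd G B ∪ B) := by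
    ext x
    simp only [nbhd, Set.mem_union, Set.mem_ofPred_eq]
    grind
  have hI : nbhd G (A ∩ B) ∪ (A ∩ B) ⊆ (nbhd G A ∪ A) ∩ (nbhd G B ∪ B) := by
    intro x
    simp only [nbhd, Set.mem_union, Set.mem_ofPred_eq, Set.mem_inter_iff]
    grind
  have h1 := ncard_nbhd_add (G := G) (A ∪ B)
  have h2 := ncard_nbhd_add (G := G) (A ∩ B)
  have h3 := ncard_nbhd_add (G := G) A
  have h4 := ncard_nbhd_add (G := G) B
  have h5 := Set.ncard_union_add_ncard_inter A B
  have h6 := Set.ncard_union_add_ncard_inter (nbhd G A ∪ A) (nbhd G B ∪ B)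
  have h7 := Set.ncard_le_ncard hI (Set.toFinite _)
  rw [hU] at h1
  omega

/-! ## Maximal chips as maximal connected sets with small neighbourhood -/

/-- `C` is connected, avoids `S`, and has at most `p` neighbours. -/
def IsFree (G : SimpleGraph V) (S : Set V) (p : ℕ) (C : Set V) : Prop :=
  Conn G C ∧ Disjoint C S ∧ (nbhd G C).ncard ≤ p

theorem IsChip.isFree {k : ℕ} {S C : Set V} (h : IsChip G k S C) : IsFree G S (3 * k) C := by
  have hC := induce_connected_iff.1 h.1
  refine ⟨hC, ?_, h.2.1⟩
  have := isSeparator_iff.1 h.2.2.1.1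
  rwa [hC.reach_nbhd] at this

/-- Minimality and importance of `N(C)` have one source, `key`: what a separator `W` of size at most
`|N(C)|` and disjoint from `C` leaves reachable from `C` is free, because its neighbourhood lies in
`W`. Maximality of `C` then rules out any growth. -/
theorem isChip_of_maximal [Finite V] {k : ℕ} {S C : Set V} (h : Maximal (IsFree G S (3 * k)) C) :
    IsChip G k S C := by
  have hC := h.1.1
  obtain ⟨v, hv⟩ := hC.1
  have key : ∀ W : Set V, Disjoint C W → IsSeparator G C S W → W.ncard ≤ (nbhd G C).ncard →
      reach G W C ⊆ C := by
    intro W hCW hW hcard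
    have hvW := Set.disjoint_left.1 hCW hv
    rw [isSeparator_iff, reach_eq_comp hC hv hCW] at hW
    rw [reach_eq_comp hC hv hCW]
    refine h.2 ⟨conn_comp, hW, ?_⟩
      (hC.subset_comp hv fun x hx => Set.disjoint_left.1 hCW hx)
    exact (Set.ncard_le_ncard nbhd_comp_compl_subset (Set.toFinite _)).trans
      (hcard.trans h.1.2.2)
  refine ⟨induce_connected_iff.2 hC, h.1.2.2, ⟨⟨?_, ?_⟩, ?_⟩⟩
  · rw [isSeparator_iff, hC.reach_nbhd]; exact h.1.2.1
  · intro W hW hWN x hx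
    by_contra hxW
    have hCW : Disjoint C W := Set.disjoint_right.2 fun y hy => (hWN hy).1
    have := key W hCW hW (Set.ncard_le_ncard hWN (Set.toFinite _))
    rw [reach_eq_comp hC hv hCW] at this
    obtain ⟨hxC, u, hu, hux⟩ := hx
    refine hxC (this (comp_closed (hC.subset_comp hv ?_ hu) hxW hux))
    exact fun x hx => Set.disjoint_left.1 hCW hx
  · rintro ⟨W, hW, hcard, hss⟩
    rw [hC.reach_nbhd] at hss
    -- Vertices of `W` are never reachable outside `W`, so an enlarged reach that contains `C`
    -- forces `W` to miss `C`.
    have hCW : Disjoint C W := Set.disjoint_left.2 fun x hx hxW => by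
      obtain ⟨_, _, h, _⟩ := hss.1 hx
      exact h hxW
    exact hss.2 (key W hCW hW hcard)

theorem exists_maximal_isFree [Finite V] {S C : Set V} {p : ℕ} (h : IsFree G S p C) :
    ∃ D, C ⊆ D ∧ Maximal (IsFree G S p) D :=
  (Set.toFinite {C | IsFree G S p C}).exists_le_maximal h

/-- From here on importance plays no role: all later arguments extend a free set to a maximal one.
-/
theorem maxChips_eq [Finite V] (k : ℕ) (S : Set V) :
    maxChips G k S = {C | Maximal (IsFree G S (3 * k)) C} := by
  ext C
  constructor
  · intro h
    obtain ⟨D, hCD, hD⟩ := exists_maximal_isFree h.1.isFree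
    have : C = D := hCD.antisymm (h.2 (isChip_of_maximal hD) hCD)
    rw [this]; exact hD
  · intro h
    exact ⟨isChip_of_maximal h, fun D hD hCD => h.2 hD.isFree hCD⟩

/-! ### Structure of the bag: terminals, components outside, unbreakability -/

theorem mem_chipBag_iff {k : ℕ} {S : Set V} {v : V} : v ∈ chipBag G k S ↔
    (∀ C ∈ maxChips G k S, v ∉ C) ∨ ∃ C ∈ maxChips G k S, v ∈ nbhd G C := by
  simp only [chipBag, Set.mem_union, Set.mem_iInter, Set.mem_iUnion, Set.mem_compl_iff, exists_prop]
  grind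

theorem subset_chipBag [Finite V] (k : ℕ) (S : Set V) : S ⊆ chipBag G k S := by
  intro v hv
  refine mem_chipBag_iff.2 (.inl fun C hC hvC => ?_)
  rw [maxChips_eq] at hC
  exact Set.disjoint_left.1 hC.1.2.1 hvC hv

/-- If the bag were just `S`, a maximal chip `C` would have all its neighbours in `S`. As the
complement of `S` is connected, `C` would be this whole complement, which has more than `3k`
neighbours. -/
theorem ne_chipBag [Finite V] {k : ℕ} {S : Set V} (hS : 3 * k < S.ncard) (hc : Conn G Sᶜ)
    (hN : nbhd G Sᶜ = S) : S ≠ chipBag G k S := by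
  intro hSA
  obtain ⟨v, hv⟩ := hc.1
  have hv' := hv
  rw [hSA, Set.mem_compl_iff, mem_chipBag_iff, not_or] at hv
  obtain ⟨h1, h2⟩ := hv
  push Not at h1 h2
  obtain ⟨C, hC, hvC⟩ := h1
  have hCS : C ⊆ Sᶜ := by
    rw [maxChips_eq] at hC
    exact fun x hx => Set.disjoint_left.1 hC.1.2.1 hx
  have hsub : Sᶜ ⊆ C := by
    refine hc.2 C ⟨v, hv', hvC⟩ fun u _ huC w hw huw => ?_
    by_contra hwC
    apply hw
    rw [hSA]
    exact mem_chipBag_iff.2 (.inr ⟨C, hC, hwC, u, huC, huw⟩)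
  have : C = Sᶜ := hCS.antisymm hsub
  rw [maxChips_eq] at hC
  have h := hC.1.2.2
  rw [this, hN] at h
  omega

theorem ncard_biUnion_le [Finite V] {ι : Type*} [Finite ι] {I : Set ι} {f : ι → Set V} {a b : ℕ}
    (hI : I.ncard ≤ a) (hf : ∀ i ∈ I, (f i).ncard ≤ b) : (⋃ i ∈ I, f i).ncard ≤ a * b := by
  classical
  have := Fintype.ofFinite ι
  have := Fintype.ofFinite V
  have h : (⋃ i ∈ I, f i) = ((I.toFinset.biUnion fun i => (f i).toFinset : Finset V) : Set V) := by
    ext; simp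
  rw [h, Set.ncard_coe_finset]
  refine (Finset.card_biUnion_le_card_mul _ _ b fun i hi => ?_).trans ?_
  · rw [← Set.ncard_eq_toFinset_card']; exact hf i (by simpa using hi)
  · rw [← Set.ncard_eq_toFinset_card']; exact Nat.mul_le_mul_right _ hI

/-- The neighbourhoods of the maximal chips that meet a given set. -/
theorem ncard_nbhds_le [Finite V] {k N : ℕ} {S U : Set V}
    (hN : ∀ v, {C | C ∈ maxChips G k S ∧ v ∈ C}.ncard ≤ N) :
    (⋃ C ∈ ⋃ v ∈ U, {C | C ∈ maxChips G k S ∧ v ∈ C}, nbhd G C).ncard ≤ U.ncard * N * (3 * k) := by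
  refine ncard_biUnion_le (ncard_biUnion_le le_rfl fun v _ => hN v) fun C hC => ?_
  simp only [Set.mem_iUnion] at hC
  obtain ⟨v, -, hC, -⟩ := hC
  exact hC.1.2.1

/-- A component outside the bag cannot cross `N(C)` for a maximal chip `C` that it meets, so it
stays in `C`. Its neighbours are in `N(C)` or in the neighbourhoods of maximal chips meeting `N(C)`,
of which there are at most `3k · N`. -/
theorem ncard_nbhd_component_le [Finite V] {k N : ℕ} {S : Set V}
    (hN : ∀ v, {C | C ∈ maxChips G k S ∧ v ∈ C}.ncard ≤ N)
    (D : (G.induce (chipBag G k S)ᶜ).ConnectedComponent) :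
    (nbhd G (Subtype.val '' D.supp)).ncard ≤ 3 * k * (3 * k * N + 1) := by
  obtain ⟨⟨d, hd⟩, rfl⟩ := D.exists_rep
  set A := chipBag G k S with hA
  have hD : Subtype.val '' ((G.induce Aᶜ).connectedComponentMk ⟨d, hd⟩).supp = comp G Aᶜ d := by
    ext u
    constructor
    · rintro ⟨u, hu, rfl⟩
      exact (reachable_induce_iff hd u.2).1 (SimpleGraph.ConnectedComponent.exact hu).symm
    · intro hu
      have hu' := comp_subset_self hd hu
      exact ⟨⟨u, hu'⟩, SimpleGraph.ConnectedComponent.sound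
        ((reachable_induce_iff hd hu').2 hu).symm, rfl⟩
  change (nbhd G (Subtype.val '' ((G.induce Aᶜ).connectedComponentMk ⟨d, hd⟩).supp)).ncard ≤ _
  rw [hD]
  have hd' := hd
  rw [hA, Set.mem_compl_iff, mem_chipBag_iff, not_or] at hd'
  obtain ⟨h1, h2⟩ := hd'
  push Not at h1
  obtain ⟨C, hC, hdC⟩ := h1
  have hCA : nbhd G C ⊆ A := fun x hx => mem_chipBag_iff.2 (.inr ⟨C, hC, hx⟩)
  have hDC : comp G Aᶜ d ⊆ C := comp_subset hdC fun a ha b hb hab => by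
    by_contra hbC
    exact hb (hCA ⟨hbC, a, ha, hab⟩)
  have hsub : nbhd G (comp G Aᶜ d) ⊆ nbhd G C ∪
      ⋃ C' ∈ ⋃ v ∈ nbhd G C, {C | C ∈ maxChips G k S ∧ v ∈ C}, nbhd G C' := by
    rintro x ⟨hx, u, hu, hux⟩
    have hxA : x ∈ A := by
      by_contra hxA
      exact hx (comp_closed hu hxA hux)
    by_cases hxC : x ∈ C
    · right
      rcases mem_chipBag_iff.1 hxA with h | ⟨C', hC', hxC'⟩
      · exact absurd hxC (h C hC)
      -- If `C'` missed `N(C)`, its vertex `y` adjacent to `x` would lie in `C`; connectedness would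
      -- put `C'` inside `C`, and maximality would give `x ∈ C'`.
      have hmeet : ∃ v ∈ nbhd G C, v ∈ C' := by
        by_contra hno
        push Not at hno
        obtain ⟨hxC'n, y, hy, hyx⟩ := hxC'
        have hyC : y ∈ C := by
          by_contra h
          exact hno y ⟨h, x, hxC, hyx.symm⟩ hy
        rw [maxChips_eq] at hC hC'
        have : C' ⊆ C := hC'.1.1.2 C ⟨y, hy, hyC⟩ fun a _ haC b hb hab => by
          by_contra hbC
          exact hno b ⟨hbC, a, haC, hab⟩ hb
        exact hxC'n (hC'.2 hC.1 this hxC)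
      obtain ⟨v, hv, hvC'⟩ := hmeet
      simp only [Set.mem_iUnion]
      exact ⟨C', ⟨v, hv, hC', hvC'⟩, hxC'⟩
    · exact .inl ⟨hxC, u, hDC hu, hux⟩
  have h3 : (nbhd G C).ncard ≤ 3 * k := hC.1.2.1
  calc (nbhd G (comp G Aᶜ d)).ncard ≤ _ := Set.ncard_le_ncard hsub (Set.toFinite _)
    _ ≤ _ := Set.ncard_union_le _ _
    _ ≤ 3 * k + 3 * k * N * (3 * k) := by
      refine Nat.add_le_add h3 ((ncard_nbhds_le hN).trans ?_)
      gcongr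
    _ = 3 * k * (3 * k * N + 1) := by ring

/-- On a side with few terminals, the bag consists of these terminals and of neighbours of maximal
chips that meet the small set `X ∩ Y`. -/
theorem ncard_side_le [Finite V] {k N : ℕ} {S X Y : Set V}
    (hN : ∀ v, {C | C ∈ maxChips G k S ∧ v ∈ C}.ncard ≤ N)
    (hXY : IsSeparation G X Y) (hk : (X ∩ Y).ncard ≤ k) (hS : ((X \ Y) ∩ S).ncard ≤ 2 * k) :
    ((X \ Y) ∩ chipBag G k S).ncard ≤ k * N * (3 * k) + 2 * k := by
  have hsub : (X \ Y) ∩ chipBag G k S ⊆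
      (⋃ C ∈ ⋃ v ∈ X ∩ Y, {C | C ∈ maxChips G k S ∧ v ∈ C}, nbhd G C) ∪ ((X \ Y) ∩ S) := by
    rintro x ⟨hx, hxA⟩
    by_cases hxS : x ∈ S
    · exact .inr ⟨hx, hxS⟩
    left
    set R := (X \ Y) \ S with hR
    have hxR : x ∈ R := ⟨hx, hxS⟩
    -- This border has at most `k + 2k = 3k` vertices, which is what makes the component of `x` in
    -- `R` free.
    have hNR : nbhd G R ⊆ (X ∩ Y) ∪ ((X \ Y) ∩ S) := by
      rintro w ⟨hw, u, hu, huw⟩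
      have hwX : w ∈ X := by
        by_contra hwX
        have hwY : w ∈ Y := (hXY.1.symm ▸ Set.mem_univ w : w ∈ X ∪ Y).resolve_left hwX
        exact hXY.2 u hu.1 w ⟨hwY, hwX⟩ huw
      by_cases hwY : w ∈ Y
      · exact .inl ⟨hwX, hwY⟩
      · exact .inr ⟨⟨hwX, hwY⟩, by_contra fun hwS => hw ⟨⟨hwX, hwY⟩, hwS⟩⟩
    have hfree : IsFree G S (3 * k) (comp G R x) := by
      refine ⟨conn_comp, Set.disjoint_left.2 fun u hu => (comp_subset_self hxR hu).2, ?_⟩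
      have h1 := Set.ncard_le_ncard ((nbhd_comp_subset hxR).trans hNR) (Set.toFinite _)
      have h2 := Set.ncard_union_le (X ∩ Y) ((X \ Y) ∩ S)
      omega
    obtain ⟨C, hxC, hC⟩ := exists_maximal_isFree hfree
    have hC' : C ∈ maxChips G k S := by rw [maxChips_eq]; exact hC
    rcases mem_chipBag_iff.1 hxA with h | ⟨C', hC', hxN⟩
    · exact absurd (hxC mem_comp_self) (h C hC')
    -- If `C'` missed `X ∩ Y`, it would avoid all of `N(R)`, since it also avoids `S`. Followed from
    -- its vertex `y` adjacent to `x`, it would stay in the component of `x` in `R`, hence in `C`,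
    -- and equal `C`, which contains `x`.
    have hmeet : ∃ v ∈ X ∩ Y, v ∈ C' := by
      by_contra hno
      push Not at hno
      obtain ⟨hxC', y, hy, hyx⟩ := hxN
      have hm := hC'
      rw [maxChips_eq] at hm
      have hyS : ∀ y ∈ C', y ∉ S := fun y hy => Set.disjoint_left.1 hm.1.2.1 hy
      have step : ∀ a ∈ R, ∀ b ∈ C', G.Adj a b → b ∈ R := by
        intro a ha b hb hab
        by_contra hbR
        rcases hNR ⟨hbR, a, ha, hab⟩ with h | h
        · exact hno b h hb
        · exact hyS b hb h.2
      have hyR : y ∈ R := step x hxR y hy hyx.symm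
      have : C' ⊆ comp G R x := by
        refine hm.1.1.2 _ ⟨y, hy, comp_closed mem_comp_self hyR hyx.symm⟩ ?_
        intro a _ haK b hb hab
        exact comp_closed haK (step a (comp_subset_self hxR haK) b hb hab) hab
      exact hxC' (hm.2 hC.1 (this.trans hxC) (hxC mem_comp_self))
    obtain ⟨v, hv, hvC'⟩ := hmeet
    simp only [Set.mem_iUnion]
    exact ⟨C', ⟨v, hv, hC', hvC'⟩, hxN⟩
  calc _ ≤ _ := Set.ncard_le_ncard hsub (Set.toFinite _)
    _ ≤ _ := Set.ncard_union_le _ _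
    _ ≤ _ := by
      refine Nat.add_le_add ((ncard_nbhds_le hN).trans ?_) hS
      gcongr

theorem isUnbreakable_chipBag [Finite V] {k N : ℕ} {S : Set V}
    (hN : ∀ v, {C | C ∈ maxChips G k S ∧ v ∈ C}.ncard ≤ N) (hS : IsUnbreakable G (2 * k) k S) :
    IsUnbreakable G (k * N * (3 * k) + 2 * k) k (chipBag G k S) := by
  intro X Y hXY hk
  have hYX : IsSeparation G Y X := ⟨by rw [Set.union_comm]; exact hXY.1,
    fun x hx y hy h => hXY.2 y hy x hx h.symm⟩
  rcases hS X Y hXY hk with h | h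
  · exact .inl (ncard_side_le hN hXY hk h)
  · exact .inr (ncard_side_le hN hYX (by rwa [Set.inter_comm]) h)

end Combinatorics

/-! ## Furthest minimum cuts and the enumeration of maximal chips -/

section Enumeration

/-- `R` is the furthest minimum cut between `Z` and `T`: among the connected supersets of `Z` that
avoid `T` it has the fewest neighbours, and it contains all others with as few neighbours. -/
def IsFar {V : Type*} (G : SimpleGraph V) (Z T R : Set V) : Prop :=
  (Z ⊆ R ∧ Disjoint R T ∧ Conn G R) ∧ ∀ R', Z ⊆ R' → Disjoint R' T → Conn G R' →
    (nbhd G R).ncard ≤ (nbhd G R').ncard ∧ ((nbhd G R').ncard ≤ (nbhd G R).ncard → R' ⊆ R)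

variable {V : Type*} {G : SimpleGraph V}

theorem IsFar.unique {Z T R R' : Set V} (h : IsFar G Z T R) (h' : IsFar G Z T R') : R = R' :=
  have a := h.2 R' h'.1.1 h'.1.2.1 h'.1.2.2
  have b := h'.2 R h.1.1 h.1.2.1 h.1.2.2
  (b.2 a.1).antisymm (a.2 b.1)

theorem ncard_nbhd_comp_le [Finite V] {R : Set V} {v : V} (hv : v ∈ R) :
    (nbhd G (comp G R v)).ncard ≤ (nbhd G R).ncard :=
  Set.ncard_le_ncard (nbhd_comp_subset hv) (Set.toFinite _)

/-- Bounds on the neighbourhoods of connected sets extend to all sets. -/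
theorem le_ncard_nbhd [Finite V] {Z T : Set V} {l : ℕ} (hZ : Conn G Z)
    (h : ∀ R, Z ⊆ R → Disjoint R T → Conn G R → l ≤ (nbhd G R).ncard)
    {R : Set V} (hZR : Z ⊆ R) (hRT : Disjoint R T) : l ≤ (nbhd G R).ncard := by
  obtain ⟨v, hv⟩ := hZ.1
  exact (h _ (hZ.subset_comp hv hZR) (hRT.mono_left (comp_subset_self (hZR hv))) conn_comp).trans
    (ncard_nbhd_comp_le (hZR hv))

/-- Among the minimum cuts take an inclusionwise maximal `R`. For another minimum cut `R'`, the
intersection `R ∩ R'` has at least the minimum number of neighbours (`le_ncard_nbhd` is needed here,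
as it may be disconnected), so by submodularity `R ∪ R'` is a minimum cut too and equals `R`. -/
theorem exists_isFar [Finite V] {Z T : Set V} (hZ : Conn G Z) (hZT : Disjoint Z T) :
    ∃ R, IsFar G Z T R := by
  classical
  let F : Set (Set V) := {R | Z ⊆ R ∧ Disjoint R T ∧ Conn G R}
  obtain ⟨R₀, hR₀, hmin⟩ := Set.exists_min_image F (fun R => (nbhd G R).ncard) (Set.toFinite F)
    ⟨Z, subset_rfl, hZT, hZ⟩
  obtain ⟨R, -, hR⟩ := (Set.toFinite {R | R ∈ F ∧ (nbhd G R).ncard ≤ (nbhd G R₀).ncard}).exists_le_maximal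
    (show R₀ ∈ {R | R ∈ F ∧ (nbhd G R).ncard ≤ (nbhd G R₀).ncard} from ⟨hR₀, le_rfl⟩)
  refine ⟨R, hR.1.1, fun R' h1 h2 h3 => ⟨hR.1.2.trans (hmin R' ⟨h1, h2, h3⟩), fun hle => ?_⟩⟩
  have hZR := hR.1.1.1
  have hsub := ncard_nbhd_submodular (G := G) R R'
  have hI := le_ncard_nbhd hZ (fun R a b c => hmin R ⟨a, b, c⟩)
    (Set.subset_inter hZR h1) (hR.1.1.2.1.mono_left Set.inter_subset_left)
  have hU : R ∪ R' ∈ {R | R ∈ F ∧ (nbhd G R).ncard ≤ (nbhd G R₀).ncard} := by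
    refine ⟨⟨hZR.trans Set.subset_union_left, hR.1.1.2.1.union_left h2, hR.1.1.2.2.union h3 ?_⟩, ?_⟩
    · obtain ⟨v, hv⟩ := hZ.1
      exact ⟨v, hZR hv, h1 hv⟩
    · have := hR.1.2
      omega
  exact Set.subset_union_right.trans (hR.2 hU Set.subset_union_left)

/-- A furthest minimum cut inside a maximal set: the push towards the far side is safe. -/
theorem IsFar.subset_of_maximal [Finite V] {S Z T R C : Set V} {p : ℕ} (h : IsFar G Z T R)
    (hZ : Conn G Z) (hST : S ⊆ T) (hC : Maximal (IsFree G S p) C) (hZC : Z ⊆ C)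
    (hCT : Disjoint C T) : R ⊆ C := by
  -- `R ∩ C` competes with `R`, so it has at least as many neighbours; submodularity passes the gain
  -- to `R ∪ C`, which therefore is free.
  have hI := le_ncard_nbhd hZ (fun R a b c => (h.2 R a b c).1)
    (Set.subset_inter h.1.1 hZC) (hCT.mono_left Set.inter_subset_right)
  have hsub := ncard_nbhd_submodular (G := G) R C
  have hfree : IsFree G S p (R ∪ C) := by
    refine ⟨h.1.2.2.union hC.1.1 ?_, (h.1.2.1.union_left hCT).mono_right hST, ?_⟩
    · obtain ⟨v, hv⟩ := hZ.1
      exact ⟨v, h.1.1 hv, hZC hv⟩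
    · have := hC.1.2.2
      omega
  exact Set.subset_union_left.trans (hC.2 hfree Set.subset_union_right)

open Classical in
/-- The furthest minimum cut. -/
noncomputable def far (G : SimpleGraph V) (Z T : Set V) : Set V :=
  if h : ∃ R, IsFar G Z T R then h.choose else Set.univ

theorem IsFar.far_eq {Z T R : Set V} (h : IsFar G Z T R) : far G Z T = R := by
  have hex : ∃ R, IsFar G Z T R := ⟨R, h⟩
  rw [far, dif_pos hex]
  exact hex.choose_spec.unique h

variable {n : ℕ} {H : SimpleGraph (Fin n)}

open Classical in
/-- The enumeration procedure. The guess `r` below `2 ^ L` tells for each branching vertex whether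
it is added to the forbidden set `T` or to the set `Z`. -/
noncomputable def enum (H : SimpleGraph (Fin n)) (p : ℕ) :
    ℕ → ℕ → Set (Fin n) → Set (Fin n) → Option (Set (Fin n))
  | 0, _, Z, T =>
    if (nbhd H (far H Z T)).ncard ≤ p ∧ nbhd H (far H Z T) ⊆ T then some (far H Z T) else none
  | L + 1, r, Z, T =>
    if (nbhd H (far H Z T)).ncard ≤ p then
      -- Taking the greatest vertex makes the choice canonical, so that the program can reproduce
      -- it.
      if h : ∃ x, IsGreatest (nbhd H (far H Z T) \ T) x then
        if 2 ^ L ≤ r then enum H p L (r - 2 ^ L) (insert h.choose (far H Z T)) T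
        else enum H p L r (far H Z T) (insert h.choose T)
      else some (far H Z T)
    else none

section Unfold

variable {p L r : ℕ} {Z T R : Set (Fin n)} {x : Fin n}

theorem enum_of_lt (hR : IsFar H Z T R) (h : p < (nbhd H R).ncard) : enum H p L r Z T = none := by
  cases L with
  | zero => rw [enum, hR.far_eq, if_neg fun h' => absurd h'.1 (not_le.2 h)]
  | succ L => rw [enum, hR.far_eq, if_neg (not_le.2 h)]

theorem enum_of_subset (hR : IsFar H Z T R) (hp : (nbhd H R).ncard ≤ p) (h : nbhd H R ⊆ T) :
    enum H p L r Z T = some R := by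
  cases L with
  | zero => rw [enum, hR.far_eq, if_pos ⟨hp, h⟩]
  | succ L =>
    rw [enum, hR.far_eq, if_pos hp, dif_neg]
    rintro ⟨x, hx, -⟩
    exact hx.2 (h hx.1)

theorem enum_zero_of_mem (hR : IsFar H Z T R) (hx : x ∈ nbhd H R \ T) :
    enum H p 0 r Z T = none := by
  rw [enum, hR.far_eq, if_neg fun h => hx.2 (h.2 hx.1)]

theorem enum_succ (hR : IsFar H Z T R) (hp : (nbhd H R).ncard ≤ p)
    (hx : IsGreatest (nbhd H R \ T) x) : enum H p (L + 1) r Z T =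
      if 2 ^ L ≤ r then enum H p L (r - 2 ^ L) (insert x R) T
      else enum H p L r R (insert x T) := by
  have hex : ∃ x, IsGreatest (nbhd H R \ T) x := ⟨x, hx⟩
  have h : hex.choose = x := hex.choose_spec.unique hx
  rw [enum, hR.far_eq, if_pos hp, dif_pos hex, h]

end Unfold

theorem nbhd_mono_of_disjoint {Z R W : Set V} (hZR : Z ⊆ R) (hRW : Disjoint R W)
    (hW : W ⊆ nbhd G Z) : W ⊆ nbhd G R := fun _ hw =>
  have ⟨_, u, hu, huw⟩ := hW hw
  ⟨Set.disjoint_right.1 hRW hw, u, hZR hu, huw⟩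

theorem disjoint_insert_right_of {R T : Set V} {x : V} (h : Disjoint R T) (hx : x ∉ R) :
    Disjoint R (insert x T) := Set.disjoint_insert_right.2 ⟨hx, h⟩

/-- What `enum` returns is connected, avoids `T` and has at most `p` neighbours. -/
theorem enum_sound {p L r : ℕ} {Z T C : Set (Fin n)} (hZ : Conn H Z) (hZT : Disjoint Z T)
    (h : enum H p L r Z T = some C) : Z ⊆ C ∧ IsFree H T p C := by
  induction L generalizing r Z T with
  | zero =>
    obtain ⟨R, hR⟩ := exists_isFar hZ hZT
    rw [enum, hR.far_eq] at h
    split at h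
    · next h' =>
      cases h
      exact ⟨hR.1.1, hR.1.2.2, hR.1.2.1, h'.1⟩
    · cases h
  | succ L ih =>
    obtain ⟨R, hR⟩ := exists_isFar hZ hZT
    by_cases hp : (nbhd H R).ncard ≤ p
    · rcases (nbhd H R \ T).eq_empty_or_nonempty with he | hne
      · rw [enum_of_subset hR hp (Set.sdiff_eq_empty.1 he)] at h
        cases h
        exact ⟨hR.1.1, hR.1.2.2, hR.1.2.1, hp⟩
      · obtain ⟨x, hx⟩ := Set.exists_max_image (nbhd H R \ T) id (Set.toFinite _) hne
        have hx' : IsGreatest (nbhd H R \ T) x := ⟨hx.1, fun y hy => hx.2 y hy⟩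
        rw [enum_succ hR hp hx'] at h
        split at h
        · obtain ⟨h1, h2⟩ := ih (hR.1.2.2.insert hx.1.1)
            (Set.disjoint_insert_left.2 ⟨hx.1.2, hR.1.2.1⟩) h
          exact ⟨hR.1.1.trans ((Set.subset_insert _ _).trans h1), h2⟩
        · obtain ⟨h1, h2, h3, h4⟩ := ih hR.1.2.2
            (disjoint_insert_right_of hR.1.2.1 hx.1.1.1) h
          exact ⟨hR.1.1.trans h1, h2, h3.mono_right (Set.subset_insert _ _), h4⟩
    · rw [enum_of_lt hR (not_le.1 hp)] at h
      cases h

/-- Each maximal chip is found by some guess: every branching raises the minimum cut or the number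
of forbidden vertices outside `S`. -/
theorem enum_complete {p : ℕ} {S C : Set (Fin n)} (hC : Maximal (IsFree H S p) C)
    (L l : ℕ) (Z W : Set (Fin n)) (hZ : Conn H Z) (hZC : Z ⊆ C) (hW : W ⊆ nbhd H Z)
    (hWS : Disjoint W S) (hCW : Disjoint C W)
    (hl : ∀ R, Z ⊆ R → Disjoint R (S ∪ W) → Conn H R → l ≤ (nbhd H R).ncard)
    (hL : 2 * p ≤ L + l + W.ncard) : ∃ r < 2 ^ L, enum H p L r Z (S ∪ W) = some C := by
  induction L generalizing Z W l with
  | zero =>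
    have hCT : Disjoint C (S ∪ W) := hC.1.2.1.union_right hCW
    obtain ⟨R, hR⟩ := exists_isFar hZ (hCT.mono_left hZC)
    have hRC := hR.subset_of_maximal hZ Set.subset_union_left hC hZC hCT
    have hp : (nbhd H R).ncard ≤ p := (hR.2 C hZC hCT hC.1.1).1.trans hC.1.2.2
    have hWR : W ⊆ nbhd H R :=
      nbhd_mono_of_disjoint hR.1.1 (hR.1.2.1.mono_right Set.subset_union_right) hW
    -- With the budget spent, `2p ≤ l + |W|` and `l ≤ |N(R)| ≤ p` give `|N(R)| ≤ |W|`; since `W ⊆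
    -- N(R)`, the two sets coincide.
    have hsub : nbhd H R ⊆ S ∪ W := by
      have h1 := hl R hR.1.1 hR.1.2.1 hR.1.2.2
      rw [← Set.eq_of_subset_of_ncard_le hWR (by omega)]
      exact Set.subset_union_right
    -- `C` is connected, meets `R` and contains no vertex of `N(R)`, so it cannot leave `R`.
    have hCR : C ⊆ R := hC.1.1.2 R (by
        obtain ⟨v, hv⟩ := hZ.1
        exact ⟨v, hZC hv, hR.1.1 hv⟩) fun u _ hu w hw huw => by
      by_contra hwR
      exact Set.disjoint_left.1 hCT hw (hsub ⟨hwR, u, hu, huw⟩)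
    refine ⟨0, by simp, ?_⟩
    rw [enum_of_subset hR hp hsub, hRC.antisymm hCR]
  | succ L ih =>
    have hCT : Disjoint C (S ∪ W) := hC.1.2.1.union_right hCW
    obtain ⟨R, hR⟩ := exists_isFar hZ (hCT.mono_left hZC)
    have hRC := hR.subset_of_maximal hZ Set.subset_union_left hC hZC hCT
    have hp : (nbhd H R).ncard ≤ p := (hR.2 C hZC hCT hC.1.1).1.trans hC.1.2.2
    have hWR : W ⊆ nbhd H R :=
      nbhd_mono_of_disjoint hR.1.1 (hR.1.2.1.mono_right Set.subset_union_right) hW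
    have hlR := hl R hR.1.1 hR.1.2.1 hR.1.2.2
    rcases (nbhd H R \ (S ∪ W)).eq_empty_or_nonempty with he | hne
    · have hsub := Set.sdiff_eq_empty.1 he
      have hCR : C ⊆ R := hC.1.1.2 R (by
          obtain ⟨v, hv⟩ := hZ.1
          exact ⟨v, hZC hv, hR.1.1 hv⟩) fun u _ hu w hw huw => by
        by_contra hwR
        exact Set.disjoint_left.1 hCT hw (hsub ⟨hwR, u, hu, huw⟩)
      refine ⟨0, by simp, ?_⟩
      rw [enum_of_subset hR hp hsub, hRC.antisymm hCR]
    obtain ⟨x, hx⟩ := Set.exists_max_image _ id (Set.toFinite _) hne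
    have hx' : IsGreatest (nbhd H R \ (S ∪ W)) x := ⟨hx.1, fun y hy => hx.2 y hy⟩
    obtain ⟨hxN, hxT⟩ := hx.1
    by_cases hxC : x ∈ C
    · have hins : insert x R ⊆ C := Set.insert_subset hxC hRC
      -- `R` absorbs every competitor with as few neighbours, and `x` is outside `R`. So all
      -- competitors containing `x` have strictly more neighbours, and the bound `l` rises.
      obtain ⟨r, hr, he⟩ := ih ((nbhd H R).ncard + 1) (insert x R) W (hR.1.2.2.insert hxN) hins
        (nbhd_mono_of_disjoint (Set.subset_insert _ _) (hCW.mono_left hins) hWR) hWS hCW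
        (fun R' h1 h2 h3 => by
          have h4 := hR.2 R' (hR.1.1.trans ((Set.subset_insert _ _).trans h1)) h2 h3
          by_contra hlt
          exact hxN.1 (h4.2 (by omega) (h1 (Set.mem_insert _ _))))
        (by omega)
      -- The leading binary digit of the guess records the decision `x ∈ C`.
      refine ⟨r + 2 ^ L, by rw [pow_succ]; omega, ?_⟩
      rw [enum_succ hR hp hx', if_pos (by omega), Nat.add_sub_cancel, he]
    · have hxW : x ∉ W := fun h => hxT (.inr h)
      have hxS : x ∉ S := fun h => hxT (.inl h)
      -- Here `l` stays and `W` gains the new vertex `x`, which is adjacent to `R` and outside `S`.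
      obtain ⟨r, hr, he⟩ := ih l R (insert x W) hR.1.2.2 hRC (Set.insert_subset hxN hWR)
        (Set.disjoint_insert_left.2 ⟨hxS, hWS⟩) (disjoint_insert_right_of hCW hxC)
        (fun R' h1 h2 h3 => hl R' (hR.1.1.trans h1)
          (h2.mono_right (Set.union_subset_union_right _ (Set.subset_insert _ _))) h3)
        (by rw [Set.ncard_insert_of_notMem hxW]; omega)
      refine ⟨r, by rw [pow_succ]; omega, ?_⟩
      rw [enum_succ hR hp hx', if_neg (by omega), ← Set.union_insert, he]

theorem exists_enum_eq {p : ℕ} {S C : Set (Fin n)} (hC : Maximal (IsFree H S p) C) {v : Fin n}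
    (hv : v ∈ C) : ∃ r < 2 ^ (2 * p), enum H p (2 * p) r {v} S = some C := by
  have := enum_complete hC (2 * p) 0 {v} ∅ (Conn.singleton v) (Set.singleton_subset_iff.2 hv)
    (Set.empty_subset _) (Set.empty_disjoint _) (Set.disjoint_empty _) (fun _ _ _ _ => Nat.zero_le _)
    (by simp)
  simpa using this

/-- A vertex lies in at most `4 ^ (3 * k)` maximal chips. -/
theorem ncard_maxChips_mem_le (k : ℕ) (S : Set (Fin n)) (v : Fin n) :
    {C | C ∈ maxChips H k S ∧ v ∈ C}.ncard ≤ 4 ^ (3 * k) := by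
  rw [maxChips_eq]
  have hsub : {C | Maximal (IsFree H S (3 * k)) C ∧ v ∈ C} ⊆
      (fun r => (enum H (3 * k) (2 * (3 * k)) r {v} S).getD ∅) ''
        (Finset.range (2 ^ (2 * (3 * k))) : Set ℕ) := by
    rintro C ⟨hC, hv⟩
    obtain ⟨r, hr, he⟩ := exists_enum_eq hC hv
    exact ⟨r, by simpa using hr, by simp [he]⟩
  calc _ ≤ _ := Set.ncard_le_ncard hsub (Set.toFinite _)
    _ ≤ _ := Set.ncard_image_le (Finset.finite_toSet _)
    _ = 4 ^ (3 * k) := by rw [Set.ncard_coe_finset, Finset.card_range, pow_mul]; norm_num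

end Enumeration

/-! ## Flows between a vertex set and a terminal set -/

section Flow

variable {V : Type*} {G : SimpleGraph V} {Z T : Set V} {q : V → Option V}

/-- A system of disjoint paths from `T` to the neighbourhood of `Z`, coded as a matching: `q u` is the
predecessor of `u` on its path, undefined if `u` is the first vertex, and `q u = u` if `u` is on no
path. The vertices that are not values of `q` are the last vertices of the paths. -/
structure IsFlow (G : SimpleGraph V) (Z T : Set V) (q : V → Option V) : Prop where
  inj : ∀ u u' w, q u = some w → q u' = some w → u = u'
  edge : ∀ u w, q u = some w → u = w ∨ G.Adj w u
  none_mem : ∀ u, q u = none → u ∈ T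
  cover : ∀ w, (∀ u, q u ≠ some w) → w ∈ nbhd G Z
  fixed : ∀ z ∈ Z, q z = some z

/-- The flow without paths, from which augmentation starts. -/
theorem isFlow_some : IsFlow G Z T some where
  inj := by rintro u u' w ⟨⟩ ⟨⟩; rfl
  edge := by rintro u w ⟨⟩; exact .inl rfl
  none_mem := by simp
  cover w h := absurd rfl (h w)
  fixed _ _ := rfl

/-- One step of the search for an augmenting path. -/
def Step (G : SimpleGraph V) (q : V → Option V) (u x : V) : Prop :=
  ∃ w, q u = some w ∧ (x = w ∨ G.Adj w x)

/-- Weak duality: a flow has at most as many paths as `R` has neighbours. If equality holds, `q` maps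
the complement of `R` to vertices outside `R` that have no neighbour in `R`. -/
theorem IsFlow.ncard_le [Finite V] (h : IsFlow G Z T q) {R : Set V} (hZR : Z ⊆ R)
    (hRT : Disjoint R T) : {u | q u = none}.ncard ≤ (nbhd G R).ncard ∧
      ((nbhd G R).ncard ≤ {u | q u = none}.ncard →
        ∀ u ∉ R, ∀ w, q u = some w → w ∉ R ∪ nbhd G R) := by
  classical
  -- Paths end in `N(Z)`, inside `R ∪ N(R)`, so every `w ∈ Q` is the predecessor of some `f w`,
  -- equal or adjacent to `w` and hence outside `R`. The first vertices and the values of `f` are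
  -- disjoint subsets of the complement of `R`; removing `|Q|` from the count leaves `|N(R)|`.
  set Q : Set V := (nbhd G R ∪ R)ᶜ with hQ
  have hpre : ∀ w ∈ Q, ∃ u, q u = some w := by
    intro w hw
    by_contra hno
    push Not at hno
    obtain ⟨hwZ, z, hz, hzw⟩ := h.cover w hno
    by_cases hwR : w ∈ R
    · exact hw (.inr hwR)
    · exact hw (.inl ⟨hwR, z, hZR hz, hzw⟩)
  choose! f hf using hpre
  have hfR : ∀ w ∈ Q, f w ∉ R := by
    intro w hw hR
    rcases h.edge _ _ (hf w hw) with he | he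
    · exact hw (.inr (he ▸ hR))
    · by_cases hwR : w ∈ R
      · exact hw (.inr hwR)
      · exact hw (.inl ⟨hwR, _, hR, he.symm⟩)
  have hinj : Set.InjOn f Q := fun a ha b hb hab => by
    have := hf a ha
    rw [hab, hf b hb] at this
    exact (Option.some.inj this).symm
  have hdisj : Disjoint {u | q u = none} (f '' Q) := by
    rw [Set.disjoint_left]
    rintro _ hu ⟨w, hw, rfl⟩
    have := hf w hw
    rw [show q (f w) = none from hu] at this
    cases this
  have hsub : {u | q u = none} ∪ f '' Q ⊆ Rᶜ := by
    rintro u (hu | ⟨w, hw, rfl⟩)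
    · exact fun hR => Set.disjoint_left.1 hRT hR (h.none_mem u hu)
    · exact hfR w hw
  have h1 := Set.ncard_union_eq hdisj (Set.toFinite _) (Set.toFinite _)
  rw [hinj.ncard_image] at h1
  have h2 := Set.ncard_le_ncard hsub (Set.toFinite _)
  have h3 := ncard_nbhd_add (G := G) R
  have h4 := Set.ncard_add_ncard_compl R
  have h5 := Set.ncard_add_ncard_compl (nbhd G R ∪ R)
  rw [← hQ] at h5
  refine ⟨by omega, fun hle u hu w hw => ?_⟩
  -- In the case of equality no vertex outside `R` is left over: each is a first vertex or some `f
  -- w`.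
  have heq := Set.eq_of_subset_of_ncard_le hsub (by omega) (Set.toFinite _)
  have huR : u ∈ Rᶜ := hu
  rw [← heq] at huR
  rcases huR with hu' | ⟨w', hw', rfl⟩
  · rw [show q u = none from hu'] at hw
    cases hw
  · rw [hf w' hw'] at hw
    cases hw
    rw [Set.union_comm]
    exact hw'

/-- If the search from `T` gets stuck on the set `A`, the component of `Z` outside `A` is the
furthest minimum cut, and its neighbourhood is as large as the flow. -/
theorem IsFlow.isFar [Finite V] (h : IsFlow G Z T q) {A : Set V} (hZ : Conn G Z) {v : V}
    (hv : v ∈ Z) (hTA : T ⊆ A) (hAZ : Disjoint A Z)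
    (hclosed : ∀ u ∈ A, ∀ x, Step G q u x → x ∉ Z → x ∈ A)
    (hleast : ∀ X : Set V, T ⊆ X → (∀ u ∈ X, ∀ x, Step G q u x → x ∉ Z → x ∈ X) → A ⊆ X)
    (hstuck : ∀ u ∈ A, ∀ w, q u = some w → w ∉ nbhd G Z) :
    IsFar G Z T (comp G Aᶜ v) ∧ (nbhd G (comp G Aᶜ v)).ncard = {u | q u = none}.ncard := by
  classical
  have hZA : Z ⊆ Aᶜ := fun z hz hA => Set.disjoint_left.1 hAZ hA hz
  have hAT : Disjoint Aᶜ T := Set.disjoint_right.2 fun t ht h => h (hTA ht)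
  -- The closed neighbourhood of a vertex of `B` stays in `A`: it could leave `A` only into `Z`, and
  -- then the search would have found an augmenting path. Hence `N(Aᶜ)` lies in `A ∖ B`.
  set B : Set V := {w | ∃ u ∈ A, q u = some w} with hB
  have hBZ : ∀ w ∈ B, w ∉ Z := by
    rintro w ⟨u, hu, hw⟩ hwZ
    have := h.inj u w w hw (h.fixed w hwZ)
    exact Set.disjoint_left.1 hAZ hu (this ▸ hwZ)
  have hNB : ∀ w ∈ B, ∀ x, (x = w ∨ G.Adj w x) → x ∈ A := by
    rintro w hw x hx
    obtain ⟨u, hu, hq⟩ := hw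
    refine hclosed u hu x ⟨w, hq, hx⟩ fun hxZ => ?_
    have hwZ := hBZ w ⟨u, hu, hq⟩
    rcases hx with rfl | hx
    · exact hwZ hxZ
    · exact hstuck u hu w hq ⟨hwZ, x, hxZ, hx.symm⟩
  have hN : nbhd G Aᶜ ⊆ A \ B := by
    rintro x ⟨hx, u, hu, hux⟩
    refine ⟨not_not.1 hx, fun hxB => hu (hNB x hxB u (.inr hux.symm))⟩
  have hBA : B ⊆ A := fun w hw => hNB w hw w (.inl rfl)
  -- `q` is injective on the vertices of `A` that have a predecessor, so `A ∖ B` is no larger than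
  -- the number of paths.
  have hcard : A.ncard ≤ {u | q u = none}.ncard + B.ncard := by
    have : A ⊆ {u | q u = none} ∪ {u | u ∈ A ∧ q u ≠ none} := fun u hu => by
      by_cases hq : q u = none
      · exact .inl hq
      · exact .inr ⟨hu, hq⟩
    refine (Set.ncard_le_ncard this (Set.toFinite _)).trans ((Set.ncard_union_le _ _).trans ?_)
    refine Nat.add_le_add_left ?_ _
    refine Set.ncard_le_ncard_of_injOn (fun u => (q u).getD u) ?_ ?_ (Set.toFinite _)
    · rintro u ⟨hu, hq⟩
      obtain ⟨w, hw⟩ := Option.ne_none_iff_exists'.1 hq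
      exact ⟨u, hu, by simp [hw]⟩
    · rintro u ⟨hu, hq⟩ u' ⟨hu', hq'⟩ he
      obtain ⟨w, hw⟩ := Option.ne_none_iff_exists'.1 hq
      obtain ⟨w', hw'⟩ := Option.ne_none_iff_exists'.1 hq'
      simp only [hw, hw', Option.getD_some] at he
      exact h.inj u u' w hw (he ▸ hw')
  have hle : (nbhd G Aᶜ).ncard ≤ {u | q u = none}.ncard := by
    have h1 := Set.ncard_le_ncard hN (Set.toFinite _)
    have h2 := Set.ncard_sdiff_add_ncard_of_subset hBA
    omega
  have hC := ncard_nbhd_comp_le (G := G) (hZA hv)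
  have hCZ := hZ.subset_comp hv hZA
  have hCT := hAT.mono_left (comp_subset_self (G := G) (hZA hv))
  have hlow := (h.ncard_le hCZ hCT).1
  refine ⟨⟨⟨hCZ, hCT, conn_comp⟩, fun R' h1 h2 h3 => ⟨?_, fun hR' => ?_⟩⟩, by omega⟩
  · exact hC.trans (hle.trans (h.ncard_le h1 h2).1)
  · have htight := (h.ncard_le h1 h2).2 (by omega)
    -- By tightness the complement of a minimum cut `R'` is closed under search steps, and `A` is
    -- the least such set containing `T`.
    have : A ⊆ R'ᶜ := by
      refine hleast _ (fun t ht hR => Set.disjoint_left.1 h2 hR ht) ?_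
      rintro u hu x ⟨w, hq, hx⟩ - hxR
      have hw := htight u hu w hq
      rcases hx with rfl | hx
      · exact hw (.inl hxR)
      · by_cases hwR : w ∈ R'
        · exact hw (.inl hwR)
        · exact hw (.inr ⟨hwR, x, hxR, hx.symm⟩)
    exact h3.subset_comp (h1 hv) fun x hx hA => this hA hx

/-! ### Augmentation by moving a hole -/

/-- A flow with a hole at `x`, as it occurs during augmentation. -/
structure IsHoled (G : SimpleGraph V) (Z T : Set V) (q : V → Option V) (x : V) : Prop where
  inj : ∀ u u' w, q u = some w → q u' = some w → u = u'
  edge : ∀ u w, q u = some w → u = w ∨ G.Adj w u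
  none_mem : ∀ u, q u = none → u = x ∨ u ∈ T
  hole : q x = none
  cover : ∀ w, (∀ u, q u ≠ some w) → w ∈ nbhd G Z
  fixed : ∀ z ∈ Z, q z = some z

/-- Augmentation starts at the far end: `y` releases its predecessor `w`, which becomes the last
vertex of a path because `w ∈ N(Z)`, and `y` is left with the hole. -/
theorem IsFlow.isHoled [DecidableEq V] (h : IsFlow G Z T q) {y w : V} (hw : q y = some w)
    (hN : w ∈ nbhd G Z) (hy : y ∉ Z) : IsHoled G Z T (Function.update q y none) y where
  inj u u' w h1 h2 := by
    rw [Function.update_apply] at h1 h2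
    split at h1
    · cases h1
    · split at h2
      · cases h2
      · exact h.inj u u' w h1 h2
  edge u w h1 := by
    rw [Function.update_apply] at h1
    split at h1
    · cases h1
    · exact h.edge u w h1
  none_mem u h1 := by
    rw [Function.update_apply] at h1
    split at h1
    · next e => exact .inl e
    · exact .inr (h.none_mem u h1)
  hole := by simp
  cover w' hw' := by
    by_cases hww : w' = w
    · exact hww ▸ hN
    · refine h.cover w' fun u hu => hw' u ?_
      rw [Function.update_of_ne, hu]
      rintro rfl
      exact hww (Option.some.inj (hu.symm.trans hw))
  fixed z hz := by
    rw [Function.update_of_ne, h.fixed z hz]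
    rintro rfl
    exact hy hz

theorem IsHoled.isFlow {x : V} (h : IsHoled G Z T q x) (hx : x ∈ T) : IsFlow G Z T q where
  inj := h.inj
  edge := h.edge
  none_mem u hu := (h.none_mem u hu).elim (fun e => e ▸ hx) id
  cover := h.cover
  fixed := h.fixed

/-- The vertex `x` takes over the predecessor of `x'`, to which it is equal or adjacent by `Step`,
and `x'` inherits the hole. Written as composition with a transposition, this visibly preserves
injectivity and the set of values. -/
theorem IsHoled.swap [DecidableEq V] {x x' : V} (h : IsHoled G Z T q x) (hx : x ∉ Z) (hx' : x' ∉ Z)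
    (hs : Step G q x' x) : IsHoled G Z T (q ∘ Equiv.swap x x') x' where
  inj u u' w h1 h2 := (Equiv.swap x x').injective (h.inj _ _ w h1 h2)
  edge u w := by
    obtain ⟨w', hw', hs⟩ := hs
    intro hu
    simp only [Function.comp, Equiv.swap_apply_def] at hu
    split at hu
    · next e =>
      cases hw'.symm.trans hu
      exact e ▸ hs
    · split at hu
      · rw [h.hole] at hu
        cases hu
      · exact h.edge u w hu
  none_mem u := by
    obtain ⟨w', hw', hs⟩ := hs
    intro hu
    simp only [Function.comp, Equiv.swap_apply_def] at hu
    split at hu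
    · rw [hw'] at hu
      cases hu
    · next hne =>
      split at hu
      · next e => exact .inl e
      · exact .inr ((h.none_mem u hu).resolve_left hne)
  hole := by simp [h.hole]
  cover w hw := h.cover w fun u hu => hw (Equiv.swap x x' u) (by simpa using hu)
  fixed z hz := by
    rw [Function.comp, Equiv.swap_apply_of_ne_of_ne, h.fixed z hz]
    · rintro rfl
      exact hx hz
    · rintro rfl
      exact hx' hz

theorem ncard_none_update [Finite V] [DecidableEq V] {y w : V} (hw : q y = some w) :
    {u | Function.update q y none u = none}.ncard = {u | q u = none}.ncard + 1 := by
  have : {u | Function.update q y none u = none} = insert y {u | q u = none} := by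
    ext u
    by_cases h : u = y <;> simp [h, Function.update_apply]
  rw [this, Set.ncard_insert_of_notMem (by simp [hw])]

theorem ncard_none_swap [DecidableEq V] (x x' : V) :
    {u | (q ∘ Equiv.swap x x') u = none}.ncard = {u | q u = none}.ncard := by
  refine Set.ncard_congr (fun u _ => Equiv.swap x x' u) (fun u hu => hu)
    (fun a b _ _ h => (Equiv.swap x x').injective h) (fun b hb => ⟨Equiv.swap x x' b, ?_, by simp⟩)
  simpa using hb

end Flow

/-! ## Reasoning about programs -/

section Logic

infixr:60 "⨾" => Prog.seq

/-- `p` started in `σ` halts within `T` steps in a memory that satisfies `Q`. -/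
def Runs (p : Prog) (σ : Store) (T : ℕ) (Q : Store → Prop) : Prop :=
  ∃ t σ', Exec p σ t σ' ∧ t ≤ T ∧ Q σ'

variable {p q : Prog} {b : Expr} {σ : Store} {T T' : ℕ} {Q Q' : Store → Prop}

theorem Runs.mono (h : Runs p σ T Q) (hT : T ≤ T') (hQ : ∀ σ', Q σ' → Q' σ') :
    Runs p σ T' Q' :=
  have ⟨t, σ', he, ht, hq⟩ := h
  ⟨t, σ', he, ht.trans hT, hQ σ' hq⟩

theorem Runs.seq (hp : Runs p σ T Q) (hq : ∀ σ', Q σ' → Runs q σ' T' Q') :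
    Runs (p ⨾ q) σ (T + T') Q' := by
  obtain ⟨t, σ', he, ht, h⟩ := hp
  obtain ⟨t', σ'', he', ht', h'⟩ := hq σ' h
  exact ⟨t + t', σ'', .seq he he', Nat.add_le_add ht ht', h'⟩

theorem Runs.assign {a : ℕ} {i e : Expr} (h : Q (σ.write a (i.eval σ) (e.eval σ))) :
    Runs (.assign a i e) σ (i.cost + e.cost + 1) Q :=
  ⟨_, _, .assign σ a i e, le_rfl, h⟩

theorem Runs.cond (hp : b.eval σ ≠ 0 → Runs p σ T Q) (hq : b.eval σ = 0 → Runs q σ T' Q) :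
    Runs (.cond b p q) σ (b.cost + 1 + (T + T')) Q := by
  by_cases hb : b.eval σ = 0
  · obtain ⟨t, σ', he, ht, h⟩ := hq hb
    exact ⟨_, σ', .cond_false hb he, by omega, h⟩
  · obtain ⟨t, σ', he, ht, h⟩ := hp hb
    exact ⟨_, σ', .cond_true hb he, by omega, h⟩

/-- A loop whose running time is paid for by the potential `φ`. -/
theorem Runs.loop {I : Store → Prop} {φ : Store → ℕ}
    (hs : ∀ σ, I σ → b.eval σ ≠ 0 →
      ∃ T, Runs p σ T fun σ' => I σ' ∧ φ σ' + T + b.cost + 1 ≤ φ σ) (h0 : I σ) :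
    Runs (.loop b p) σ (φ σ + b.cost + 1) fun σ' => I σ' ∧ b.eval σ' = 0 := by
  induction hφ : φ σ using Nat.strong_induction_on generalizing σ with
  | _ N ih =>
    by_cases hb : b.eval σ = 0
    · exact ⟨_, σ, .loop_done hb, by omega, h0, hb⟩
    · obtain ⟨T, t, σ', he, ht, hI, hle⟩ := hs σ h0 hb
      obtain ⟨t', σ'', he', ht', h'⟩ := ih (φ σ') (by omega) hI rfl
      exact ⟨_, σ'', .loop_step hb he he', by omega, h'⟩

/-- The arrays a program writes to. -/
def Prog.mods : Prog → List ℕ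
  | .skip => []
  | .assign a _ _ => [a]
  | .seq p q => p.mods ++ q.mods
  | .cond _ p q => p.mods ++ q.mods
  | .loop _ p => p.mods

theorem Store.write_same (σ : Store) (a i x : ℕ) :
    σ.write a i x a = Function.update (σ a) i x := by
  simp [Store.write]

theorem Store.write_ne (σ : Store) {a c : ℕ} (i x : ℕ) (h : c ≠ a) : σ.write a i x c = σ c := by
  simp [Store.write, h]

theorem Exec.frame {t : ℕ} {σ' : Store} (h : Exec p σ t σ') {a : ℕ} (ha : a ∉ p.mods) :
    σ' a = σ a := by
  induction h with
  | skip => rfl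
  | assign σ a i e =>
    simp only [Prog.mods, List.mem_singleton] at ha
    exact σ.write_ne _ _ ha
  | seq _ _ ih1 ih2 =>
    simp only [Prog.mods, List.mem_append, not_or] at ha
    rw [ih2 ha.2, ih1 ha.1]
  | cond_true _ _ ih =>
    simp only [Prog.mods, List.mem_append, not_or] at ha
    exact ih ha.1
  | cond_false _ _ ih =>
    simp only [Prog.mods, List.mem_append, not_or] at ha
    exact ih ha.2
  | loop_done => rfl
  | loop_step _ _ _ ih1 ih2 => rw [ih2 ha, ih1 ha]

/-- Specifications need to mention only the arrays they concern; that the others are unchanged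
follows from the list `mods`, usually by `decide`. -/
theorem Runs.frame (h : Runs p σ T Q) :
    Runs p σ T fun σ' => Q σ' ∧ ∀ a, a ∉ p.mods → σ' a = σ a :=
  have ⟨t, σ', he, ht, hq⟩ := h
  ⟨t, σ', he, ht, hq, fun _ ha => he.frame ha⟩

/-- Effect of a program without loops. -/
def Prog.act : Prog → Store → Store
  | .skip, σ => σ
  | .assign a i e, σ => σ.write a (i.eval σ) (e.eval σ)
  | .seq p q, σ => q.act (p.act σ)
  | .cond b p q, σ => if b.eval σ ≠ 0 then p.act σ else q.act σ
  | .loop _ _, σ => σ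

def Prog.isFlat : Prog → Bool
  | .skip => true
  | .assign _ _ _ => true
  | .seq p q => p.isFlat && q.isFlat
  | .cond _ p q => p.isFlat && q.isFlat
  | .loop _ _ => false

/-- Time bound for a program without loops. -/
def Prog.time : Prog → ℕ
  | .skip => 1
  | .assign _ i e => i.cost + e.cost + 1
  | .seq p q => p.time + q.time
  | .cond b p q => b.cost + 1 + (p.time + q.time)
  | .loop _ _ => 0

theorem runs_act (p : Prog) (h : p.isFlat = true) (σ : Store) :
    Runs p σ p.time fun σ' => σ' = p.act σ := by
  induction p generalizing σ with
  | skip => exact ⟨_, _, .skip σ, le_rfl, rfl⟩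
  | assign => exact .assign rfl
  | seq p q ihp ihq =>
    simp only [Prog.isFlat, Bool.and_eq_true] at h
    refine (ihp h.1 σ).seq fun σ' hσ' => ?_
    rw [hσ']
    exact ihq h.2 _
  | cond b p q ihp ihq =>
    simp only [Prog.isFlat, Bool.and_eq_true] at h
    refine .cond (fun hb => ?_) fun hb => ?_
    · simpa [Prog.act, hb] using ihp h.1 σ
    · simpa [Prog.act, hb] using ihq h.2 σ
  | loop => cases h

/-- Loop-free code is verified by computing its effect; the time bound charges both branches of a
conditional. -/
theorem Runs.flat (h : p.isFlat = true) (hT : p.time ≤ T) (hQ : Q (p.act σ)) : Runs p σ T Q :=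
  (runs_act p h σ).mono hT fun _ h => h ▸ hQ

/-! ### Scalars, truth values and counted loops -/

/-- The content of cell `0` of array `a`. -/
def sc (a : ℕ) : Expr := .get a (.lit 0)

/-- `a[0] := e` -/
def set (a : ℕ) (e : Expr) : Prog := .assign a (.lit 0) e

/-- Negation of a truth value. -/
def Expr.neg (e : Expr) : Expr := .sub (.lit 1) e

/-- Conjunction of truth values. -/
def Expr.both (e f : Expr) : Expr := .sub (.lit 1) (.add e.neg f.neg)

theorem Expr.eval_neg (e : Expr) : e.neg.eval σ ≠ 0 ↔ e.eval σ = 0 := by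
  simp only [Expr.neg, Expr.eval]; omega

theorem Expr.eval_both (e f : Expr) : (e.both f).eval σ ≠ 0 ↔ e.eval σ ≠ 0 ∧ f.eval σ ≠ 0 := by
  simp only [Expr.neg, Expr.both, Expr.eval]; omega

theorem eval_sc (a : ℕ) : (sc a).eval σ = σ a 0 := rfl

/-- Run `body` with `i[0] = 0, 1, …` as long as `i[0]` is less than `N`. -/
def forTo (i : ℕ) (N : Expr) (body : Prog) : Prog :=
  set i (.lit 0) ⨾ .loop (.sub N (sc i)) (body ⨾ set i (.add (sc i) (.lit 1)))

/-- The time of the body may depend on the index, so that loops over all vertices and their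
neighbours add up to a sum of degrees. The potential is the time owed by the remaining iterations;
the invariant is demanded after the counter has been advanced. -/
theorem Runs.forTo {i m : ℕ} {N : Expr} {body : Prog} {I : ℕ → Store → Prop} {T : ℕ → ℕ}
    (hN : ∀ j σ, I j σ → N.eval σ = m) (h0 : I 0 (σ.write i 0 0))
    (hs : ∀ j < m, ∀ σ, σ i 0 = j → I j σ → Runs body σ (T j) fun σ' =>
      σ' i 0 = j ∧ I (j + 1) (σ'.write i 0 (j + 1))) :
    Runs (forTo i N body) σ ((∑ j ∈ Finset.range m, (T j + N.cost + 10)) + N.cost + 7) (I m) := by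
  have key := Runs.loop (σ := σ.write i 0 0) (b := .sub N (sc i))
    (p := body ⨾ set i (.add (sc i) (.lit 1)))
    (I := fun σ => σ i 0 ≤ m ∧ I (σ i 0) σ)
    (φ := fun σ => ∑ j ∈ Finset.Ico (σ i 0) m, (T j + N.cost + 10)) ?_
    ⟨by simp [Store.write_same], by simpa [Store.write_same] using h0⟩
  · refine (Runs.seq (Q := fun σ' => σ' = σ.write i 0 0) (T := 3)
      (.flat rfl (by simp [set, Prog.time, Expr.cost])
      (by simp [set, Prog.act, Expr.eval])) fun σ' hσ' => ?_).mono
        (T := 3 + ((∑ j ∈ Finset.range m, (T j + N.cost + 10)) + (N.cost + 3) + 1)) (by omega) ?_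
      (Q := fun σ' => (σ' i 0 ≤ m ∧ I (σ' i 0) σ') ∧ (Expr.sub N (sc i)).eval σ' = 0)
    · subst hσ'
      simpa [Store.write_same, Expr.cost, sc] using key
    · rintro σ' ⟨⟨h1, h2⟩, h3⟩
      have := hN _ _ h2
      simp only [Expr.eval, sc] at h3
      rwa [show σ' i 0 = m by omega] at h2
  · rintro σ ⟨h1, h2⟩ hb
    have hm := hN _ _ h2
    simp only [Expr.eval, sc] at hb
    refine ⟨T (σ i 0) + 6, (hs (σ i 0) (by omega) σ rfl h2).seq fun σ' ⟨h3, h4⟩ => ?_⟩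
    refine .flat rfl (by simp [set, sc, Prog.time, Expr.cost]) ?_
    simp only [set, sc, Prog.act, Expr.eval, h3, Store.write_same, Function.update_self]
    refine ⟨⟨by omega, h4⟩, ?_⟩
    rw [Finset.sum_eq_sum_Ico_succ_bot (a := σ i 0) (by omega)]
    simp only [Expr.cost]
    omega

theorem Runs.forTo_const {i m c : ℕ} {N : Expr} {body : Prog} {I : ℕ → Store → Prop}
    (hN : ∀ j σ, I j σ → N.eval σ = m) (h0 : I 0 (σ.write i 0 0))
    (hs : ∀ j < m, ∀ σ, σ i 0 = j → I j σ → Runs body σ c fun σ' =>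
      σ' i 0 = j ∧ I (j + 1) (σ'.write i 0 (j + 1))) :
    Runs (LocalDecomp.forTo i N body) σ (m * (c + N.cost + 10) + N.cost + 7) (I m) :=
  (Runs.forTo hN h0 hs).mono (by simp) fun _ h => h

end Logic

/-! ## Vertex sets and loops over vertices and neighbours -/

section Vertices

variable {n : ℕ} {adj : Fin n → List (Fin n)} {k : ℕ} {S : Finset (Fin n)} {σ : Store}

/-- The vertex set with characteristic vector `f`. -/
def vs (n : ℕ) (f : ℕ → ℕ) : Set (Fin n) := {u | f u ≠ 0}

theorem mem_vs {f : ℕ → ℕ} {u : Fin n} : u ∈ vs n f ↔ f u ≠ 0 := Iff.rfl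

theorem vs_congr {f g : ℕ → ℕ} (h : ∀ u < n, f u ≠ 0 ↔ g u ≠ 0) : vs n f = vs n g :=
  Set.ext fun u => h u u.2

/-- The vertex with number `x`, if there is one. -/
def dec (n x : ℕ) : Option (Fin n) := if h : x < n then some ⟨x, h⟩ else none

theorem dec_val (u : Fin n) : dec n u = some u := by simp [dec]

theorem dec_self : dec n n = none := by simp [dec]

theorem dec_eq_some {x : ℕ} {u : Fin n} : dec n x = some u ↔ x = u := by
  unfold dec
  split
  · simp [Fin.ext_iff]
  · have := u.2
    simp only [reduceCtorEq, false_iff]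
    omega

theorem dec_eq_none {x : ℕ} : dec n x = none ↔ n ≤ x := by
  unfold dec
  split <;> simp <;> omega

/-- The input arrays are unchanged. -/
def Base (adj : Fin n → List (Fin n)) (k : ℕ) (S : Finset (Fin n)) (σ : Store) : Prop :=
  ∀ a < 4, σ a = inputStore adj k S a

theorem Base.size (h : Base adj k S σ) : σ 0 0 = n := by rw [h 0 (by omega)]; rfl

theorem Base.param (h : Base adj k S σ) : σ 0 1 = k := by rw [h 0 (by omega)]; rfl

theorem Base.terminals (h : Base adj k S σ) : vs n (σ 3) = (S : Set (Fin n)) := by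
  ext u
  rw [mem_vs, h 3 (by omega)]
  simp only [inputStore, ne_eq, ite_eq_right_iff, one_ne_zero, imp_false, not_not]
  constructor
  · rintro ⟨v, hv, he⟩
    rwa [← Fin.ext he]
  · exact fun hu => ⟨u, hu, rfl⟩

theorem Base.of_frame {σ' : Store} (h : Base adj k S σ) (h' : ∀ a < 4, σ' a = σ a) :
    Base adj k S σ' := fun a ha => (h' a ha).trans (h a ha)

theorem Base.write (h : Base adj k S σ) {a i x : ℕ} (ha : 4 ≤ a) : Base adj k S (σ.write a i x) :=
  h.of_frame fun c hc => σ.write_ne i x (by omega)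

theorem Base.off_succ (h : Base adj k S σ) (w : Fin n) :
    σ 1 (w + 1) = σ 1 w + (adj w).length := by
  rw [h 1 (by omega)]
  have hw := w.2
  simp only [inputStore]
  rw [if_pos (by omega), if_pos (by omega), List.take_add_one]
  simp [hw]

theorem Base.arc (h : Base adj k S σ) (w : Fin n) {j : ℕ} (hj : j < (adj w).length) :
    σ 2 (σ 1 w + j) = (adj w)[j] := by
  rw [h 1 (by omega), h 2 (by omega)]
  have hw := w.2
  simp only [inputStore]
  rw [if_pos (by omega)]
  -- The offset of `w` is the total length of the lists before it, so cutting the vertex list at `w`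
  -- locates the cell.
  have hsplit : List.finRange n = (List.finRange n).take w ++ w :: (List.finRange n).drop (w + 1) := by
    conv_lhs => rw [← List.take_append_drop w (List.finRange n)]
    rw [List.drop_eq_getElem_cons (by simp [hw])]
    simp
  have hlen : (((List.finRange n).take w).map fun u => (adj u).length).sum =
      (((List.finRange n).take w).flatMap adj).length := by
    rw [List.length_flatMap]
  rw [hlen]
  conv_lhs => arg 1; arg 2; rw [hsplit]
  rw [List.flatMap_append, List.flatMap_cons, List.getD_eq_getElem?_getD, List.getElem?_map,
    List.getElem?_append_right (by omega), Nat.add_sub_cancel_left, List.getElem?_append_left hj,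
    List.getElem?_eq_getElem hj]
  rfl

/-! ### Loops over all vertices and over the neighbours of a vertex -/

/-- `a[u] := e` for all vertices `u`, where `u` is stored in array `26`. -/
def fill (a : ℕ) (e : Expr) : Prog := forTo 26 (sc 0) (.assign a (sc 26) e)

/-- The premise `σ' a u = σ a u` in `he` lets `e` read the old entry that it overwrites; the third
pass of `nbr` and the update of array `41` rely on it. -/
theorem runs_fill {a : ℕ} {e : Expr} {f : ℕ → ℕ} (hσ : Base adj k S σ) (ha : 4 ≤ a) (ha' : a ≠ 26)
    (he : ∀ u < n, ∀ σ' : Store, (∀ b, b ≠ a → b ≠ 26 → σ' b = σ b) → σ' 26 0 = u →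
      σ' a u = σ a u → e.eval σ' = f u) :
    Runs (fill a e) σ (n * (e.cost + 20) + 20) fun σ' =>
      (∀ b, b ≠ a → b ≠ 26 → σ' b = σ b) ∧ ∀ u < n, σ' a u = f u := by
  refine (Runs.forTo_const (m := n) (c := e.cost + 3) (I := fun j σ' =>
    (∀ b, b ≠ a → b ≠ 26 → σ' b = σ b) ∧ (∀ u < j, σ' a u = f u) ∧ ∀ u, j ≤ u → σ' a u = σ a u)
    ?_ ?_ ?_).mono ?_ ?_
  · intro j σ' h
    rw [eval_sc, h.1 0 (by omega) (by omega), hσ.size]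
  · refine ⟨fun b _ hb => σ.write_ne _ _ hb, by simp, fun u _ => ?_⟩
    rw [σ.write_ne _ _ ha']
  · rintro j hj τ hτ ⟨h1, h2, h3⟩
    have hv := he j hj τ h1 hτ (h3 j le_rfl)
    refine .flat rfl (by simp [Prog.time, sc, Expr.cost]; omega) ?_
    simp only [Prog.act, sc, Expr.eval, hτ, hv]
    refine ⟨by rw [Store.write_ne _ _ _ ha'.symm, hτ], fun b hb hb' => ?_, fun u hu => ?_, fun u hu => ?_⟩
    · rw [Store.write_ne _ _ _ hb', Store.write_ne _ _ _ hb, h1 b hb hb']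
    · rw [Store.write_ne _ _ _ ha', Store.write_same, Function.update_apply]
      split
      · next h => rw [h]
      · exact h2 u (by omega)
    · rw [Store.write_ne _ _ _ ha', Store.write_same, Function.update_of_ne (by omega)]
      exact h3 u (by omega)
  · simp only [sc, Expr.cost]
    ring_nf
    omega
  · exact fun σ' h => ⟨h.1, h.2.1⟩

/-- `a[0]` becomes the greatest vertex `u` that satisfies `e`, or `n` if there is none. -/
def find (a : ℕ) (e : Expr) : Prog :=
  set a (sc 0) ⨾ forTo 26 (sc 0) (.cond e (set a (sc 26)) .skip)

/-- Later hits overwrite earlier ones, so the result is the greatest, as `enum` requires. -/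
theorem runs_find {a : ℕ} {e : Expr} {P : ℕ → Prop} (hσ : Base adj k S σ) (ha : 4 ≤ a)
    (ha' : a ≠ 26)
    (he : ∀ u < n, ∀ σ' : Store, (∀ b, b ≠ a → b ≠ 26 → σ' b = σ b) → σ' 26 0 = u →
      (e.eval σ' ≠ 0 ↔ P u)) :
    Runs (find a e) σ (n * (e.cost + 20) + 20) fun σ' =>
      (∀ b, b ≠ a → b ≠ 26 → σ' b = σ b) ∧
      ((σ' a 0 = n ∧ ∀ u < n, ¬ P u) ∨
        (σ' a 0 < n ∧ P (σ' a 0) ∧ ∀ u < n, P u → u ≤ σ' a 0)) := by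
  have h0 : Runs (set a (sc 0)) σ 4 fun σ' => σ' = σ.write a 0 n :=
    .flat rfl (by simp [set, sc, Prog.time, Expr.cost])
      (by simp [set, sc, Prog.act, Expr.eval, hσ.size])
  refine (h0.seq fun τ hτ => Runs.forTo_const (m := n) (c := e.cost + 6) (I := fun j σ' =>
    (∀ b, b ≠ a → b ≠ 26 → σ' b = σ b) ∧ ((σ' a 0 = n ∧ ∀ u < j, ¬ P u) ∨
        (σ' a 0 < j ∧ P (σ' a 0) ∧ ∀ u < j, P u → u ≤ σ' a 0)))
    ?_ ?_ ?_).mono ?_ ?_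
  · intro j σ' h
    rw [eval_sc, h.1 0 (by omega) (by omega), hσ.size]
  · subst hτ
    refine ⟨fun b hb hb' => by rw [Store.write_ne _ _ _ hb', Store.write_ne _ _ _ hb], .inl ⟨?_, by simp⟩⟩
    rw [Store.write_ne _ _ _ ha', Store.write_same, Function.update_self]
  · rintro j hj τ' hτ' ⟨h1, h2⟩
    have hv := he j hj τ' h1 hτ'
    refine .flat rfl (by simp [Prog.time, sc, set, Expr.cost]) ?_
    simp only [Prog.act, sc, set, Expr.eval, hτ']
    split
    · next hb =>
      refine ⟨by rw [Store.write_ne _ _ _ ha'.symm, hτ'], fun b hb hb' => ?_, .inr ?_⟩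
      · rw [Store.write_ne _ _ _ hb', Store.write_ne _ _ _ hb, h1 b hb hb']
      · rw [Store.write_ne _ _ _ ha', Store.write_same, Function.update_self]
        exact ⟨by omega, hv.1 hb, fun u hu _ => by omega⟩
    · next hb =>
      have hP : ¬ P j := fun h => hb (hv.2 h)
      refine ⟨hτ', fun b hb hb' => ?_, ?_⟩
      · rw [Store.write_ne _ _ _ hb', h1 b hb hb']
      · rw [Store.write_ne _ _ _ ha']
        have split_lt : ∀ u < j + 1, P u → u < j := fun u hu hPu =>
          lt_of_le_of_ne (by omega) (by rintro rfl; exact hP hPu)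
        rcases h2 with ⟨h2, h3⟩ | ⟨h2, h3, h4⟩
        · exact .inl ⟨h2, fun u hu hPu => h3 u (split_lt u hu hPu) hPu⟩
        · exact .inr ⟨by omega, h3, fun u hu hPu => h4 u (split_lt u hu hPu) hPu⟩
  · simp only [sc, Expr.cost]
    ring_nf
    omega
  · exact fun σ' h => h

/-- Run `body` for all neighbours `x` of the vertex `wv[0]`, where `x` is stored in array `22`. -/
def forAdj (wv : ℕ) (body : Prog) : Prog :=
  set 25 (.get 1 (sc wv)) ⨾ .loop (.sub (.get 1 (.add (sc wv) (.lit 1))) (sc 25))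
    (set 22 (.get 2 (sc 25)) ⨾ body ⨾ set 25 (.add (sc 25) (.lit 1)))

/-- The invariant is indexed by the part of the adjacency list already treated; `hI` makes it
insensitive to the arrays `22` and `25` that the loop itself uses. -/
theorem Runs.forAdj {wv c : ℕ} {body : Prog} {w : Fin n} {I : List (Fin n) → Store → Prop}
    (hB : ∀ l σ, I l σ → Base adj k S σ ∧ σ wv 0 = w)
    (hI : ∀ l σ σ', (∀ a, a ≠ 22 → a ≠ 25 → σ' a = σ a) → I l σ → I l σ') (h0 : I [] σ)
    (hs : ∀ l (x : Fin n) l', adj w = l ++ x :: l' → ∀ σ, I l σ → σ 22 0 = x → Runs body σ c fun σ' =>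
      σ' 25 0 = σ 25 0 ∧ I (l ++ [x]) σ') :
    Runs (forAdj wv body) σ ((adj w).length * (c + 30) + 30) (I (adj w)) := by
  obtain ⟨hB0, hw0⟩ := hB _ _ h0
  have h1 : Runs (set 25 (.get 1 (sc wv))) σ 5 fun σ' => σ' = σ.write 25 0 (σ 1 w) :=
    .flat rfl (by simp [set, sc, Prog.time, Expr.cost])
      (by simp [set, sc, Prog.act, Expr.eval, hw0])
  let J : Store → Prop := fun τ => ∃ j ≤ (adj w).length, τ 25 0 = τ 1 w + j ∧ I ((adj w).take j) τ
  let φ : Store → ℕ := fun τ => (τ 1 (w + 1) - τ 25 0) * (c + 30)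
  have hJ : J (σ.write 25 0 (σ 1 w)) := by
    refine ⟨0, Nat.zero_le _, ?_, ?_⟩
    · rw [Store.write_same, Function.update_self, Store.write_ne _ _ _ (by decide), Nat.add_zero]
    · exact hI _ _ _ (fun a _ ha => Store.write_ne _ _ _ ha) h0
  refine (h1.seq (T' := (adj w).length * (c + 30) + 9) fun τ hτ =>
    (Runs.loop (I := J) (φ := φ) ?_ (hτ ▸ hJ)).mono ?_ fun _ h => h).mono ?_ ?_
  · clear * - hB hI hs
    rintro τ ⟨j, hj, hj25, hIj⟩ hb
    obtain ⟨hBτ, hwτ⟩ := hB _ _ hIj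
    simp only [Expr.eval, sc, hwτ, hBτ.off_succ, hj25] at hb
    have hjlt : j < (adj w).length := by omega
    refine ⟨c + 11, ?_⟩
    have e1 : Runs (set 22 (.get 2 (sc 25))) τ 5 fun σ' => σ' = τ.write 22 0 (adj w)[j] :=
      .flat rfl (by simp [set, sc, Prog.time, Expr.cost])
        (by simp [set, sc, Prog.act, Expr.eval, hj25, hBτ.arc w hjlt])
    refine (e1.seq fun τ1 hτ1 => (hs ((adj w).take j) (adj w)[j] ((adj w).drop (j + 1)) ?_ τ1 ?_ ?_).seq
      (T' := 6) fun τ2 hτ2 => ?_).mono (by omega) fun _ h => h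
    · rw [← List.drop_eq_getElem_cons hjlt, List.take_append_drop]
    · rw [hτ1]
      exact hI _ _ _ (fun a ha _ => Store.write_ne _ _ _ ha) hIj
    · rw [hτ1, Store.write_same, Function.update_self]
    · obtain ⟨h25, hI2⟩ := hτ2
      rw [hτ1, Store.write_ne _ _ _ (by decide), hj25] at h25
      have hB2 := (hB _ _ hI2).1
      have hoff : τ2 1 = τ 1 := by rw [hB2 1 (by omega), hBτ 1 (by omega)]
      refine .flat rfl (by simp [set, sc, Prog.time, Expr.cost]) ?_
      simp only [set, sc, Prog.act, Expr.eval, h25]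
      refine ⟨⟨j + 1, hjlt, ?_, ?_⟩, ?_⟩
      · rw [Store.write_same, Function.update_self, Store.write_ne _ _ _ (by decide), hoff]
        omega
      · rw [List.take_add_one, List.getElem?_eq_getElem hjlt]
        exact hI _ _ _ (fun a _ ha => Store.write_ne _ _ _ ha) hI2
      · simp only [φ, Expr.cost]
        rw [Store.write_same, Function.update_self, Store.write_ne _ _ _ (by decide), hoff, hj25,
          hBτ.off_succ]
        obtain ⟨d, hd⟩ : ∃ d, (adj w).length = j + 1 + d := ⟨_, (Nat.add_sub_cancel' hjlt).symm⟩
        rw [show τ 1 w + (adj w).length - (τ 1 w + j) = d + 1 by omega,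
          show τ 1 w + (adj w).length - (τ 1 w + j + 1) = d by omega, Nat.add_mul]
        omega
  · subst hτ
    simp only [φ, Expr.cost, sc]
    rw [Store.write_same, Function.update_self, Store.write_ne _ _ _ (by decide), hB0.off_succ]
    simp
  · omega
  · rintro τ ⟨⟨j, hj, hj25, hIj⟩, hb⟩
    obtain ⟨hBτ, hwτ⟩ := hB _ _ hIj
    simp only [Expr.eval, sc, hwτ, hBτ.off_succ, hj25] at hb
    rwa [List.take_of_length_le (by omega)] at hIj

end Vertices

/-! ## Neighbourhoods and graph search

The arrays of the program are used as follows.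
`5`: the bound `p`; `6`: the number `L` of branchings; `7`: powers of two;
`10`, `11`: the sets `Z` and `T` of the enumeration; `12`: the flow;
`13`, `14`, `15`: search numbers, search parents and queue; `16`, `17`: starting and blocked vertices;
`18`, `19`: head and tail of the queue; `20`, `21`, `22`: vertices under inspection;
`23`, `24`: output and input of the neighbourhood computation; `25`, `26`: counters of loops over
neighbours and vertices; `27`, `28`, `29`: flow value, round, and end of the augmenting path;
`30`: status; `31`, `32`: the guess and the branching depth; `33`, `34`, `35`: counters of the main
loops; `36`: the candidate; `37`, `38`, `39`: results of its comparison;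
`41`, `42`: the vertices in a neighbourhood of a maximal chip and those in a maximal chip. -/

section Search

variable {n : ℕ} {G : SimpleGraph (Fin n)} {adj : Fin n → List (Fin n)} {k : ℕ}
  {S : Finset (Fin n)} {σ : Store}

/-- The size of the input, up to a constant factor. -/
def size (adj : Fin n → List (Fin n)) : ℕ := n + ∑ u, (adj u).length + 1

theorem vs_update {f : ℕ → ℕ} {x : Fin n} {c : ℕ} (hc : c ≠ 0) :
    vs n (Function.update f x c) = insert x (vs n f) := by
  ext u
  by_cases h : u = x
  · simp [mem_vs, h, hc]
  · have : (u : ℕ) ≠ x := fun h' => h (Fin.ext h')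
    simp [mem_vs, h, this]

/-- Array `23` becomes the neighbourhood of the set in array `24`. -/
def nbr : Prog :=
  fill 23 (.lit 0) ⨾
  forTo 26 (sc 0) (.cond (.get 24 (sc 26)) (forAdj 26 (.assign 23 (sc 22) (.lit 1))) .skip) ⨾
  fill 23 (.both (.get 23 (sc 26)) (.neg (.get 24 (sc 26))))

theorem runs_nbr (hadj : IsAdjList G adj) (hσ : Base adj k S σ) :
    Runs nbr σ (200 * size adj) fun σ' => vs n (σ' 23) = nbhd G (vs n (σ 24)) := by
  have h1 := runs_fill (a := 23) (e := .lit 0) (f := fun _ => 0) hσ (by decide) (by decide)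
    (fun _ _ _ _ _ _ => rfl)
  refine (h1.seq fun σ1 ⟨hf1, hz1⟩ => (Runs.forTo (m := n)
    -- Each vertex is charged for its own degree, which keeps the total linear in the input.
    (T := fun j => if h : j < n then (adj ⟨j, h⟩).length * 34 + 40 else 0)
    (I := fun j τ => Base adj k S τ ∧ τ 24 = σ 24 ∧
      vs n (τ 23) = {x | ∃ u : Fin n, (u : ℕ) < j ∧ u ∈ vs n (σ 24) ∧ G.Adj u x})
    ?_ ?_ ?_).seq fun σ2 ⟨hB2, h24, h23⟩ => (runs_fill (a := 23)
      (f := fun u => if σ2 23 u ≠ 0 ∧ σ2 24 u = 0 then 1 else 0)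
      hB2 (by decide) (by decide) ?_).mono le_rfl ?_).mono ?_ fun _ h => h
  · intro j τ h
    exact h.1.size
  · refine ⟨(hσ.of_frame fun a ha => hf1 a (by omega) (by omega)).write (by decide), ?_, ?_⟩
    · rw [Store.write_ne _ _ _ (by decide), hf1 24 (by decide) (by decide)]
    · rw [Store.write_ne _ _ _ (by decide)]
      ext u
      simp [mem_vs, hz1 u u.2]
  · rintro j hj τ hτ ⟨hB, hτ24, hτ23⟩
    refine Runs.mono (Runs.cond (T := (adj ⟨j, hj⟩).length * 34 + 30) (T' := 1) (fun hb => ?_)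
      fun hb => .flat rfl le_rfl ?_) ?_ fun _ h => h
    · have := Runs.forAdj (wv := 26) (c := 4) (w := ⟨j, hj⟩) (adj := adj) (k := k) (S := S) (σ := τ)
        (body := .assign 23 (sc 22) (.lit 1))
        (I := fun l ρ => Base adj k S ρ ∧ ρ 26 0 = j ∧ ρ 24 = σ 24 ∧
          vs n (ρ 23) = vs n (τ 23) ∪ {x | x ∈ l}) ?_ ?_ ?_ ?_
      · refine this.mono (by omega) ?_
        rintro ρ ⟨hBρ, h26, hρ24, hρ23⟩
        refine ⟨h26, hBρ.write (by decide), ?_, ?_⟩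
        · rwa [Store.write_ne _ _ _ (by decide)]
        · rw [Store.write_ne _ _ _ (by decide), hρ23, hτ23]
          have hj' : (⟨j, hj⟩ : Fin n) ∈ vs n (σ 24) := by
            rw [← hτ24, mem_vs]
            simpa [sc, Expr.eval, hτ] using hb
          ext x
          simp only [Set.mem_union, Set.mem_ofPred_eq, (hadj _).2]
          constructor
          · rintro (⟨u, hu, h⟩ | h)
            · exact ⟨u, by omega, h⟩
            · exact ⟨⟨j, hj⟩, Nat.lt_succ_self j, hj', h⟩
          · rintro ⟨u, hu, h⟩
            by_cases huj : (u : ℕ) = j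
            · right
              rw [show u = ⟨j, hj⟩ from Fin.ext huj] at h
              exact h.2
            · exact .inl ⟨u, by omega, h⟩
      · exact fun l ρ h => ⟨h.1, h.2.1⟩
      · rintro l ρ ρ' hf ⟨a1, a2, a3, a4⟩
        refine ⟨a1.of_frame fun a ha => hf a (by omega) (by omega), ?_, ?_, ?_⟩
        · rwa [hf 26 (by decide) (by decide)]
        · rwa [hf 24 (by decide) (by decide)]
        · rwa [hf 23 (by decide) (by decide)]
      · exact ⟨hB, hτ, hτ24, by simp⟩
      · rintro l x l' hl ρ ⟨a1, a2, a3, a4⟩ hx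
        refine .flat rfl (by simp [Prog.time, sc, Expr.cost]) ?_
        simp only [Prog.act, sc, Expr.eval, hx]
        refine ⟨?_, a1.write (by decide), ?_, ?_, ?_⟩
        · rw [Store.write_ne _ _ _ (by decide)]
        · rwa [Store.write_ne _ _ _ (by decide)]
        · rwa [Store.write_ne _ _ _ (by decide)]
        · rw [Store.write_same, vs_update one_ne_zero, a4]
          ext y
          simp only [Set.mem_insert_iff, Set.mem_union, Set.mem_ofPred_eq, List.mem_append,
            List.mem_singleton]
          tauto
    · refine ⟨hτ, hB.write (by decide), ?_, ?_⟩
      · simpa [Prog.act, Store.write_ne] using hτ24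
      · rw [Store.write_ne _ _ _ (by decide)]
        change vs n (τ 23) = _
        rw [hτ23]
        have hj' : (⟨j, hj⟩ : Fin n) ∉ vs n (σ 24) := by
          rw [← hτ24, mem_vs]
          simpa [sc, Expr.eval, hτ] using hb
        ext x
        simp only [Set.mem_ofPred_eq]
        constructor
        · rintro ⟨u, hu, h⟩
          exact ⟨u, by omega, h⟩
        · rintro ⟨u, hu, h⟩
          refine ⟨u, ?_, h⟩
          by_contra hlt
          exact hj' ((show u = ⟨j, hj⟩ from Fin.ext (by simp; omega)) ▸ h.1)
    · simp only [hj, dite_true, Expr.cost, sc]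
      omega
  · intro u hu τ hf h26 h23
    simp only [Expr.both, Expr.neg, Expr.eval, sc, h26, h23, hf 24 (by decide) (by decide)]
    split <;> omega
  · rintro σ3 ⟨hf3, h3⟩
    ext x
    rw [mem_vs, h3 x x.2]
    have hx23 : σ2 23 x ≠ 0 ↔ ∃ u : Fin n, u ∈ vs n (σ 24) ∧ G.Adj u x := by
      rw [← mem_vs, h23]
      simp
    simp only [ne_eq, ite_eq_right_iff, one_ne_zero, imp_false, not_not]
    rw [← ne_eq, hx23, h24]
    simp only [nbhd, Set.mem_ofPred_eq, mem_vs, ne_eq, not_not]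
    tauto
  · rw [Finset.sum_range]
    simp only [Fin.is_lt, dite_true, Fin.eta, Expr.cost, sc, Expr.both, Expr.neg, size, Finset.sum_add_distrib,
      ← Finset.sum_mul, Finset.sum_const, Finset.card_univ, Fintype.card_fin, smul_eq_mul]
    omega

/-! ### Invariant of the search -/

/-- State of the search: search numbers `act`, parents `par`, queue `que` with `tail` entries, of
which the first `h` have been processed. -/
structure SInv (G : SimpleGraph (Fin n)) (T Z : Set (Fin n)) (q : Fin n → Option (Fin n))
    (act par que : ℕ → ℕ) (tail h : ℕ) : Prop where
  que_act : ∀ i < tail, ∃ u : Fin n, que i = u ∧ act u = i + 1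
  act_que : ∀ u : Fin n, act u ≠ 0 → act u ≤ tail ∧ que (act u - 1) = u
  avoid : ∀ u : Fin n, act u ≠ 0 → u ∉ Z
  least : ∀ X : Set (Fin n), T ⊆ X → (∀ u ∈ X, ∀ x, Step G q u x → x ∉ Z → x ∈ X) →
    vs n act ⊆ X
  par_spec : ∀ u : Fin n, act u ≠ 0 → (dec n (par u) = none ∧ u ∈ T) ∨
    ∃ u', dec n (par u) = some u' ∧ act u' ≠ 0 ∧ act u' < act u ∧ Step G q u' u
  closed : ∀ u : Fin n, act u ≠ 0 → act u ≤ h → ∀ x : Fin n, Step G q u x → x ∉ Z → act x ≠ 0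
  head_le : h ≤ tail

variable {T Z : Set (Fin n)} {q : Fin n → Option (Fin n)}

/-- The new number `tail + 1` exceeds all earlier ones, so parents have smaller numbers than their
children, and, as `h ≤ tail`, the new vertex does not yet count as processed. -/
theorem SInv.push {act par que : ℕ → ℕ} {tail h pv : ℕ} {x : Fin n}
    (hI : SInv G T Z q act par que tail h) (hx : act x = 0) (hxZ : x ∉ Z)
    (hp : (dec n pv = none ∧ x ∈ T) ∨ ∃ u', dec n pv = some u' ∧ act u' ≠ 0 ∧ Step G q u' x) :
    SInv G T Z q (Function.update act x (tail + 1)) (Function.update par x pv)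
      (Function.update que tail x) (tail + 1) h := by
  have hne : ∀ u : Fin n, u ≠ x → (u : ℕ) ≠ x := fun u hu h => hu (Fin.ext h)
  have hact : ∀ u : Fin n, act u ≠ 0 → u ≠ x := by
    rintro u hu rfl
    exact hu hx
  refine ⟨fun i hi => ?_, fun u hu => ?_, fun u hu => ?_, fun X hT hX => ?_, fun u hu => ?_,
    fun u hu huh y hs hy => ?_, hI.head_le.trans (Nat.le_succ _)⟩
  · by_cases hit : i = tail
    · exact ⟨x, by simp [hit], by simp [hit]⟩
    · obtain ⟨u, h1, h2⟩ := hI.que_act i (by omega)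
      refine ⟨u, by simp [hit, h1], ?_⟩
      rw [Function.update_of_ne (hne u (hact u (by omega))), h2]
  · by_cases hux : u = x
    · simp [hux]
    · rw [Function.update_of_ne (hne u hux)] at hu ⊢
      obtain ⟨h1, h2⟩ := hI.act_que u hu
      refine ⟨by omega, ?_⟩
      rw [Function.update_of_ne (by omega), h2]
  · by_cases hux : u = x
    · rwa [hux]
    · rw [Function.update_of_ne (hne u hux)] at hu
      exact hI.avoid u hu
  · rw [vs_update (by omega)]
    have := hI.least X hT hX
    refine Set.insert_subset ?_ this
    rcases hp with ⟨-, h⟩ | ⟨u', -, hu', hs⟩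
    · exact hT h
    · exact hX u' (this hu') x hs hxZ
  · by_cases hux : u = x
    · subst hux
      simp only [Function.update_self]
      refine hp.imp id ?_
      rintro ⟨u', h1, h2, h3⟩
      refine ⟨u', h1, ?_⟩
      rw [Function.update_of_ne (hne _ (hact u' h2))]
      exact ⟨h2, by have := (hI.act_que u' h2).1; omega, h3⟩
    · rw [Function.update_of_ne (hne u hux)] at hu
      rw [Function.update_of_ne (hne u hux), Function.update_of_ne (hne u hux)]
      refine (hI.par_spec u hu).imp id ?_
      rintro ⟨u', h1, h2, h3⟩
      refine ⟨u', h1, ?_⟩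
      rw [Function.update_of_ne (hne _ (hact u' h2))]
      exact ⟨h2, h3⟩
  · by_cases hyx : y = x
    · simp [hyx]
    rw [Function.update_of_ne (hne y hyx)]
    by_cases hux : u = x
    · have := hI.head_le
      rw [hux, Function.update_self] at huh
      omega
    · rw [Function.update_of_ne (hne u hux)] at hu huh
      exact hI.closed u hu huh y hs hy

/-- Put the vertex `22[0]` into the queue, with parent `20[0]`, unless this was done before. -/
def visit : Prog :=
  .cond (.both (.neg (.get 13 (sc 22))) (.neg (.get 17 (sc 22))))
    (.assign 13 (sc 22) (.add (sc 19) (.lit 1)) ⨾ .assign 14 (sc 22) (sc 20) ⨾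
      .assign 15 (sc 19) (sc 22) ⨾ set 19 (.add (sc 19) (.lit 1)))
    .skip

/-- `SInv` for the arrays of the program. -/
def SState (G : SimpleGraph (Fin n)) (T Z : Set (Fin n)) (q : Fin n → Option (Fin n))
    (σ : Store) (h : ℕ) : Prop := SInv G T Z q (σ 13) (σ 14) (σ 15) (σ 19 0) h

theorem runs_visit {h : ℕ} {x : Fin n} (hI : SState G T Z q σ h) (hZ : vs n (σ 17) = Z)
    (hx : σ 22 0 = x) (hp : (dec n (σ 20 0) = none ∧ x ∈ T) ∨
      ∃ u' : Fin n, dec n (σ 20 0) = some u' ∧ σ 13 u' ≠ 0 ∧ Step G q u' x) :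
    Runs visit σ 50 fun σ' => (SState G T Z q σ' h ∧ (x ∉ Z → σ' 13 x ≠ 0) ∧
      ∀ u : Fin n, σ 13 u ≠ 0 → σ' 13 u = σ 13 u) ∧ ∀ a, a ∉ [13, 14, 15, 19] → σ' a = σ a := by
  have hb : (Expr.both (.neg (.get 13 (sc 22))) (.neg (.get 17 (sc 22)))).eval σ ≠ 0 ↔
      σ 13 x = 0 ∧ x ∉ Z := by
    rw [Expr.eval_both, Expr.eval_neg, Expr.eval_neg, ← hZ, mem_vs]
    simp [sc, Expr.eval, hx]
  refine (Runs.flat (Q := fun σ' => SState G T Z q σ' h ∧ (x ∉ Z → σ' 13 x ≠ 0) ∧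
      ∀ u : Fin n, σ 13 u ≠ 0 → σ' 13 u = σ 13 u) rfl
    (by simp [visit, set, Prog.time, sc, Expr.cost, Expr.both, Expr.neg]) ?_).frame.mono
    le_rfl fun σ' h' => ⟨h'.1, fun a ha => h'.2 a (by simpa [visit, set, Prog.mods] using ha)⟩
  simp only [visit, Prog.act]
  split
  · next hb' =>
    obtain ⟨h1, h2⟩ := hb.1 hb'
    have := SInv.push hI h1 h2 hp
    simp only [SState, Prog.act, set, sc, Expr.eval, Store.write, Function.update_self, hx,
      Function.update_of_ne, ne_eq, Nat.reduceEqDiff, not_false_eq_true]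
    refine ⟨this, by simp, fun u hu => ?_⟩
    rw [Function.update_of_ne]
    intro hux
    rw [hux, h1] at hu
    exact hu rfl
  · next hb' =>
    rw [hb, not_and_not_right] at hb'
    exact ⟨hI, fun hxZ h0 => hxZ (hb' h0), fun u _ => rfl⟩

/-- Search from the vertices in array `16` along the steps of the flow in array `12`, avoiding the
vertices in array `17`. -/
def search : Prog :=
  fill 13 (.lit 0) ⨾ set 19 (.lit 0) ⨾ set 20 (sc 0) ⨾
  forTo 26 (sc 0) (.cond (.get 16 (sc 26)) (set 22 (sc 26) ⨾ visit) .skip) ⨾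
  set 18 (.lit 0) ⨾
  .loop (.sub (sc 19) (sc 18))
    (set 20 (.get 15 (sc 18)) ⨾ set 18 (.add (sc 18) (.lit 1)) ⨾ set 21 (.get 12 (sc 20)) ⨾
      .cond (.sub (sc 0) (sc 21)) (set 22 (sc 21) ⨾ visit ⨾ forAdj 21 visit) .skip)

theorem sum_add_le_sum {ι : Type*} [Fintype ι] {f g : ι → ℕ} {K : ℕ} (v : ι)
    (h : ∀ u, f u ≤ g u) (hv : f v + K ≤ g v) : (∑ u, f u) + K ≤ ∑ u, g u := by
  classical
  rw [← Finset.add_sum_erase _ _ (Finset.mem_univ v), ← Finset.add_sum_erase _ g (Finset.mem_univ v)]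
  have := Finset.sum_le_sum (s := Finset.univ.erase v) fun u _ => h u
  omega

/-- No vertex is the predecessor of two others, so scanning the lists of all predecessors is at most
one pass over all lists. -/
theorem sum_length_le (hq : ∀ u u' w, q u = some w → q u' = some w → u = u') :
    ∑ u, ((q u).elim 0 fun w => (adj w).length) ≤ ∑ u, (adj u).length := by
  classical
  have h1 : ∀ u, ((q u).elim 0 fun w => (adj w).length) =
      ∑ w, if q u = some w then (adj w).length else 0 := by
    intro u
    rcases hu : q u with _ | w <;> simp
  simp only [h1]
  rw [Finset.sum_comm]
  refine Finset.sum_le_sum fun w _ => ?_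
  rw [← Finset.sum_filter, Finset.sum_const, smul_eq_mul]
  have : (Finset.univ.filter fun u => q u = some w).card ≤ 1 := by
    rw [Finset.card_le_one]
    intro a ha b hb
    simp only [Finset.mem_filter, Finset.mem_univ, true_and] at ha hb
    exact hq a b w ha hb
  exact (Nat.mul_le_mul_right _ this).trans_eq (Nat.one_mul _)

end Search

/-! ### Correctness and linear running time of the search -/

section SearchLoop

variable {n : ℕ} {G : SimpleGraph (Fin n)} {adj : Fin n → List (Fin n)} {k : ℕ}
  {S : Finset (Fin n)} {σ : Store} {T Z : Set (Fin n)} {q : Fin n → Option (Fin n)}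

theorem Runs.set_seq {p : Prog} {a t : ℕ} {e : Expr} {Q : Store → Prop}
    (h : Runs p (σ.write a 0 (e.eval σ)) t Q) : Runs (set a e ⨾ p) σ (e.cost + 2 + t) Q := by
  have h1 : Runs (set a e) σ (e.cost + 2) fun σ' => σ' = σ.write a 0 (e.eval σ) :=
    .flat rfl (by simp [set, Prog.time, Expr.cost]; omega) rfl
  exact h1.seq fun _ h' => h' ▸ h

theorem SState.congr {σ' : Store} {h : ℕ} (hI : SState G T Z q σ h) (h13 : σ' 13 = σ 13)
    (h14 : σ' 14 = σ 14) (h15 : σ' 15 = σ 15) (h19 : σ' 19 = σ 19) : SState G T Z q σ' h := by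
  unfold SState
  rwa [h13, h14, h15, h19]

/-- The queue recovers a vertex from its search number, so `v` is the only vertex that becomes
processed. -/
theorem SInv.succ {act par que : ℕ → ℕ} {tail h : ℕ} {v : Fin n}
    (hI : SInv G T Z q act par que tail h) (hv : act v = h + 1)
    (hc : ∀ x : Fin n, Step G q v x → x ∉ Z → act x ≠ 0) :
    SInv G T Z q act par que tail (h + 1) :=
  { hI with
    closed := fun u hu huh x hs hx => by
      by_cases hu' : act u ≤ h
      · exact hI.closed u hu hu' x hs hx
      · have h1 := (hI.act_que u hu).2
        have h2 := (hI.act_que v (by omega)).2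
        rw [show act u = act v by omega, h2] at h1
        rw [show u = v from Fin.ext h1.symm] at hs
        exact hc x hs hx
    head_le := by
      have := (hI.act_que v (by omega)).1
      omega }

/-- Starting vertices get the parent `n`, which is no vertex; the walk back along parents recognises
its end by it. -/
theorem runs_search_start (hσ : Base adj k S σ) (hT : vs n (σ 16) = T) (hZ : vs n (σ 17) = Z)
    (hTZ : Disjoint T Z) (h13 : ∀ u < n, σ 13 u = 0) (h19 : σ 19 0 = 0) (h20 : σ 20 0 = n) :
    Runs (forTo 26 (sc 0) (.cond (.get 16 (sc 26)) (set 22 (sc 26) ⨾ visit) .skip)) σ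
      (n * 80 + 20) fun σ' => SState G T Z q σ' 0 ∧ T ⊆ vs n (σ' 13) := by
  refine (Runs.forTo_const (m := n) (c := 60) (I := fun j τ => Base adj k S τ ∧ τ 16 = σ 16 ∧
    τ 17 = σ 17 ∧ τ 20 0 = n ∧ SState G T Z q τ 0 ∧
    ∀ u : Fin n, (u : ℕ) < j → u ∈ T → τ 13 u ≠ 0) ?_ ?_ ?_).mono ?_ ?_
  · exact fun j τ h => h.1.size
  · refine ⟨hσ.write (by decide), ?_, ?_, ?_, ?_, by simp⟩
    · rw [Store.write_ne _ _ _ (by decide)]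
    · rw [Store.write_ne _ _ _ (by decide)]
    · rwa [Store.write_ne _ _ _ (by decide)]
    · unfold SState
      simp only [Store.write_ne, ne_eq, Nat.reduceEqDiff, not_false_eq_true, h19]
      have h0 : ∀ u : Fin n, σ 13 u = 0 := fun u => h13 u u.2
      exact ⟨by simp, by simp [h0], by simp [h0], fun X _ _ u hu => absurd (h0 u) hu,
        by simp [h0], by simp [h0], le_rfl⟩
  · rintro j hj τ hτ ⟨a1, a2, a3, a4, a5, a6⟩
    refine (Runs.cond (T := 54) (T' := 1) (fun hb => ?_) fun hb => .flat rfl le_rfl ?_).mono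
      (by simp [Expr.cost, sc]) fun _ h => h
    · simp only [Expr.eval, sc, hτ] at hb
      refine (Runs.set_seq (t := 50) ?_).mono (by simp [Expr.cost, sc]) fun _ h => h
      have hjT : (⟨j, hj⟩ : Fin n) ∈ T := by rw [← hT, mem_vs, ← a2]; exact hb
      have ev : (sc 26).eval τ = j := hτ
      rw [ev]
      refine (runs_visit (G := G) (T := T) (Z := Z) (q := q) (x := ⟨j, hj⟩) (h := 0)
        (a5.congr ?_ ?_ ?_ ?_) ?_ ?_ (.inl ⟨?_, hjT⟩)).mono le_rfl ?_
      · rw [Store.write_ne _ _ _ (by decide)]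
      · rw [Store.write_ne _ _ _ (by decide)]
      · rw [Store.write_ne _ _ _ (by decide)]
      · rw [Store.write_ne _ _ _ (by decide)]
      · rw [Store.write_ne _ _ _ (by decide), a3, hZ]
      · rw [Store.write_same, Function.update_self]
      · rw [Store.write_ne _ _ _ (by decide), a4, dec_self]
      · rintro ρ ⟨⟨b1, b2, b3⟩, hf⟩
        have hf' : ∀ a, a ∉ [13, 14, 15, 19, 22] → ρ a = τ a := fun a ha => by
          simp only [List.mem_cons, List.not_mem_nil, not_or] at ha
          rw [hf a (by simp; omega), Store.write_ne _ _ _ (by tauto)]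
        refine ⟨by rw [hf' 26 (by decide), hτ], (a1.of_frame fun a ha => hf' a ?_).write (by decide),
          ?_, ?_, ?_, ?_, ?_⟩
        · simp; omega
        · rw [Store.write_ne _ _ _ (by decide), hf' 16 (by decide), a2]
        · rw [Store.write_ne _ _ _ (by decide), hf' 17 (by decide), a3]
        · rw [Store.write_ne _ _ _ (by decide), hf' 20 (by decide), a4]
        · refine b1.congr ?_ ?_ ?_ ?_ <;> rw [Store.write_ne _ _ _ (by decide)]
        · intro u hu huT
          rw [Store.write_ne _ _ _ (by decide)]
          by_cases huj : (u : ℕ) = j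
          · rw [huj]
            exact b2 (Set.disjoint_left.1 hTZ hjT)
          · have := a6 u (by omega) huT
            rw [b3 u (by rwa [Store.write_ne _ _ _ (by decide)]), Store.write_ne _ _ _ (by decide)]
            exact this
    · simp only [Expr.eval, sc, hτ] at hb
      refine ⟨hτ, a1.write (by decide), ?_, ?_, ?_, ?_, ?_⟩
      · rw [Store.write_ne _ _ _ (by decide)]; exact a2
      · rw [Store.write_ne _ _ _ (by decide)]; exact a3
      · rw [Store.write_ne _ _ _ (by decide)]; exact a4
      · refine a5.congr ?_ ?_ ?_ ?_ <;> rw [Store.write_ne _ _ _ (by decide)] <;> rfl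
      · intro u hu huT
        rw [Store.write_ne _ _ _ (by decide)]
        by_cases huj : (u : ℕ) = j
        · rw [← hT, mem_vs, ← a2, huj] at huT
          exact absurd hb huT
        · exact a6 u (by omega) huT
  · simp only [Expr.cost, sc]
    omega
  · rintro τ ⟨-, -, -, -, h5, h6⟩
    exact ⟨h5, fun u hu => h6 u u.2 hu⟩

/-- What is known while the entry `v` of the queue is processed, started in memory `τ`. -/
structure SearchMid (adj : Fin n → List (Fin n)) (k : ℕ) (S : Finset (Fin n))
    (G : SimpleGraph (Fin n)) (T Z : Set (Fin n)) (q : Fin n → Option (Fin n))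
    (τ : Store) (v : Fin n) (ρ : Store) : Prop where
  base : Base adj k S ρ
  flow : ρ 12 = τ 12
  block : ρ 17 = τ 17
  head : ρ 18 0 = τ 18 0 + 1
  cur : ρ 20 0 = v
  next : ρ 21 0 = τ 12 v
  state : SState G T Z q ρ (τ 18 0)
  keep : ∀ u : Fin n, τ 13 u ≠ 0 → ρ 13 u = τ 13 u

theorem SearchMid.of_frame {τ ρ ρ' : Store} {v : Fin n} (h : SearchMid adj k S G T Z q τ v ρ)
    (hf : ∀ a, a ≠ 22 → a ≠ 25 → ρ' a = ρ a) : SearchMid adj k S G T Z q τ v ρ' := by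
  obtain ⟨h1, h2, h3, h4, h5, h6, h7, h8⟩ := h
  refine ⟨h1.of_frame fun a ha => hf a (by omega) (by omega), ?_, ?_, ?_, ?_, ?_, h7.congr ?_ ?_ ?_ ?_, ?_⟩
  all_goals rw [hf _ (by decide) (by decide)]
  all_goals assumption

theorem SearchMid.runs_visit {τ ρ : Store} {v x : Fin n} (h : SearchMid adj k S G T Z q τ v ρ)
    (hZ : vs n (τ 17) = Z) (hv : τ 13 v ≠ 0) (hx : ρ 22 0 = x) (hs : Step G q v x) :
    Runs visit ρ 50 fun ρ' => SearchMid adj k S G T Z q τ v ρ' ∧ ρ' 25 0 = ρ 25 0 ∧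
      (x ∉ Z → ρ' 13 x ≠ 0) ∧ ∀ u : Fin n, ρ 13 u ≠ 0 → ρ' 13 u ≠ 0 := by
  obtain ⟨h1, h2, h3, h4, h5, h6, h7, h8⟩ := h
  refine (LocalDecomp.runs_visit h7 (by rw [h3, hZ]) hx (.inr ⟨v, by rw [h5, dec_val], ?_, hs⟩)).mono
    le_rfl ?_
  · rwa [h8 v hv]
  · rintro ρ' ⟨⟨b1, b2, b3⟩, hf⟩
    refine ⟨⟨h1.of_frame fun a ha => hf a ?_, ?_, ?_, ?_, ?_, ?_, b1, fun u hu => ?_⟩, ?_, b2, ?_⟩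
    · simp; omega
    · rw [hf _ (by decide), h2]
    · rw [hf _ (by decide), h3]
    · rw [hf _ (by decide), h4]
    · rw [hf _ (by decide), h5]
    · rw [hf _ (by decide), h6]
    · rw [b3 u (by rwa [h8 u hu]), h8 u hu]
    · rw [hf _ (by decide)]
    · intro u hu
      rwa [b3 u hu]

theorem runs_search_step (hadj : IsAdjList G adj) {τ : Store} {v : Fin n}
    (hZ : vs n (τ 17) = Z) (hq : ∀ u : Fin n, dec n (τ 12 u) = q u) (hB : Base adj k S τ)
    (hv : τ 15 (τ 18 0) = v) (hv' : τ 13 v = τ 18 0 + 1) (hI : SState G T Z q τ (τ 18 0)) :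
    Runs (set 20 (.get 15 (sc 18)) ⨾ set 18 (.add (sc 18) (.lit 1)) ⨾ set 21 (.get 12 (sc 20)) ⨾
      .cond (.sub (sc 0) (sc 21)) (set 22 (sc 21) ⨾ visit ⨾ forAdj 21 visit) .skip) τ
      (((q v).elim 0 fun w => (adj w).length) * 80 + 150) fun ρ =>
        SearchMid adj k S G T Z q τ v ρ ∧ ∀ x : Fin n, Step G q v x → x ∉ Z → ρ 13 x ≠ 0 := by
  have hv0 : τ 13 v ≠ 0 := by omega
  refine (Runs.set_seq (Runs.set_seq (Runs.set_seq
    (t := ((q v).elim 0 fun w => (adj w).length) * 80 + 120) ?_))).mono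
    (by simp [Expr.cost, sc]; omega) fun _ h => h
  have e1 : (Expr.get 15 (sc 18)).eval τ = v := hv
  rw [e1]
  set τ1 := τ.write 20 0 v with hτ1
  have e2 : (Expr.add (sc 18) (.lit 1)).eval τ1 = τ 18 0 + 1 := by
    simp [sc, Expr.eval, hτ1, Store.write_ne]
  rw [e2]
  set τ2 := τ1.write 18 0 (τ 18 0 + 1) with hτ2
  have e3 : (Expr.get 12 (sc 20)).eval τ2 = τ 12 v := by
    simp [sc, Expr.eval, hτ2, hτ1, Store.write_ne, Store.write_same]
  rw [e3]
  have hM : SearchMid adj k S G T Z q τ v (τ2.write 21 0 (τ 12 v)) := by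
    refine ⟨((hB.write (by decide)).write (by decide)).write (by decide), ?_, ?_, ?_, ?_, ?_,
      hI.congr ?_ ?_ ?_ ?_, fun u _ => ?_⟩ <;> simp [hτ2, hτ1, Store.write_ne, Store.write_same]
  generalize τ2.write 21 0 (τ 12 v) = τ3 at hM ⊢
  clear hτ1 hτ2 e1 e2 e3 τ1 τ2
  have hqv := hq v
  have e4 : (Expr.sub (sc 0) (sc 21)).eval τ3 = n - τ 12 v := by
    simp [sc, Expr.eval, hM.base.size, hM.next]
  refine (Runs.cond (T := ((q v).elim 0 fun w => (adj w).length) * 80 + 110) (T' := 1)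
    (fun hb => ?_) fun hb => .flat rfl le_rfl ⟨hM, ?_⟩).mono (by simp [Expr.cost, sc]; omega)
    fun _ h => h
  · rw [e4] at hb
    obtain ⟨w, hw⟩ : ∃ w : Fin n, τ 12 v = w := ⟨⟨τ 12 v, by omega⟩, rfl⟩
    rw [hw, dec_val] at hqv
    rw [← hqv, Option.elim_some]
    refine (Runs.set_seq (t := 50 + ((adj w).length * 80 + 30)) (?_ : Runs _ _ _ _)).mono
      (by simp [Expr.cost, sc]; omega) fun _ h => h
    have e5 : (sc 21).eval τ3 = w := by simp [sc, Expr.eval, hM.next, hw]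
    rw [e5]
    have hM4 : SearchMid adj k S G T Z q τ v (τ3.write 22 0 w) :=
      hM.of_frame fun a ha _ => Store.write_ne _ _ _ ha
    have h22 : (τ3.write 22 0 w) 22 0 = w := by simp [Store.write_same]
    generalize τ3.write 22 0 w = τ4 at hM4 h22 ⊢
    refine (hM4.runs_visit hZ hv0 h22 ⟨w, hqv.symm, .inl rfl⟩).seq fun τ5 ⟨c1, _, c3, _⟩ => ?_
    refine (Runs.forAdj (wv := 21) (c := 50) (w := w) (adj := adj) (k := k) (S := S)
      (I := fun l ρ => SearchMid adj k S G T Z q τ v ρ ∧ (w ∉ Z → ρ 13 w ≠ 0) ∧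
        ∀ x ∈ l, x ∉ Z → ρ 13 x ≠ 0) ?_ ?_ ⟨c1, c3, by simp⟩ ?_).mono le_rfl ?_
    · rintro l ρ ⟨d1, -⟩
      exact ⟨d1.base, by rw [d1.next, hw]⟩
    · rintro l ρ ρ' hf ⟨d1, d2, d3⟩
      rw [hf 13 (by decide) (by decide)]
      exact ⟨d1.of_frame hf, d2, d3⟩
    · rintro l x l' hl ρ ⟨d1, d2, d3⟩ hx
      have hwx : G.Adj w x := ((hadj w).2 x).1 (by rw [hl]; simp)
      refine (d1.runs_visit hZ hv0 hx ⟨w, hqv.symm, .inr hwx⟩).mono le_rfl ?_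
      rintro ρ' ⟨f1, f2, f3, f4⟩
      refine ⟨f2, f1, fun hwZ => f4 _ (d2 hwZ), fun y hy hyZ => ?_⟩
      rw [List.mem_append, List.mem_singleton] at hy
      rcases hy with hy | rfl
      · exact f4 _ (d3 y hy hyZ)
      · exact f3 hyZ
    · rintro ρ ⟨d1, d2, d3⟩
      refine ⟨d1, ?_⟩
      rintro x ⟨w', hw', hx⟩ hxZ
      cases hw'.symm.trans hqv.symm
      rcases hx with rfl | hx
      · exact d2 hxZ
      · exact d3 x (((hadj w).2 x).2 hx) hxZ
  · rw [e4] at hb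
    rintro x ⟨w, hw, -⟩
    rw [hw, dec_eq_some] at hqv
    have := w.2
    omega

theorem runs_search (hadj : IsAdjList G adj) (hσ : Base adj k S σ) (hT : vs n (σ 16) = T)
    (hZ : vs n (σ 17) = Z) (hTZ : Disjoint T Z) (hq : ∀ u : Fin n, dec n (σ 12 u) = q u)
    (hinj : ∀ u u' w, q u = some w → q u' = some w → u = u') :
    Runs search σ (400 * size adj) fun σ' =>
      T ⊆ vs n (σ' 13) ∧ SState G T Z q σ' (σ' 19 0) := by
  let J : Store → Prop := fun τ => Base adj k S τ ∧ τ 12 = σ 12 ∧ τ 17 = σ 17 ∧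
    SState G T Z q τ (τ 18 0) ∧ T ⊆ vs n (τ 13)
  -- Every unprocessed vertex, queued or not, holds a credit proportional to the degree of its
  -- predecessor, enough to pay for its own processing.
  let φ : Store → ℕ := fun τ => ∑ u : Fin n, if τ 13 u ≠ 0 ∧ τ 13 u ≤ τ 18 0 then 0 else
    ((q u).elim 0 fun w => (adj w).length) * 80 + 160
  have hφ : ∀ τ, φ τ ≤ (∑ u, (adj u).length) * 80 + n * 160 := by
    intro τ
    calc φ τ ≤ ∑ u, (((q u).elim 0 fun w => (adj w).length) * 80 + 160) :=
          Finset.sum_le_sum fun u _ => by split <;> omega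
      _ = (∑ u, ((q u).elim 0 fun w => (adj w).length)) * 80 + n * 160 := by
          rw [Finset.sum_add_distrib, Finset.sum_mul]; simp
      _ ≤ _ := by
          have := sum_length_le (adj := adj) hinj
          omega
  have h1 := runs_fill (a := 13) (e := .lit 0) (f := fun _ => 0) hσ (by decide) (by decide)
    (fun _ _ _ _ _ _ => rfl)
  refine (h1.seq (T' := 7 + (n * 80 + 20) + (3 + ((∑ u, (adj u).length) * 80 + n * 160 + 6)))
    fun σ1 ⟨hf1, hz1⟩ => ?_).mono (by simp only [size, Expr.cost]; omega) fun _ h => h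
  refine (Runs.set_seq (Runs.set_seq
    (t := n * 80 + 20 + (3 + ((∑ u, (adj u).length) * 80 + n * 160 + 6))) ?_)).mono
    (by simp only [Expr.cost, sc]; omega) fun _ h => h
  have hB1 : Base adj k S σ1 := hσ.of_frame fun a ha => hf1 a (by omega) (by omega)
  have e1 : (sc 0).eval (σ1.write 19 0 ((Expr.lit 0).eval σ1)) = n := (hB1.write (by decide)).size
  rw [e1]
  have hf2 : ∀ a, a ≠ 13 → a ≠ 26 → a ≠ 19 → a ≠ 20 →
      ((σ1.write 19 0 ((Expr.lit 0).eval σ1)).write 20 0 n) a = σ a := fun a h1 h2 h3 h4 => by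
    rw [Store.write_ne _ _ _ h4, Store.write_ne _ _ _ h3, hf1 a h1 h2]
  have h13 : ∀ u < n, ((σ1.write 19 0 ((Expr.lit 0).eval σ1)).write 20 0 n) 13 u = 0 := by
    simpa [Store.write_ne] using hz1
  have h19 : ((σ1.write 19 0 ((Expr.lit 0).eval σ1)).write 20 0 n) 19 0 = 0 := by
    simp [Store.write_ne, Store.write_same, Expr.eval]
  have h20 : ((σ1.write 19 0 ((Expr.lit 0).eval σ1)).write 20 0 n) 20 0 = n := by
    simp [Store.write_same]
  generalize (σ1.write 19 0 ((Expr.lit 0).eval σ1)).write 20 0 n = σ2 at hf2 h13 h19 h20 ⊢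
  refine (runs_search_start (G := G) (q := q) (hσ.of_frame fun a ha => hf2 a (by omega) (by omega) (by omega)
    (by omega)) (by rw [hf2 16 (by decide) (by decide) (by decide) (by decide), hT])
    (by rw [hf2 17 (by decide) (by decide) (by decide) (by decide), hZ]) hTZ h13 h19 h20).frame.seq
    fun σ3 ⟨⟨hI3, hT3⟩, hf3⟩ => (Runs.set_seq
      (t := (∑ u, (adj u).length) * 80 + n * 160 + 6) ?_).mono (by simp [Expr.cost])
      fun _ h => h
  have hf4 : ∀ a, a ∉ [13, 14, 15, 19, 22, 20, 26, 18] →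
      σ3.write 18 0 ((Expr.lit 0).eval σ3) a = σ a := fun a ha => by
    simp only [List.mem_cons, List.not_mem_nil, not_or] at ha
    rw [Store.write_ne _ _ _ (by tauto), hf3 a, hf2 a (by tauto) (by tauto) (by tauto) (by tauto)]
    simp only [forTo, set, visit, Prog.mods, List.mem_append, List.mem_cons, List.not_mem_nil]
    tauto
  have hJ : J (σ3.write 18 0 ((Expr.lit 0).eval σ3)) := by
    refine ⟨hσ.of_frame fun a ha => hf4 a (by simp; omega), hf4 _ (by decide), hf4 _ (by decide),
      ?_, ?_⟩
    · rw [Store.write_same, Function.update_self]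
      exact hI3.congr (Store.write_ne _ _ _ (by decide)) (Store.write_ne _ _ _ (by decide))
        (Store.write_ne _ _ _ (by decide)) (Store.write_ne _ _ _ (by decide))
    · rwa [Store.write_ne _ _ _ (by decide)]
  generalize σ3.write 18 0 ((Expr.lit 0).eval σ3) = σ4 at hJ ⊢
  refine (Runs.loop (I := J) (φ := φ) ?_ hJ).mono ?_ ?_
  · rintro τ ⟨a1, a2, a3, a4, a5⟩ hb
    simp only [Expr.eval, sc] at hb
    obtain ⟨v, hv, hv'⟩ := a4.que_act (τ 18 0) (by omega)
    refine ⟨_, (runs_search_step hadj (by rw [a3, hZ]) (by rw [a2]; exact hq) a1 hv hv' a4).mono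
      le_rfl ?_⟩
    rintro ρ ⟨b1, b2⟩
    refine ⟨⟨b1.base, by rw [b1.flow, a2], by rw [b1.block, a3], ?_, fun u hu => ?_⟩, ?_⟩
    · rw [b1.head]
      exact SInv.succ b1.state (by rw [b1.keep v (by omega), hv']) b2
    · rw [mem_vs, b1.keep u (a5 hu)]
      exact a5 hu
    · simp only [Expr.cost, sc]
      have := sum_add_le_sum (K := ((q v).elim 0 fun w => (adj w).length) * 80 + 160) v
        (f := fun u : Fin n => if ρ 13 u ≠ 0 ∧ ρ 13 u ≤ ρ 18 0 then 0 else
          ((q u).elim 0 fun w => (adj w).length) * 80 + 160)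
        (g := fun u : Fin n => if τ 13 u ≠ 0 ∧ τ 13 u ≤ τ 18 0 then 0 else
          ((q u).elim 0 fun w => (adj w).length) * 80 + 160) ?_ ?_
      · change φ ρ + _ ≤ φ τ at this
        omega
      · intro u
        by_cases hu : τ 13 u ≠ 0 ∧ τ 13 u ≤ τ 18 0
        · have : ρ 13 u ≠ 0 ∧ ρ 13 u ≤ ρ 18 0 := by
            rw [b1.keep u hu.1, b1.head]
            omega
          simp [this]
        · simp only [hu, if_false]
          split <;> omega
      · have h1 : ρ 13 v ≠ 0 ∧ ρ 13 v ≤ ρ 18 0 := by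
          rw [b1.keep v (by omega), b1.head]
          omega
        have h2 : ¬ (τ 13 v ≠ 0 ∧ τ 13 v ≤ τ 18 0) := by omega
        simp only [if_pos h1, if_neg h2]
        omega
  · have := hφ σ4
    simp only [Expr.cost, sc]
    omega
  · rintro τ ⟨⟨a1, a2, a3, a4, a5⟩, hb⟩
    simp only [Expr.eval, sc] at hb
    refine ⟨a5, ?_⟩
    have := a4.head_le
    rwa [show τ 19 0 = τ 18 0 by omega]

end SearchLoop

/-! ## Maximum flows -/

section FlowProg

variable {n : ℕ} {G : SimpleGraph (Fin n)} {adj : Fin n → List (Fin n)} {k : ℕ}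
  {S : Finset (Fin n)} {σ : Store} {T Z : Set (Fin n)} {q : Fin n → Option (Fin n)}

/-- The partial function on vertices with table `f`. -/
def decf (n : ℕ) (f : ℕ → ℕ) (u : Fin n) : Option (Fin n) := dec n (f u)

theorem decf_update (f : ℕ → ℕ) (x : Fin n) (c : ℕ) :
    decf n (Function.update f x c) = Function.update (decf n f) x (dec n c) := by
  ext1 u
  by_cases h : u = x
  · simp [decf, h]
  · have : (u : ℕ) ≠ x := fun h' => h (Fin.ext h')
    simp [decf, h, this]

/-- Queue entries are distinct vertices; this bounds the search numbers and thus the length of an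
augmenting path. -/
theorem SInv.tail_le {act par que : ℕ → ℕ} {tail h : ℕ}
    (hI : SInv G T Z q act par que tail h) : tail ≤ n := by
  have := hI.que_act
  choose f hf using fun i : Fin tail => this i i.2
  have hinj : Function.Injective f := fun i j hij => by
    have h1 := (hf i).2
    rw [hij, (hf j).2] at h1
    exact Fin.ext (by omega)
  simpa using Fintype.card_le_of_injective f hinj

/-- Augment the flow in array `12` along the search path that ends in `29[0]`. -/
def augment : Prog :=
  .loop (.sub (sc 0) (.get 14 (sc 29)))
    (.assign 12 (sc 29) (.get 12 (.get 14 (sc 29))) ⨾ set 29 (.get 14 (sc 29))) ⨾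
  .assign 12 (sc 29) (sc 0)

/-- Overwriting one table entry and moving the hole is the same as exchanging two entries. -/
theorem update_swap {x x' : Fin n} (hx : x' ≠ x) :
    Function.update (Function.update q x (q x')) x' none =
      Function.update q x none ∘ Equiv.swap x x' := by
  ext1 u
  simp only [Function.comp, Equiv.swap_apply_def, Function.update_apply]
  split_ifs <;> simp_all

theorem runs_augment {y w : Fin n} (hσ : Base adj k S σ) (hq : IsFlow G Z T (decf n (σ 12)))
    (hI : SState G T Z (decf n (σ 12)) σ (σ 19 0)) (hy : σ 29 0 = y) (hy' : σ 13 y ≠ 0)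
    (hw : decf n (σ 12) y = some w) (hwZ : w ∈ nbhd G Z) :
    Runs augment σ (30 * size adj) fun σ' => IsFlow G Z T (decf n (σ' 12)) ∧
      {u | decf n (σ' 12) u = none}.ncard = {u | decf n (σ 12) u = none}.ncard + 1 := by
  -- The walk has altered predecessors only at vertices with search numbers above that of the
  -- current `x`. So the step recorded for the parent of `x` still refers to an unchanged entry.
  let J : Store → Prop := fun τ => ∃ x : Fin n, τ 29 0 = x ∧ Base adj k S τ ∧ τ 13 = σ 13 ∧
    τ 14 = σ 14 ∧ σ 13 x ≠ 0 ∧ IsHoled G Z T (Function.update (decf n (τ 12)) x none) x ∧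
    {u | Function.update (decf n (τ 12)) x none u = none}.ncard =
      {u | decf n (σ 12) u = none}.ncard + 1 ∧
    ∀ u : Fin n, σ 13 u ≤ σ 13 x → τ 12 u = σ 12 u
  have hJ : J σ := ⟨y, hy, hσ, rfl, rfl, hy', hq.isHoled hw hwZ (hI.avoid y hy'),
    ncard_none_update hw, fun _ _ => rfl⟩
  -- Search numbers drop along parents; `19` covers the body (`12`), the test (`6`) and the branch
  -- (`1`).
  refine ((Runs.loop (I := J) (φ := fun τ => 19 * σ 13 (τ 29 0)) ?_ hJ).seq (T' := 5)
    fun τ ⟨⟨x, a1, a2, a3, a4, a5, a6, a7, a8⟩, hb⟩ =>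
      .flat rfl (by simp [Prog.time, sc, Expr.cost]) ?_).mono ?_ fun _ h => h
  · rintro τ ⟨x, a1, a2, a3, a4, a5, a6, a7, a8⟩ hb
    simp only [Expr.eval, sc, a2.size, a1, a4] at hb
    rcases hI.par_spec x a5 with ⟨hp, -⟩ | ⟨x', hp, hx', hlt, hs⟩
    · rw [dec_eq_none] at hp
      omega
    have hp' := dec_eq_some.1 hp
    have hne : x' ≠ x := by
      rintro rfl
      omega
    have hne' : (x' : ℕ) ≠ x := fun h => hne (Fin.ext h)
    have hqx : decf n (τ 12) x' = decf n (σ 12) x' := by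
      simp only [decf, a8 x' (by omega)]
    refine ⟨12, .flat rfl (by simp [Prog.time, set, sc, Expr.cost]) ?_⟩
    simp only [Prog.act, set, sc, Expr.eval, a1, a4, hp', Store.write, Function.update_self,
      Function.update_of_ne, ne_eq, Nat.reduceEqDiff, not_false_eq_true]
    refine ⟨⟨x', by simp, ?_, by simpa using a3, by simpa using a4, hx', ?_, ?_, fun u hu => ?_⟩, ?_⟩
    · exact (a2.write (a := 12) (by decide)).write (a := 29) (by decide)
    · simp only [Function.update_of_ne, ne_eq, Nat.reduceEqDiff, not_false_eq_true,
        Function.update_self, decf_update]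
      rw [show dec n (τ 12 x') = decf n (τ 12) x' from rfl, update_swap hne]
      refine a6.swap (hI.avoid x a5) (hI.avoid x' hx') ?_
      obtain ⟨w', hw', hs⟩ := hs
      exact ⟨w', by rw [Function.update_of_ne hne, hqx, hw'], hs⟩
    · simp only [Function.update_of_ne, ne_eq, Nat.reduceEqDiff, not_false_eq_true,
        Function.update_self, decf_update]
      rw [show dec n (τ 12 x') = decf n (τ 12) x' from rfl, update_swap hne, ncard_none_swap, a7]
    · have hux : (u : ℕ) ≠ x := fun h => by
        rw [h] at hu
        omega
      simp only [Function.update_of_ne, ne_eq, Nat.reduceEqDiff, not_false_eq_true,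
        Function.update_self, hux]
      exact a8 u (by omega)
    · simp only [Expr.cost]
      omega
  · have h1 := (hI.act_que y hy').1
    have h2 := hI.tail_le
    simp only [Expr.cost, sc, hy, size]
    omega
  · simp only [Expr.eval, sc, a2.size, a1, a4] at hb
    simp only [Prog.act, sc, Expr.eval, a1, a2.size, Store.write_same, decf_update, dec_self]
    refine ⟨a6.isFlow ?_, a7⟩
    rcases hI.par_spec x a5 with ⟨-, hT⟩ | ⟨x', hp, -⟩
    · exact hT
    · have := dec_eq_some.1 hp
      have := x'.2
      omega

/-- The search ended in the set `A` without reaching `Z`. -/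
structure IsStuck (G : SimpleGraph (Fin n)) (Z T : Set (Fin n)) (q : Fin n → Option (Fin n))
    (A : Set (Fin n)) : Prop where
  terminals : T ⊆ A
  avoid : Disjoint A Z
  closed : ∀ u ∈ A, ∀ x, Step G q u x → x ∉ Z → x ∈ A
  least : ∀ X : Set (Fin n), T ⊆ X → (∀ u ∈ X, ∀ x, Step G q u x → x ∉ Z → x ∈ X) → A ⊆ X
  stuck : ∀ u ∈ A, ∀ w, q u = some w → w ∉ nbhd G Z

/-- The end of an augmenting path. -/
def isEnd : Expr :=
  .both (.get 13 (sc 26)) (.both (.sub (sc 0) (.get 12 (sc 26))) (.get 23 (.get 12 (sc 26))))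

/-- One attempt to augment the flow. -/
def round : Prog :=
  search ⨾ find 29 isEnd ⨾
  .cond (.sub (sc 0) (sc 29)) (augment ⨾ set 27 (.add (sc 27) (.lit 1))) .skip

/-- Maximum flow from `T` in array `11` to `Z` in array `10`, up to the value `5[0] + 1`. -/
def flow : Prog :=
  fill 12 (sc 26) ⨾ fill 16 (.get 11 (sc 26)) ⨾ fill 17 (.get 10 (sc 26)) ⨾
  fill 24 (.get 10 (sc 26)) ⨾ nbr ⨾ set 27 (.lit 0) ⨾ forTo 28 (.add (sc 5) (.lit 1)) round

/-- The state between two rounds. -/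
structure FlowState (adj : Fin n → List (Fin n)) (k : ℕ) (S : Finset (Fin n))
    (G : SimpleGraph (Fin n)) (Z T : Set (Fin n)) (j : ℕ) (τ : Store) : Prop where
  base : Base adj k S τ
  start : vs n (τ 16) = T
  block : vs n (τ 17) = Z
  goal : vs n (τ 23) = nbhd G Z
  isFlow : IsFlow G Z T (decf n (τ 12))
  value : τ 27 0 = {u | decf n (τ 12) u = none}.ncard
  le : τ 27 0 ≤ j
  progress : τ 27 0 = j ∨ IsStuck G Z T (decf n (τ 12)) (vs n (τ 13))

theorem runs_round (hadj : IsAdjList G adj) {j : ℕ} (hTZ : Disjoint T Z)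
    (h : FlowState adj k S G Z T j σ) :
    Runs round σ (600 * size adj) (FlowState adj k S G Z T (j + 1)) := by
  obtain ⟨h1, h2, h3, h4, h5, h6, h7, h8⟩ := h
  refine ((runs_search (q := decf n (σ 12)) hadj h1 h2 h3 hTZ (fun _ => rfl) h5.inj).frame.seq
    (T' := 200 * size adj) fun σ1 ⟨⟨a1, a2⟩, hf⟩ => ?_).mono (by omega) fun _ h => h
  have hf1 : ∀ a, a ∉ [13, 14, 15, 18, 19, 20, 21, 22, 25, 26] → σ1 a = σ a := fun a ha =>
    hf a fun hm => ha (by revert hm; simp [search, fill, forTo, forAdj, visit, set, Prog.mods]; omega)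
  have hB1 : Base adj k S σ1 := h1.of_frame fun a ha => hf1 a (by simp; omega)
  have e12 := hf1 12 (by decide)
  have e23 := hf1 23 (by decide)
  refine ((runs_find (a := 29) (e := isEnd) (P := fun u => σ1 13 u ≠ 0 ∧ σ1 12 u < n ∧
    σ1 23 (σ1 12 u) ≠ 0) hB1 (by decide) (by decide) ?_).seq (T' := 100 * size adj)
    fun σ2 ⟨hf2, c⟩ => ?_).mono ?_ fun _ h => h
  · intro u hu τ hfr h26
    have g : ∀ b, b ≠ 29 → b ≠ 26 → τ b = σ1 b := hfr
    simp only [isEnd, Expr.eval_both]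
    simp only [Expr.eval, sc, h26, g 13 (by decide) (by decide), g 12 (by decide) (by decide),
      g 23 (by decide) (by decide), g 0 (by decide) (by decide), hB1.size]
    omega
  · have hB2 : Base adj k S σ2 := hB1.of_frame fun a ha => hf2 a (by omega) (by omega)
    have hf3 : ∀ a, a ∉ [13, 14, 15, 18, 19, 20, 21, 22, 25, 26, 29] → σ2 a = σ a := fun a ha => by
      simp only [List.mem_cons, List.not_mem_nil, not_or] at ha
      rw [hf2 a (by tauto) (by tauto), hf1 a (by simp; omega)]
    have i12 := hf3 12 (by decide)
    have hS2 : SState G T Z (decf n (σ 12)) σ2 (σ2 19 0) := by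
      rw [hf2 19 (by decide) (by decide)]
      refine a2.congr ?_ ?_ ?_ ?_ <;> exact hf2 _ (by decide) (by decide)
    refine (Runs.cond (T := 50 * size adj) (T' := 1) (fun hb => ?_)
      fun hb => .flat rfl le_rfl ?_).mono
      (by simp only [Expr.cost, sc, size]; omega) fun _ h => h
    · simp only [Expr.eval, sc, hB2.size] at hb
      rcases c with ⟨c, -⟩ | ⟨c1, ⟨c2, c3, c4⟩, -⟩
      · omega
      obtain ⟨y, hy⟩ : ∃ y : Fin n, σ2 29 0 = y := ⟨⟨_, c1⟩, rfl⟩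
      rw [hy, e12] at c3
      rw [hy] at c2
      rw [hy, e12, e23] at c4
      obtain ⟨w, hw⟩ : ∃ w : Fin n, σ 12 y = w := ⟨⟨_, c3⟩, rfl⟩
      have hqw : decf n (σ 12) y = some w := by rw [decf, hw, dec_val]
      have hwN : w ∈ nbhd G Z := by
        rw [← h4, mem_vs, ← hw]
        exact c4
      have c2' : σ2 13 y ≠ 0 := by rwa [hf2 13 (by decide) (by decide)]
      refine ((runs_augment (T := T) (w := w) hB2 (by rwa [i12]) (by rwa [i12]) hy c2' (by rwa [i12])
        hwN).frame.seq (T' := 6) fun σ3 ⟨⟨d1, d2⟩, hf4⟩ => .flat rfl ?_ ?_).mono ?_ fun _ h => h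
      · simp [Prog.time, set, sc, Expr.cost]
      · have hf5 : ∀ a, a ∉ [13, 14, 15, 18, 19, 20, 21, 22, 25, 26, 29, 12] → σ3 a = σ a :=
          fun a ha => by
            simp only [List.mem_cons, List.not_mem_nil, not_or] at ha
            rw [hf4 a, hf3 a (by simp; omega)]
            simp only [augment, set, Prog.mods, List.mem_append, List.mem_cons, List.not_mem_nil]
            tauto
        have v27 := hf5 27 (by decide)
        simp only [set, Prog.act, sc, Expr.eval, v27]
        -- If an earlier round had got stuck, leastness would put the present search set inside the
        -- stuck one, and no end of an augmenting path could occur. So all `j` earlier rounds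
        -- augmented.
        have hlam : σ 27 0 = j := by
          rcases h8 with h8 | h8
          · exact h8
          · exfalso
            have hsub := a2.least _ h8.terminals h8.closed
            have hyA : y ∈ vs n (σ1 13) := c2
            exact h8.stuck y (hsub hyA) w hqw hwN
        refine ⟨(h1.of_frame fun a ha => hf5 a (by simp; omega)).write (by decide), ?_, ?_, ?_, ?_,
          ?_, ?_, .inl ?_⟩
        · rw [Store.write_ne _ _ _ (by decide), hf5 16 (by decide), h2]
        · rw [Store.write_ne _ _ _ (by decide), hf5 17 (by decide), h3]
        · rw [Store.write_ne _ _ _ (by decide), hf5 23 (by decide), h4]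
        · rwa [Store.write_ne _ _ _ (by decide)]
        · rw [Store.write_same, Function.update_self, Store.write_ne _ _ _ (by decide), d2, i12, h6]
        · rw [Store.write_same, Function.update_self]; omega
        · rw [Store.write_same, Function.update_self]; omega
      · simp only [size]
        omega
    · simp only [Expr.eval, sc, hB2.size] at hb
      simp only [Prog.act]
      rcases c with ⟨-, c⟩ | ⟨c1, -⟩
      · refine ⟨hB2, ?_, ?_, ?_, ?_, ?_, ?_, .inr ?_⟩
        · rw [hf3 16 (by decide), h2]
        · rw [hf3 17 (by decide), h3]
        · rw [hf3 23 (by decide), h4]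
        · rwa [i12]
        · rw [hf3 27 (by decide), i12, h6]
        · rw [hf3 27 (by decide)]; omega
        · rw [i12, hf2 13 (by decide) (by decide)]
          refine ⟨a1, Set.disjoint_left.2 fun u hu => a2.avoid u hu, fun u hu x hs hx =>
            a2.closed u hu (a2.act_que u hu).1 x hs hx, a2.least, fun u hu w hw hwN => ?_⟩
          refine c u u.2 ⟨hu, ?_⟩
          have : σ 12 u = w := dec_eq_some.1 hw
          rw [e12, e23, this]
          refine ⟨w.2, ?_⟩
          rw [← h4] at hwN
          exact hwN
      · omega
  · simp only [isEnd, Expr.both, Expr.neg, Expr.cost, sc, size]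
    omega

/-- With `p = 5[0]`, `p + 1` rounds suffice: either all of them augment and weak duality makes every
cut larger than `p`, or the last search certifies a furthest minimum cut. -/
theorem runs_flow (hadj : IsAdjList G adj) (hσ : Base adj k S σ) (hZ : vs n (σ 10) = Z)
    (hT : vs n (σ 11) = T) (hTZ : Disjoint T Z) :
    Runs flow σ ((σ 5 0 + 2) * (1000 * size adj)) (FlowState adj k S G Z T (σ 5 0 + 1)) := by
  refine ((runs_fill (a := 12) (e := sc 26) (f := fun u => u) hσ (by decide) (by decide)
    fun u _ τ _ h _ => h).seq (T' := (n * 23 + 20) + ((n * 23 + 20) + ((n * 23 + 20) +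
      (200 * size adj + (3 + ((σ 5 0 + 1) * (600 * size adj + 14) + 11))))))
    fun σ1 ⟨f1, g1⟩ => ?_).mono
    ?_ fun _ h => h
  · have B1 : Base adj k S σ1 := hσ.of_frame fun a ha => f1 a (by omega) (by omega)
    refine (runs_fill (a := 16) (f := σ1 11) B1 (by decide) (by decide) fun u _ τ h h26 _ => ?_).seq
      fun σ2 ⟨f2, g2⟩ => ?_
    · simp only [Expr.eval, sc, h26, h 11 (by decide) (by decide)]
    have B2 : Base adj k S σ2 := B1.of_frame fun a ha => f2 a (by omega) (by omega)
    refine (runs_fill (a := 17) (f := σ2 10) B2 (by decide) (by decide) fun u _ τ h h26 _ => ?_).seq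
      fun σ3 ⟨f3, g3⟩ => ?_
    · simp only [Expr.eval, sc, h26, h 10 (by decide) (by decide)]
    have B3 : Base adj k S σ3 := B2.of_frame fun a ha => f3 a (by omega) (by omega)
    refine (runs_fill (a := 24) (f := σ3 10) B3 (by decide) (by decide) fun u _ τ h h26 _ => ?_).seq
      fun σ4 ⟨f4, g4⟩ => ?_
    · simp only [Expr.eval, sc, h26, h 10 (by decide) (by decide)]
    have B4 : Base adj k S σ4 := B3.of_frame fun a ha => f4 a (by omega) (by omega)
    refine (runs_nbr hadj B4).frame.seq fun σ5 ⟨h23, f5⟩ => ?_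
    have f5' : ∀ a, a ∉ [22, 23, 25, 26] → σ5 a = σ4 a := fun a ha =>
      f5 a fun hm => ha (by revert hm; simp [nbr, fill, forTo, forAdj, set, Prog.mods]; omega)
    have B5 : Base adj k S σ5 := B4.of_frame fun a ha => f5' a (by simp; omega)
    refine (Runs.set_seq (t := (σ 5 0 + 1) * (600 * size adj + 14) + 11) ?_).mono le_rfl fun _ h => h
    have e5 : σ5 5 = σ 5 := by
      rw [f5' _ (by decide), f4 _ (by decide) (by decide), f3 _ (by decide) (by decide),
        f2 _ (by decide) (by decide), f1 _ (by decide) (by decide)]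
    have w10 : vs n (σ3 10) = Z := by
      rw [f3 _ (by decide) (by decide), f2 _ (by decide) (by decide), f1 _ (by decide) (by decide), hZ]
    refine (Runs.forTo_const (m := σ 5 0 + 1) (c := 600 * size adj)
      (I := fun j τ => FlowState adj k S G Z T j τ ∧ τ 5 = σ 5) ?_ ?_ ?_).mono ?_ ?_
    · rintro j τ ⟨-, h⟩
      simp [Expr.eval, sc, h]
    · refine ⟨⟨(B5.write (by decide)).write (by decide), ?_, ?_, ?_, ?_, ?_, ?_, .inl ?_⟩, ?_⟩
      · simp only [Store.write_ne, ne_eq, Nat.reduceEqDiff, not_false_eq_true]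
        rw [f5' _ (by decide), f4 _ (by decide) (by decide), f3 _ (by decide) (by decide), ← hT,
          ← f1 11 (by decide) (by decide)]
        exact vs_congr fun u hu => by rw [g2 u hu]
      · simp only [Store.write_ne, ne_eq, Nat.reduceEqDiff, not_false_eq_true]
        rw [f5' _ (by decide), f4 _ (by decide) (by decide), ← hZ,
          ← f1 10 (by decide) (by decide), ← f2 10 (by decide) (by decide)]
        exact vs_congr fun u hu => by rw [g3 u hu]
      · simp only [Store.write_ne, ne_eq, Nat.reduceEqDiff, not_false_eq_true]
        rw [h23, ← w10]
        congr 1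
        exact vs_congr fun u hu => by rw [g4 u hu]
      all_goals simp only [Store.write_ne, Store.write_same, ne_eq, Nat.reduceEqDiff,
        not_false_eq_true, Function.update_self, Expr.eval, e5]
      all_goals try rw [show decf n (σ5 12) = some by
        ext1 u
        rw [f5' _ (by decide), f4 _ (by decide) (by decide), f3 _ (by decide) (by decide),
          f2 _ (by decide) (by decide), decf, g1 u u.2, dec_val]]
      · exact isFlow_some
      · simp
      · exact le_rfl
    · rintro j - τ hτ ⟨h1, h2⟩
      refine (runs_round hadj hTZ h1).frame.mono le_rfl ?_
      rintro ρ ⟨⟨a1, a2, a3, a4, a5, a6, a7, a8⟩, hf⟩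
      have hf' : ∀ a, a ∉ round.mods → ρ a = τ a := hf
      refine ⟨by rw [hf' 28 (by decide), hτ], ⟨a1.write (by decide), ?_, ?_, ?_, ?_, ?_, ?_, ?_⟩, ?_⟩
      all_goals simp only [Store.write_ne, ne_eq, Nat.reduceEqDiff, not_false_eq_true]
      all_goals first | assumption | rw [hf' 5 (by decide), h2]
    · simp only [Expr.cost, sc]
      ring_nf
      omega
    · exact fun τ h => h.1
  · have h1 : n + 1 ≤ size adj := by simp only [size]; omega
    have h2 : σ 5 0 ≤ σ 5 0 * size adj := Nat.le_mul_of_pos_right _ (by omega)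
    simp only [sc, Expr.cost]
    nlinarith

end FlowProg

/-! ## Running the enumeration for one guess -/

section Guess

variable {n : ℕ} {G : SimpleGraph (Fin n)} {adj : Fin n → List (Fin n)} {k : ℕ}
  {S : Finset (Fin n)} {σ : Store} {T Z : Set (Fin n)}

/-- Tests whether the counter `26[0]` equals `33[0]`. -/
def isRoot : Expr := .neg (.add (.sub (sc 26) (sc 33)) (.sub (sc 33) (sc 26)))

theorem eval_isRoot : isRoot.eval σ = if σ 26 0 = σ 33 0 then 1 else 0 := by
  simp only [isRoot, Expr.neg, Expr.eval, sc]
  split <;> omega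

theorem vs_indicator {f : ℕ → ℕ} {v : Fin n} (h : ∀ u < n, f u = if u = (v : ℕ) then 1 else 0) :
    vs n f = {v} := by
  ext u
  rw [mem_vs, h u u.2]
  simp [Fin.ext_iff]

/-- Array `13` becomes the component of `33[0]` outside the set in array `13`. -/
def component : Prog :=
  fill 17 (.get 13 (sc 26)) ⨾ fill 16 isRoot ⨾ fill 12 (sc 26) ⨾ search

/-- For the flow without paths, a search step leads from a vertex to itself or to a neighbour, so
the flow search doubles as plain graph search. -/
theorem runs_component (hadj : IsAdjList G adj) (hσ : Base adj k S σ) {v : Fin n}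
    (hv : σ 33 0 = v) (hvA : v ∉ vs n (σ 13)) :
    Runs component σ (520 * size adj) fun σ' => vs n (σ' 13) = comp G (vs n (σ 13))ᶜ v := by
  refine ((runs_fill (a := 17) (e := .get 13 (sc 26)) (f := σ 13) hσ (by decide) (by decide)
    fun u _ τ h h26 _ => ?_).seq
    (T' := (n * 33 + 20) + ((n * 22 + 20) + 400 * size adj)) fun σ1 ⟨f1, g1⟩ => ?_).mono ?_
    fun _ h => h
  · simp only [Expr.eval, sc, h26, h 13 (by decide) (by decide)]
  · have B1 : Base adj k S σ1 := hσ.of_frame fun a ha => f1 a (by omega) (by omega)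
    refine ((runs_fill (a := 16) (e := isRoot) (f := fun u => if u = v then 1 else 0) B1 (by decide)
      (by decide) fun u _ τ h h26 _ => ?_).mono (by simp [isRoot, Expr.neg, sc, Expr.cost])
      fun _ h => h).seq fun σ2 ⟨f2, g2⟩ => ?_
    · rw [eval_isRoot, h26, h 33 (by decide) (by decide), f1 33 (by decide) (by decide), hv]
    have B2 : Base adj k S σ2 := B1.of_frame fun a ha => f2 a (by omega) (by omega)
    refine (runs_fill (a := 12) (e := sc 26) (f := fun u => u) B2 (by decide) (by decide)
      fun u _ τ _ h _ => h).seq fun σ3 ⟨f3, g3⟩ => ?_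
    have B3 : Base adj k S σ3 := B2.of_frame fun a ha => f3 a (by omega) (by omega)
    have h16 : vs n (σ3 16) = {v} := by
      rw [f3 16 (by decide) (by decide)]
      exact vs_indicator g2
    have h17 : vs n (σ3 17) = vs n (σ 13) := by
      rw [f3 17 (by decide) (by decide), f2 17 (by decide) (by decide)]
      exact vs_congr fun u hu => by rw [g1 u hu]
    refine (runs_search (G := G) (q := some) hadj B3 h16 h17 (Set.disjoint_singleton_left.2 hvA)
      (fun u => by rw [g3 u u.2, dec_val]) (by rintro u u' w ⟨⟩ ⟨⟩; rfl)).mono le_rfl ?_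
    rintro σ4 ⟨a1, a2⟩
    refine Set.Subset.antisymm ?_ (comp_subset (a1 rfl) fun a ha b hb hab => ?_)
    · refine a2.least _ (Set.singleton_subset_iff.2 mem_comp_self) ?_
      rintro u hu x ⟨w, ⟨⟩, hx⟩ hxA
      rcases hx with rfl | hx
      · exact hu
      · exact comp_closed hu hxA hx
    · exact a2.closed a ha (a2.act_que a ha).1 b ⟨a, rfl, .inr hab⟩ hb
  · simp only [sc, Expr.cost, size]
    omega

/-- Array `10` becomes the component of `33[0]` outside the set in array `13`, and `29[0]` its
greatest neighbour outside the set in array `11`. -/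
def cut : Prog :=
  component ⨾ fill 10 (.get 13 (sc 26)) ⨾ fill 24 (.get 13 (sc 26)) ⨾ nbr ⨾
  find 29 (.both (.get 23 (sc 26)) (.neg (.get 11 (sc 26))))

theorem runs_cut (hadj : IsAdjList G adj) (hσ : Base adj k S σ) {v : Fin n}
    (hv : σ 33 0 = v) (hvA : v ∉ vs n (σ 13)) :
    Runs cut σ (900 * size adj) fun σ' => vs n (σ' 10) = comp G (vs n (σ 13))ᶜ v ∧
      ((σ' 29 0 = n ∧ nbhd G (comp G (vs n (σ 13))ᶜ v) ⊆ vs n (σ 11)) ∨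
        ∃ x : Fin n, σ' 29 0 = x ∧
          IsGreatest (nbhd G (comp G (vs n (σ 13))ᶜ v) \ vs n (σ 11)) x) := by
  refine ((runs_component hadj hσ hv hvA).frame.seq (T' := n * 23 + 20 + (n * 23 + 20 +
    (200 * size adj + (n * 35 + 20)))) fun σ1 ⟨h1, f1⟩ => ?_).mono ?_ fun _ h => h
  · have h11 := f1 11 (by decide)
    have B1 : Base adj k S σ1 := hσ.of_frame fun a ha => f1 a (by interval_cases a <;> decide)
    refine (runs_fill (a := 10) (e := .get 13 (sc 26)) (f := σ1 13) B1 (by decide) (by decide)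
      fun u _ τ h h26 _ => ?_).seq fun σ2 ⟨f2, g2⟩ => ?_
    · simp only [Expr.eval, sc, h26, h 13 (by decide) (by decide)]
    have B2 : Base adj k S σ2 := B1.of_frame fun a ha => f2 a (by omega) (by omega)
    refine (runs_fill (a := 24) (e := .get 13 (sc 26)) (f := σ2 13) B2 (by decide) (by decide)
      fun u _ τ h h26 _ => ?_).seq fun σ3 ⟨f3, g3⟩ => ?_
    · simp only [Expr.eval, sc, h26, h 13 (by decide) (by decide)]
    have B3 : Base adj k S σ3 := B2.of_frame fun a ha => f3 a (by omega) (by omega)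
    refine (runs_nbr hadj B3).frame.seq fun σ4 ⟨h4, f4⟩ => ?_
    have B4 : Base adj k S σ4 := B3.of_frame fun a ha => f4 a (by interval_cases a <;> decide)
    set R := comp G (vs n (σ 13))ᶜ v with hR
    have h10 : vs n (σ4 10) = R := by
      rw [f4 10 (by decide), f3 10 (by decide) (by decide), ← h1]
      exact vs_congr fun u hu => by rw [g2 u hu]
    have h24 : vs n (σ3 24) = R := by
      rw [← h1, ← f2 13 (by decide) (by decide)]
      exact vs_congr fun u hu => by rw [g3 u hu]
    have h23 : vs n (σ4 23) = nbhd G R := by rw [h4, h24]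
    have h11' : σ4 11 = σ 11 := by
      rw [f4 11 (by decide), f3 11 (by decide) (by decide), f2 11 (by decide) (by decide), h11]
    refine (runs_find (a := 29) (P := fun u => σ4 23 u ≠ 0 ∧ σ4 11 u = 0) B4 (by decide) (by decide)
      fun u hu τ h h26 => ?_).mono (by simp [Expr.both, Expr.neg, sc, Expr.cost]) ?_
    · rw [Expr.eval_both, Expr.eval_neg]
      simp only [Expr.eval, sc, h26, h 23 (by decide) (by decide), h 11 (by decide) (by decide)]
    · rintro σ5 ⟨f5, h5⟩
      have hP : ∀ u : Fin n, (σ4 23 u ≠ 0 ∧ σ4 11 u = 0) ↔ u ∈ nbhd G R \ vs n (σ 11) := by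
        intro u
        rw [Set.mem_sdiff, ← h23, mem_vs, mem_vs, h11', not_not]
      refine ⟨by rw [f5 10 (by decide) (by decide), h10], h5.imp ?_ ?_⟩
      · rintro ⟨a1, a2⟩
        refine ⟨a1, fun u hu => ?_⟩
        by_contra hu'
        exact a2 u u.2 ((hP u).2 ⟨hu, hu'⟩)
      · rintro ⟨a1, a2, a3⟩
        exact ⟨⟨_, a1⟩, rfl, (hP ⟨_, a1⟩).1 a2, fun u hu => a3 u u.2 ((hP u).2 hu)⟩
  · simp only [size]
    omega

/-- The power of two that decides the next branching. -/
def power : Expr := .get 7 (.sub (sc 6) (.add (sc 32) (.lit 1)))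

/-- One level of the enumeration. -/
def level : Prog :=
  flow ⨾ .cond (.sub (sc 27) (sc 5)) (set 30 (.lit 2))
    (cut ⨾ .cond (.sub (sc 0) (sc 29))
      (.cond (.sub (.add (sc 31) (.lit 1)) power)
        (set 31 (.sub (sc 31) power) ⨾ .assign 10 (sc 29) (.lit 1))
        (.assign 11 (sc 29) (.lit 1)))
      (set 30 (.lit 1)))

/-- The outcome of one level, with `R` the furthest minimum cut and `P` the deciding power of two. -/
def LevelPost (G : SimpleGraph (Fin n)) (p P : ℕ) (T R : Set (Fin n)) (σ σ' : Store) : Prop :=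
  (p < (nbhd G R).ncard ∧ σ' 30 0 = 2) ∨
  ((nbhd G R).ncard ≤ p ∧ nbhd G R ⊆ T ∧ σ' 30 0 = 1 ∧ vs n (σ' 10) = R) ∨
  ((nbhd G R).ncard ≤ p ∧ σ' 30 0 = σ 30 0 ∧ ∃ x, IsGreatest (nbhd G R \ T) x ∧
    ((P ≤ σ 31 0 ∧ σ' 31 0 = σ 31 0 - P ∧ vs n (σ' 10) = insert x R ∧ vs n (σ' 11) = T) ∨
      (σ 31 0 < P ∧ σ' 31 0 = σ 31 0 ∧ vs n (σ' 10) = R ∧ vs n (σ' 11) = insert x T)))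

theorem runs_level (hadj : IsAdjList G adj) (hσ : Base adj k S σ) {v : Fin n}
    (hv : σ 33 0 = v) (hZ : vs n (σ 10) = Z) (hT : vs n (σ 11) = T) (hvZ : v ∈ Z)
    (hZc : Conn G Z) (hTZ : Disjoint T Z) :
    Runs level σ ((σ 5 0 + 2) * (2000 * size adj)) fun σ' => ∃ R, IsFar G Z T R ∧
      LevelPost G (σ 5 0) (σ 7 (σ 6 0 - (σ 32 0 + 1))) T R σ σ' := by
  refine ((runs_flow hadj hσ hZ hT hTZ).frame.seq (T' := 950 * size adj)
    fun σ1 ⟨h1, f1⟩ => ?_).mono (by nlinarith) fun _ h => h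
  have e5 := f1 5 (by decide)
  have e6 := f1 6 (by decide)
  have e7 := f1 7 (by decide)
  have e30 := f1 30 (by decide)
  have e31 := f1 31 (by decide)
  have e32 := f1 32 (by decide)
  have e33 := f1 33 (by decide)
  have e11 := f1 11 (by decide)
  refine (Runs.cond (T := 3) (T' := 940 * size adj) (fun hb => .flat rfl (by rfl) ?_)
    fun hb => ?_).mono (by simp only [sc, Expr.cost, size]; omega) fun _ h => h
  · simp only [Expr.eval, sc, e5] at hb
    have h2 := h1.le
    obtain ⟨R, hR⟩ := exists_isFar hZc hTZ.symm
    refine ⟨R, hR, .inl ⟨?_, by simp [set, Prog.act, Expr.eval, Store.write_same]⟩⟩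
    have := (h1.isFlow.ncard_le hR.1.1 hR.1.2.1).1
    have := h1.value
    omega
  · simp only [Expr.eval, sc, e5] at hb
    -- A value of at most `p` after `p + 1` rounds means that some round did not augment.
    have hs : IsStuck G Z T (decf n (σ1 12)) (vs n (σ1 13)) := h1.progress.resolve_left (by omega)
    have hvA : v ∉ vs n (σ1 13) := Set.disjoint_right.1 hs.avoid hvZ
    obtain ⟨hR, hcard⟩ := h1.isFlow.isFar hZc hvZ hs.terminals hs.avoid hs.closed hs.least hs.stuck
    set R := comp G (vs n (σ1 13))ᶜ v with hRdef
    have hp : (nbhd G R).ncard ≤ σ 5 0 := by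
      have := h1.value
      omega
    refine ((runs_cut hadj h1.base (by rw [e33, hv]) hvA).frame.seq (T' := 40 * size adj)
      fun σ2 ⟨⟨a1, a2⟩, f2⟩ => ?_).mono (by omega) fun _ h => h
    rw [← hRdef, e11, hT] at a2
    rw [← hRdef] at a1
    have i6 := f2 6 (by decide)
    have i7 := f2 7 (by decide)
    have i30 := f2 30 (by decide)
    have i31 := f2 31 (by decide)
    have i32 := f2 32 (by decide)
    have i11 := f2 11 (by decide)
    have hn : σ2 0 0 = n := by rw [f2 0 (by decide), h1.base.size]
    refine (Runs.flat rfl le_rfl ?_).mono (Q := fun σ' => LevelPost G (σ 5 0)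
      (σ 7 (σ 6 0 - (σ 32 0 + 1))) T R σ σ') ?_ fun _ h => ⟨R, hR, h⟩
    · have hpow : ∀ τ : Store, power.eval τ = τ 7 (τ 6 0 - (τ 32 0 + 1)) := fun _ => rfl
      rcases a2 with ⟨b1, b2⟩ | ⟨x, b1, b2⟩
      · refine .inr (.inl ⟨hp, b2, ?_, ?_⟩) <;>
          simp [Prog.act, set, sc, Expr.eval, hn, b1, Store.write_same, Store.write_ne, a1]
      · have hx := x.2
        refine .inr (.inr ⟨hp, ?_⟩)
        have hlt : n - (x : ℕ) ≠ 0 := by omega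
        -- Under truncated subtraction, `P ≤ r` is tested as `r + 1 - P ≠ 0`.
        by_cases hP : σ 7 (σ 6 0 - (σ 32 0 + 1)) ≤ σ 31 0
        · have hP' : σ 31 0 + 1 - σ 7 (σ 6 0 - (σ 32 0 + 1)) ≠ 0 := by omega
          have hact : (Prog.cond (.sub (sc 0) (sc 29))
            (.cond (.sub (.add (sc 31) (.lit 1)) power)
              (set 31 (.sub (sc 31) power) ⨾ .assign 10 (sc 29) (.lit 1))
              (.assign 11 (sc 29) (.lit 1)))
            (set 30 (.lit 1))).act σ2 =
              (σ2.write 31 0 (σ 31 0 - σ 7 (σ 6 0 - (σ 32 0 + 1)))).write 10 x 1 := by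
            simp only [Prog.act, set, sc, Expr.eval, hpow, hn, b1, i6, e6, i7, e7, i31, e31, i32, e32,
              hlt, hP', ne_eq, not_false_eq_true, if_true, Store.write_ne, Nat.reduceEqDiff]
          rw [hact]
          refine ⟨?_, x, b2, .inl ⟨hP, ?_, ?_, ?_⟩⟩
          · simp [Store.write_ne, i30, e30]
          · simp [Store.write_ne, Store.write_same]
          · rw [Store.write_same, vs_update one_ne_zero, Store.write_ne _ _ _ (by decide), a1]
          · simp [Store.write_ne, i11, e11, hT]
        · have hP' : σ 31 0 + 1 - σ 7 (σ 6 0 - (σ 32 0 + 1)) = 0 := by omega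
          have hact : (Prog.cond (.sub (sc 0) (sc 29))
            (.cond (.sub (.add (sc 31) (.lit 1)) power)
              (set 31 (.sub (sc 31) power) ⨾ .assign 10 (sc 29) (.lit 1))
              (.assign 11 (sc 29) (.lit 1)))
            (set 30 (.lit 1))).act σ2 = σ2.write 11 x 1 := by
            simp only [Prog.act, set, sc, Expr.eval, hpow, hn, b1, i6, e6, i7, e7, i31, e31, i32, e32,
              hlt, hP', ne_eq, not_false_eq_true, if_true, not_true_eq_false, if_false]
          rw [hact]
          refine ⟨?_, x, b2, .inr ⟨by omega, ?_, ?_, ?_⟩⟩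
          · simp [Store.write_ne, i30, e30]
          · simp [Store.write_ne, i31, e31]
          · rw [Store.write_ne _ _ _ (by decide), a1]
          · rw [Store.write_same, vs_update one_ne_zero, i11, e11, hT]
    · simp only [Prog.time, set, sc, power, Expr.cost, size]
      omega

/-! ### All levels of the enumeration for one guess -/

/-- Run the enumeration from the vertex `33[0]` with the guess `g`. The status `30[0]` becomes `1` if
it returns a set, which is then in array `10`. -/
def guess (g : Expr) : Prog :=
  fill 10 isRoot ⨾ fill 11 (.get 3 (sc 26)) ⨾ set 31 g ⨾
  set 30 (.add (.get 3 (sc 33)) (.get 3 (sc 33))) ⨾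
  forTo 32 (.add (sc 6) (.lit 1)) (.cond (sc 30) .skip level)

open Classical in
/-- The result of the enumeration from the vertex `v` with guess `r`. -/
noncomputable def candidate (G : SimpleGraph (Fin n)) (p : ℕ) (S : Set (Fin n)) (v : Fin n) (r : ℕ) :
    Option (Set (Fin n)) := if v ∈ S then none else enum G p (2 * p) r {v} S

/-- The tables of the program: the bound `p`, the number of branchings, the powers of two. -/
def Tables (p : ℕ) (σ : Store) : Prop :=
  σ 5 0 = p ∧ σ 6 0 = 2 * p ∧ ∀ j ≤ 2 * p, σ 7 j = 2 ^ j

theorem Tables.congr {p : ℕ} {σ' : Store} (h : Tables p σ) (h5 : σ' 5 = σ 5) (h6 : σ' 6 = σ 6)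
    (h7 : σ' 7 = σ 7) : Tables p σ' := by
  unfold Tables
  rwa [h5, h6, h7]

/-- The state after `j` levels of the enumeration with final result `E`. -/
def GuessState (G : SimpleGraph (Fin n)) (p : ℕ) (v : Fin n) (E : Option (Set (Fin n))) (j : ℕ)
    (τ : Store) : Prop :=
  (τ 30 0 = 0 ∧ v ∈ vs n (τ 10) ∧ Conn G (vs n (τ 10)) ∧ Disjoint (vs n (τ 11)) (vs n (τ 10)) ∧
    E = if j ≤ 2 * p then enum G p (2 * p - j) (τ 31 0) (vs n (τ 10)) (vs n (τ 11)) else none) ∨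
  (τ 30 0 = 1 ∧ E = some (vs n (τ 10))) ∨ (τ 30 0 = 2 ∧ E = none)

/-- One level of the program is one unfolding of `enum`: the three outcomes are a cut that is too
large, an accepted set, and a branching decided by the leading digit of the guess. -/
theorem LevelPost.guessState {p j : ℕ} {v : Fin n} {E : Option (Set (Fin n))} {R : Set (Fin n)}
    {σ' : Store} (hR : IsFar G (vs n (σ 10)) (vs n (σ 11)) R) (hv : v ∈ vs n (σ 10))
    (h0 : σ 30 0 = 0) (hj : j ≤ 2 * p)
    (hE : E = enum G p (2 * p - j) (σ 31 0) (vs n (σ 10)) (vs n (σ 11)))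
    (h : LevelPost G p (2 ^ (2 * p - (j + 1))) (vs n (σ 11)) R σ σ') :
    GuessState G p v E (j + 1) σ' := by
  rcases h with ⟨h1, h2⟩ | ⟨h1, h2, h3, h4⟩ | ⟨h1, h2, x, h3, h4⟩
  · exact .inr (.inr ⟨h2, by rw [hE, enum_of_lt hR h1]⟩)
  · exact .inr (.inl ⟨h3, by rw [hE, enum_of_subset hR h1 h2, h4]⟩)
  · refine .inl ⟨h2.trans h0, ?_⟩
    have hvR := hR.1.1 hv
    have key : j + 1 ≤ 2 * p → E = if 2 ^ (2 * p - (j + 1)) ≤ σ 31 0 then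
        enum G p (2 * p - (j + 1)) (σ 31 0 - 2 ^ (2 * p - (j + 1))) (insert x R) (vs n (σ 11))
        else enum G p (2 * p - (j + 1)) (σ 31 0) R (insert x (vs n (σ 11))) := fun hj' => by
      rw [hE, ← enum_succ hR h1 h3, show 2 * p - (j + 1) + 1 = 2 * p - j by omega]
    -- With budget zero `enum` fails instead of branching; what the program then writes to `10` and
    -- `11` is irrelevant to the result.
    have last : ¬ j + 1 ≤ 2 * p → E = none := fun hj' => by
      rw [hE, show 2 * p - j = 0 by omega, enum_zero_of_mem hR h3.1]
    rcases h4 with ⟨a1, a2, a3, a4⟩ | ⟨a1, a2, a3, a4⟩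
    · rw [a2, a3, a4]
      refine ⟨.inr hvR, hR.1.2.2.insert h3.1.1,
        Set.disjoint_insert_right.2 ⟨h3.1.2, hR.1.2.1.symm⟩, ?_⟩
      split
      · next hj' => rw [key hj', if_pos a1]
      · next hj' => exact last hj'
    · rw [a2, a3, a4]
      refine ⟨hvR, hR.1.2.2, Set.disjoint_insert_left.2 ⟨h3.1.1.1, hR.1.2.1.symm⟩, ?_⟩
      split
      · next hj' => rw [key hj', if_neg (by omega)]
      · next hj' => exact last hj'

/-- The arrays `34` and `35` count the guesses of the main loop and of the comparison loop; running
a guess must leave both alone. -/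
theorem runs_guess (hadj : IsAdjList G adj) (hσ : Base adj k S σ) {v : Fin n} {p r a : ℕ}
    (hv : σ 33 0 = v) (ht : Tables p σ) (ha : a = 34 ∨ a = 35) (hr : σ a 0 = r) :
    Runs (guess (sc a)) σ ((2 * p + 2) * ((p + 2) * (3000 * size adj))) fun σ' =>
      (σ' 30 0 = 1 ∧ candidate G p S v r = some (vs n (σ' 10))) ∨
      (σ' 30 0 ≠ 1 ∧ candidate G p S v r = none) := by
  refine ((runs_fill (a := 10) (e := isRoot) (f := fun u => if u = v then 1 else 0) hσ (by decide)
    (by decide) fun u _ τ h h26 _ => ?_).seq (T' := n * 23 + 20 + (4 + (9 +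
      ((2 * p + 1) * ((p + 2) * (2000 * size adj) + 18) + 11)))) fun σ1 ⟨f1, g1⟩ => ?_).mono ?_
      fun _ h => h
  · rw [eval_isRoot, h26, h 33 (by decide) (by decide), hv]
  · have B1 : Base adj k S σ1 := hσ.of_frame fun a ha => f1 a (by omega) (by omega)
    refine (runs_fill (a := 11) (e := .get 3 (sc 26)) (f := σ1 3) B1 (by decide)
      (by decide) fun u _ τ h h26 _ => ?_).seq fun σ2 ⟨f2, g2⟩ => ?_
    · simp only [Expr.eval, sc, h26, h 3 (by decide) (by decide)]
    have B2 : Base adj k S σ2 := B1.of_frame fun a ha => f2 a (by omega) (by omega)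
    refine (Runs.set_seq (Runs.set_seq
      (t := (2 * p + 1) * ((p + 2) * (2000 * size adj) + 18) + 11) ?_)).mono
      (by simp [sc, Expr.cost]) fun _ h => h
    have ev1 : (sc a).eval σ2 = r := by
      rw [eval_sc, f2 a (by omega) (by omega), f1 a (by omega) (by omega), hr]
    rw [ev1]
    have ev2 : (Expr.add (.get 3 (sc 33)) (.get 3 (sc 33))).eval (σ2.write 31 0 r) =
        σ2 3 v + σ2 3 v := by
      have : σ2 33 0 = v := by
        rw [f2 33 (by decide) (by decide), f1 33 (by decide) (by decide), hv]
      simp [sc, Expr.eval, Store.write_ne, this]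
    rw [ev2]
    have B3 : Base adj k S ((σ2.write 31 0 r).write 30 0 (σ2 3 v + σ2 3 v)) :=
      (B2.write (by decide)).write (by decide)
    have f3 : ∀ a, a ∉ [10, 11, 26, 30, 31] →
        ((σ2.write 31 0 r).write 30 0 (σ2 3 v + σ2 3 v)) a = σ a := fun a ha => by
      simp only [List.mem_cons, List.not_mem_nil, not_or] at ha
      rw [Store.write_ne _ _ _ (by tauto), Store.write_ne _ _ _ (by tauto),
        f2 a (by tauto) (by tauto), f1 a (by tauto) (by tauto)]
    have h30 : ((σ2.write 31 0 r).write 30 0 (σ2 3 v + σ2 3 v)) 30 0 =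
        σ2 3 v + σ2 3 v := by simp [Store.write_same]
    have h31 : ((σ2.write 31 0 r).write 30 0 (σ2 3 v + σ2 3 v)) 31 0 = r := by
      simp [Store.write_same, Store.write_ne]
    have h10 : vs n (((σ2.write 31 0 r).write 30 0 (σ2 3 v + σ2 3 v)) 10) = {v} := by
      simp only [Store.write_ne, ne_eq, Nat.reduceEqDiff, not_false_eq_true]
      rw [f2 10 (by decide) (by decide)]
      exact vs_indicator g1
    have h11 : vs n (((σ2.write 31 0 r).write 30 0 (σ2 3 v + σ2 3 v)) 11) = S := by
      simp only [Store.write_ne, ne_eq, Nat.reduceEqDiff, not_false_eq_true]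
      rw [← B1.terminals]
      exact vs_congr fun u hu => by rw [g2 u hu]
    have hS : v ∈ (S : Set (Fin n)) ↔ σ2 3 v ≠ 0 := by rw [← B2.terminals, mem_vs]
    have hle : σ2 3 v = 0 ∨ σ2 3 v = 1 := by
      rw [B2 3 (by decide)]
      simp only [inputStore]
      split <;> simp
    generalize (σ2.write 31 0 r).write 30 0 (σ2 3 v + σ2 3 v) = σ3 at B3 f3 h30 h31 h10 h11 ⊢
    -- There is one level more than there are branchings, since the last one still tests whether its
    -- cut is accepted.
    refine (Runs.forTo_const (m := 2 * p + 1) (c := (p + 2) * (2000 * size adj) + 4)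
      (I := fun j τ => Base adj k S τ ∧ Tables p τ ∧ τ 33 0 = v ∧
        GuessState G p v (candidate G p S v r) j τ) ?_ ?_ ?_).mono ?_ ?_
    · rintro j τ ⟨-, ⟨-, h, -⟩, -⟩
      simp [Expr.eval, sc, h]
    · refine ⟨B3.write (by decide), ?_, ?_, ?_⟩
      · refine ht.congr ?_ ?_ ?_ <;> rw [Store.write_ne _ _ _ (by decide), f3 _ (by decide)]
      · rw [Store.write_ne _ _ _ (by decide), f3 _ (by decide), hv]
      · unfold GuessState
        simp only [Store.write_ne, ne_eq, Nat.reduceEqDiff, not_false_eq_true, h30, h31, h10, h11]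
        -- Doubling the indicator of `S` gives a root in `S` the failure status `2` at once.
        by_cases hvS : v ∈ (S : Set (Fin n))
        · have : σ2 3 v = 1 := hle.resolve_left (hS.1 hvS)
          exact .inr (.inr ⟨by omega, by rw [candidate, if_pos hvS]⟩)
        · have : σ2 3 v = 0 := not_not.1 fun h => hvS (hS.2 h)
          exact .inl ⟨by omega, rfl, Conn.singleton v, Set.disjoint_singleton_right.2 hvS,
            by rw [candidate, if_neg hvS]; simp⟩
    · rintro j hj τ hτ ⟨a1, a2, a3, a4⟩
      refine (Runs.cond (T := 1) (T' := (p + 2) * (2000 * size adj)) (fun hb => .flat rfl le_rfl ?_)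
        fun hb => ?_).mono (by simp only [sc, Expr.cost]; omega) fun _ h => h
      · rw [eval_sc] at hb
        refine ⟨hτ, a1.write (by decide), a2.congr ?_ ?_ ?_, ?_, ?_⟩
        · exact Store.write_ne _ _ _ (by decide)
        · exact Store.write_ne _ _ _ (by decide)
        · exact Store.write_ne _ _ _ (by decide)
        · rw [Store.write_ne _ _ _ (by decide)]
          exact a3
        · rcases a4 with h | h
          · exact absurd h.1 hb
          · refine .inr ?_
            simp only [Store.write_ne, ne_eq, Nat.reduceEqDiff, not_false_eq_true]
            exact h
      · rw [eval_sc] at hb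
        rcases a4 with ⟨b0, b1, b2, b3, b4⟩ | h | h
        · rw [if_pos (by omega)] at b4
          have hlev := runs_level hadj a1 a3 rfl rfl b1 b2 b3
          rw [a2.1, a2.2.1, hτ, a2.2.2 _ (by omega)] at hlev
          refine hlev.frame.mono le_rfl ?_
          rintro ρ ⟨⟨R, hR, hpost⟩, hf⟩
          have hgs := hpost.guessState hR b1 b0 (by omega) b4
          refine ⟨by rw [hf 32 (by decide), hτ],
            (a1.of_frame fun a ha => hf a (by interval_cases a <;> decide)).write (by decide),
            a2.congr ?_ ?_ ?_, ?_, ?_⟩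
          · rw [Store.write_ne _ _ _ (by decide), hf _ (by decide)]
          · rw [Store.write_ne _ _ _ (by decide), hf _ (by decide)]
          · rw [Store.write_ne _ _ _ (by decide), hf _ (by decide)]
          · rw [Store.write_ne _ _ _ (by decide), hf _ (by decide), a3]
          · unfold GuessState at hgs ⊢
            simpa only [Store.write_ne, ne_eq, Nat.reduceEqDiff, not_false_eq_true] using hgs
        · omega
        · omega
    · simp only [Expr.cost, sc]
      ring_nf
      omega
    · rintro τ ⟨-, -, -, h | h | h⟩
      · refine .inr ⟨by omega, ?_⟩
        rw [h.2.2.2.2, if_neg (by omega)]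
      · exact .inl h
      · exact .inr ⟨by omega, h.2⟩
  · have h1 : n + 1 ≤ size adj := by simp only [size]; omega
    simp only [isRoot, Expr.neg, sc, Expr.cost]
    generalize size adj = M at *
    have h2 : M ≤ (p + 2) * M := Nat.le_mul_of_pos_left _ (by omega)
    generalize hX : (p + 2) * M = X at *
    have e1 : (p + 2) * (2000 * M) = 2000 * X := by rw [← hX]; ring
    have e2 : (p + 2) * (3000 * M) = 3000 * X := by rw [← hX]; ring
    rw [e1, e2]
    have h3 : p ≤ p * X := Nat.le_mul_of_pos_right _ (by omega)
    nlinarith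

end Guess

/-! ## The main program -/

section Main

variable {n : ℕ} {G : SimpleGraph (Fin n)} {adj : Fin n → List (Fin n)} {k : ℕ}
  {S : Finset (Fin n)} {σ : Store}

/-- Set up the tables. -/
def tables : Prog :=
  set 5 (.add (.get 0 (.lit 1)) (.add (.get 0 (.lit 1)) (.get 0 (.lit 1)))) ⨾
  set 6 (.add (sc 5) (sc 5)) ⨾ set 7 (.lit 1) ⨾
  forTo 34 (sc 6) (.assign 7 (.add (sc 34) (.lit 1)) (.add (.get 7 (sc 34)) (.get 7 (sc 34))))

theorem runs_tables (hσ : Base adj k S σ) :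
    Runs tables σ (200 * k + 50) (Tables (3 * k)) := by
  refine (Runs.set_seq (Runs.set_seq (Runs.set_seq (t := 2 * (3 * k) * 24 + 9) ?_))).mono
    (by simp only [sc, Expr.cost]; omega) fun _ h => h
  have e1 : (Expr.add (.get 0 (.lit 1)) (.add (.get 0 (.lit 1)) (.get 0 (.lit 1)))).eval σ =
      3 * k := by
    simp only [Expr.eval, hσ.param]
    omega
  rw [e1]
  have e2 : (Expr.add (sc 5) (sc 5)).eval (σ.write 5 0 (3 * k)) = 2 * (3 * k) := by
    simp only [Expr.eval, sc, Store.write_same, Function.update_self]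
    omega
  rw [e2, show (Expr.lit 1).eval _ = 1 from rfl]
  refine (Runs.forTo_const (m := 2 * (3 * k)) (c := 12) (I := fun j τ => τ 5 0 = 3 * k ∧
    τ 6 0 = 2 * (3 * k) ∧ ∀ i ≤ j, τ 7 i = 2 ^ i) ?_ ?_ ?_).mono ?_ fun _ h => h
  · exact fun j τ h => h.2.1
  · refine ⟨by simp [Store.write_ne, Store.write_same], by simp [Store.write_ne, Store.write_same], ?_⟩
    intro i hi
    rw [Nat.le_zero.1 hi]
    simp [Store.write_ne, Store.write_same]
  · rintro j - τ hτ ⟨a1, a2, a3⟩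
    refine .flat rfl (by simp [Prog.time, sc, Expr.cost]) ?_
    simp only [Prog.act, sc, Expr.eval, hτ]
    refine ⟨?_, ?_, ?_, fun i hi => ?_⟩
    · rwa [Store.write_ne _ _ _ (by decide)]
    · rwa [Store.write_ne _ _ _ (by decide), Store.write_ne _ _ _ (by decide)]
    · rwa [Store.write_ne _ _ _ (by decide), Store.write_ne _ _ _ (by decide)]
    · rw [Store.write_ne _ _ _ (by decide), Store.write_same, Function.update_apply]
      split
      · next h => rw [h, a3 j le_rfl, pow_succ]; omega
      · exact a3 i (by omega)
  · simp [sc, Expr.cost]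

/-- Tests whether the last guess was successful. -/
def isOk : Expr := .neg (.add (.sub (sc 30) (.lit 1)) (.sub (.lit 1) (sc 30)))

theorem eval_isOk : isOk.eval σ ≠ 0 ↔ σ 30 0 = 1 := by
  simp only [isOk, Expr.neg, Expr.eval, sc]
  omega

/-- The steps for one guess. -/
def guessTime (p M : ℕ) : ℕ := (2 * p + 2) * ((p + 2) * (3000 * M))

/-- Set `37[0]` to `0` if the guess `35[0]` gives a proper superset of the set in array `36`. -/
def compare : Prog :=
  guess (sc 35) ⨾ .cond isOk
    (find 38 (.both (.get 36 (sc 26)) (.neg (.get 10 (sc 26)))) ⨾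
      find 39 (.both (.get 10 (sc 26)) (.neg (.get 36 (sc 26)))) ⨾
      .cond (.both (.neg (.sub (sc 0) (sc 38))) (.sub (sc 0) (sc 39))) (set 37 (.lit 0)) .skip)
    .skip

theorem compare_mods : ∀ a ∈ [0, 1, 2, 3, 5, 6, 7, 33, 34, 35, 36, 41, 42], a ∉ compare.mods := by
  decide

theorem runs_compare (hadj : IsAdjList G adj) (hσ : Base adj k S σ) {v : Fin n} {p : ℕ}
    (hv : σ 33 0 = v) (ht : Tables p σ) :
    Runs compare σ (guessTime p (size adj) + 200 * size adj) fun σ' => (σ' 37 0 ≠ 0 ↔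
      σ 37 0 ≠ 0 ∧ ∀ C', candidate G p S v (σ 35 0) = some C' → ¬ vs n (σ 36) ⊂ C') := by
  refine ((runs_guess (G := G) hadj hσ hv ht (.inr rfl) rfl).frame.seq (T' := 200 * size adj)
    fun σ1 ⟨h1, f1⟩ => ?_).mono le_rfl fun _ h => h
  have e36 := f1 36 (by decide)
  have e37 := f1 37 (by decide)
  have B1 : Base adj k S σ1 := hσ.of_frame fun a ha => f1 a (by interval_cases a <;> decide)
  refine (Runs.cond (T := 150 * size adj) (T' := 1) (fun hb => ?_)
    fun hb => .flat rfl le_rfl ?_).mono ?_ fun _ h => h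
  · rw [eval_isOk] at hb
    have hc : candidate G p S v (σ 35 0) = some (vs n (σ1 10)) := by
      rcases h1 with h1 | h1
      · exact h1.2
      · exact absurd hb h1.1
    refine ((runs_find (a := 38) (e := .both (.get 36 (sc 26)) (.neg (.get 10 (sc 26))))
      (P := fun u => σ1 36 u ≠ 0 ∧ σ1 10 u = 0) B1 (by decide)
      (by decide) fun u hu τ h h26 => ?_).seq (T' := n * 35 + 20 + 30) fun σ2 ⟨f2, g2⟩ => ?_).mono ?_
      fun _ h => h
    · rw [Expr.eval_both, Expr.eval_neg]
      simp only [Expr.eval, sc, h26, h 36 (by decide) (by decide), h 10 (by decide) (by decide)]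
    · have B2 : Base adj k S σ2 := B1.of_frame fun a ha => f2 a (by omega) (by omega)
      refine ((runs_find (a := 39) (e := .both (.get 10 (sc 26)) (.neg (.get 36 (sc 26))))
        (P := fun u => σ1 10 u ≠ 0 ∧ σ1 36 u = 0) B2 (by decide)
        (by decide) fun u hu τ h h26 => ?_).mono (by simp [Expr.both, Expr.neg, sc, Expr.cost])
        fun _ h => h).seq fun σ3 ⟨f3, g3⟩ => .flat rfl ?_ ?_
      · rw [Expr.eval_both, Expr.eval_neg]
        simp only [Expr.eval, sc, h26, h 36 (by decide) (by decide), h 10 (by decide) (by decide),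
          f2 36 (by decide) (by decide), f2 10 (by decide) (by decide)]
      · simp [Prog.time, set, Expr.both, Expr.neg, sc, Expr.cost]
      · have B3 : Base adj k S σ3 := B2.of_frame fun a ha => f3 a (by omega) (by omega)
        -- Proper inclusion means no witness in `36` outside `10`, but one in `10` outside `36`; the
        -- value `n` stands for a missing witness.
        have hb3 : (Expr.both (.neg (.sub (sc 0) (sc 38))) (.sub (sc 0) (sc 39))).eval σ3 ≠ 0 ↔
            vs n (σ 36) ⊂ vs n (σ1 10) := by
          rw [Expr.eval_both, Expr.eval_neg]
          simp only [Expr.eval, sc, B3.size, f3 38 (by decide) (by decide)]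
          rw [ssubset_iff_subset_not_subset]
          refine and_congr ?_ ?_
          · constructor
            · intro h u hu
              rcases g2 with ⟨-, g2⟩ | ⟨g2, -⟩
              · rw [← e36] at hu
                exact fun h0 => g2 u u.2 ⟨hu, h0⟩
              · omega
            · intro h
              rcases g2 with ⟨g2, -⟩ | ⟨g2, g4, -⟩
              · omega
              · exfalso
                have : (⟨_, g2⟩ : Fin n) ∈ vs n (σ 36) := by
                  rw [← e36]
                  exact g4.1
                exact h this g4.2
          · constructor
            · intro h hsub
              rcases g3 with ⟨g3, -⟩ | ⟨g3, g4, -⟩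
              · omega
              · have : (⟨_, g3⟩ : Fin n) ∈ vs n (σ1 10) := g4.1
                have := hsub this
                rw [← e36] at this
                exact this g4.2
            · intro h
              rcases g3 with ⟨-, g3⟩ | ⟨g3, -⟩
              · exfalso
                refine h fun u hu => ?_
                rw [← e36]
                exact fun h0 => g3 u u.2 ⟨hu, h0⟩
              · omega
        have e37' : σ3 37 = σ 37 := by
          rw [f3 37 (by decide) (by decide), f2 37 (by decide) (by decide), e37]
        simp only [Prog.act, hc, Option.some.injEq, forall_eq']
        split
        · next h =>
          rw [hb3] at h
          simp [set, Prog.act, Expr.eval, Store.write_same, h]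
        · next h =>
          rw [hb3] at h
          simp [e37', h]
    · simp only [Expr.both, Expr.neg, sc, Expr.cost, size]
      omega
  · have hok : σ1 30 0 ≠ 1 := fun h => eval_isOk.2 h hb
    have hc : candidate G p S v (σ 35 0) = none := by
      rcases h1 with h1 | h1
      · exact absurd h1.1 hok
      · exact h1.2
    simp [Prog.act, e37, hc]
  · simp only [isOk, Expr.neg, sc, Expr.cost, size]
    omega

/-- `C` is not properly contained in another candidate for `v`. -/
def IsTop (G : SimpleGraph (Fin n)) (p : ℕ) (S : Set (Fin n)) (v : Fin n) (C : Set (Fin n)) (N : ℕ) :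
    Prop := ∀ r < N, ∀ C', candidate G p S v r = some C' → ¬ C ⊂ C'

/-- Set `37[0]` to a truth value: the set in array `36` is in no larger candidate for `33[0]`. -/
def check : Prog := set 37 (.lit 1) ⨾ forTo 35 (.get 7 (sc 6)) compare

theorem runs_check (hadj : IsAdjList G adj) (hσ : Base adj k S σ) {v : Fin n} {p : ℕ}
    (hv : σ 33 0 = v) (ht : Tables p σ) :
    Runs check σ (2 ^ (2 * p) * (guessTime p (size adj) + 300 * size adj)) fun σ' =>
      (σ' 37 0 ≠ 0 ↔ IsTop G p S v (vs n (σ 36)) (2 ^ (2 * p))) := by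
  refine (Runs.set_seq (Runs.forTo_const (m := 2 ^ (2 * p))
    (c := guessTime p (size adj) + 200 * size adj)
    (I := fun j τ => Base adj k S τ ∧ Tables p τ ∧ τ 33 0 = v ∧ τ 36 = σ 36 ∧
      (τ 37 0 ≠ 0 ↔ IsTop G p S v (vs n (σ 36)) j)) ?_ ?_ ?_)).mono ?_ ?_
  · rintro j τ ⟨-, ⟨-, h6, h7⟩, -⟩
    simp [Expr.eval, sc, h6, h7]
  · refine ⟨(hσ.write (by decide)).write (by decide), ht.congr ?_ ?_ ?_, ?_, ?_, ?_⟩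
    all_goals simp [Store.write_ne, Store.write_same, Expr.eval, hv]
    exact fun r hr => absurd hr (Nat.not_lt_zero r)
  · rintro j - τ hτ ⟨a1, a2, a3, a4, a5⟩
    refine (runs_compare (G := G) hadj a1 a3 a2).frame.mono le_rfl ?_
    rintro ρ ⟨h, hf⟩
    have hf' : ∀ a ∈ [0, 1, 2, 3, 5, 6, 7, 33, 34, 35, 36, 41, 42], ρ a = τ a :=
      fun a ha => hf a (compare_mods a ha)
    refine ⟨by rw [hf' 35 (by decide), hτ],
      (a1.of_frame fun a ha => hf' a (by interval_cases a <;> decide)).write (by decide),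
      a2.congr ?_ ?_ ?_, ?_, ?_, ?_⟩
    · rw [Store.write_ne _ _ _ (by decide), hf' _ (by decide)]
    · rw [Store.write_ne _ _ _ (by decide), hf' _ (by decide)]
    · rw [Store.write_ne _ _ _ (by decide), hf' _ (by decide)]
    · rw [Store.write_ne _ _ _ (by decide), hf' _ (by decide), a3]
    · rw [Store.write_ne _ _ _ (by decide), hf' _ (by decide), a4]
    · rw [Store.write_ne _ _ _ (by decide), h, a5, hτ, a4]
      constructor
      · rintro ⟨h1, h2⟩ r hr
        rcases Nat.lt_succ_iff_lt_or_eq.1 hr with hr | rfl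
        · exact h1 r hr
        · exact h2
      · exact fun h => ⟨fun r hr => h r (by omega), h j (by omega)⟩
  · have h1 : 1 ≤ size adj := by simp only [size]; omega
    have h2 : 1 ≤ 2 ^ (2 * p) := Nat.one_le_two_pow
    simp only [sc, Expr.cost]
    generalize 2 ^ (2 * p) = N at *
    generalize guessTime p (size adj) = g
    have : N * 13 + 13 ≤ N * (100 * size adj) := by nlinarith
    nlinarith
  · exact fun τ h => h.2.2.2.2

/-- Process the guess `34[0]` for the vertex `33[0]`. -/
def process : Prog :=
  guess (sc 34) ⨾ .cond isOk
    (fill 36 (.get 10 (sc 26)) ⨾ check ⨾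
      .cond (sc 37)
        (.assign 42 (sc 33) (.lit 1) ⨾ fill 24 (.get 36 (sc 26)) ⨾ nbr ⨾
          fill 41 (.add (.get 41 (sc 26)) (.get 23 (sc 26))))
        .skip)
    .skip

theorem process_mods : ∀ a ∈ [0, 1, 2, 3, 5, 6, 7, 33, 34], a ∉ process.mods := by
  decide

/-- The guess `r` for the vertex `v` yields the set `C`, which is in no larger candidate. -/
def Good (G : SimpleGraph (Fin n)) (p : ℕ) (S : Set (Fin n)) (v : Fin n) (r : ℕ) (C : Set (Fin n)) :
    Prop := candidate G p S v r = some C ∧ IsTop G p S v C (2 ^ (2 * p))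

/-- Several guesses may yield the same set; this is harmless, as results are only united. -/
theorem runs_process (hadj : IsAdjList G adj) (hσ : Base adj k S σ) {v : Fin n} {p : ℕ}
    (hv : σ 33 0 = v) (ht : Tables p σ) :
    Runs process σ (2 ^ (2 * p) * (2 * guessTime p (size adj) + 800 * size adj)) fun σ' =>
      vs n (σ' 42) = vs n (σ 42) ∪ {u | u = v ∧ ∃ C, Good G p S v (σ 34 0) C} ∧
      vs n (σ' 41) = vs n (σ 41) ∪ {x | ∃ C, Good G p S v (σ 34 0) C ∧ x ∈ nbhd G C} := by
  have hN : 1 ≤ 2 ^ (2 * p) := Nat.one_le_two_pow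
  have hM : n + 1 ≤ size adj := by simp only [size]; omega
  refine ((runs_guess (G := G) hadj hσ hv ht (.inl rfl) rfl).frame.seq
    (T' := 2 ^ (2 * p) * (guessTime p (size adj) + 300 * size adj) + 450 * size adj)
    fun σ1 ⟨h1, f1⟩ => ?_).mono (by
      change guessTime p (size adj) + _ ≤ _
      nlinarith) fun _ h => h
  have e33 := f1 33 (by decide)
  have e41 := f1 41 (by decide)
  have e42 := f1 42 (by decide)
  have B1 : Base adj k S σ1 := hσ.of_frame fun a ha => f1 a (by interval_cases a <;> decide)
  have T1 : Tables p σ1 := ht.congr (f1 _ (by decide)) (f1 _ (by decide)) (f1 _ (by decide))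
  refine (Runs.cond
    (T := 2 ^ (2 * p) * (guessTime p (size adj) + 300 * size adj) + 430 * size adj) (T' := 1)
    (fun hb => ?_) fun hb => .flat rfl le_rfl ?_).mono ?_ fun _ h => h
  · rw [eval_isOk] at hb
    have hc : candidate G p S v (σ 34 0) = some (vs n (σ1 10)) := by
      rcases h1 with h1 | h1
      · exact h1.2
      · exact absurd hb h1.1
    refine ((runs_fill (a := 36) (e := .get 10 (sc 26)) (f := σ1 10) B1 (by decide) (by decide)
      fun u _ τ h h26 _ => ?_).seq
      (T' := 2 ^ (2 * p) * (guessTime p (size adj) + 300 * size adj) + 400 * size adj)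
      fun σ2 ⟨f2, g2⟩ => ?_).mono ?_ fun _ h => h
    · simp only [Expr.eval, sc, h26, h 10 (by decide) (by decide)]
    · have B2 : Base adj k S σ2 := B1.of_frame fun a ha => f2 a (by omega) (by omega)
      have T2 : Tables p σ2 := T1.congr (f2 _ (by decide) (by decide)) (f2 _ (by decide) (by decide))
        (f2 _ (by decide) (by decide))
      have h36 : vs n (σ2 36) = vs n (σ1 10) := vs_congr fun u hu => by rw [g2 u hu]
      refine (runs_check (G := G) (v := v) hadj B2 (by rw [f2 33 (by decide) (by decide), e33, hv]) T2).frame.seq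
        fun σ3 ⟨h3, f3⟩ => ?_
      rw [h36] at h3
      have i33 : σ3 33 0 = v := by
        rw [f3 33 (by decide), f2 33 (by decide) (by decide), e33, hv]
      have i41 : σ3 41 = σ 41 := by rw [f3 41 (by decide), f2 41 (by decide) (by decide), e41]
      have i42 : σ3 42 = σ 42 := by rw [f3 42 (by decide), f2 42 (by decide) (by decide), e42]
      have i36 : vs n (σ3 36) = vs n (σ1 10) := by rw [f3 36 (by decide), h36]
      have B3 : Base adj k S σ3 := B2.of_frame fun a ha => f3 a (by interval_cases a <;> decide)
      refine (Runs.cond (T := 350 * size adj) (T' := 1) (fun hb' => ?_)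
        fun hb' => .flat rfl le_rfl ?_).mono (by simp only [sc, Expr.cost]; omega) fun _ h => h
      · have htop := h3.1 hb'
        have hgood : ∀ C, Good G p S v (σ 34 0) C ↔ C = vs n (σ1 10) := fun C => by
          constructor
          · rintro ⟨hC, -⟩
            exact Option.some.inj (hC.symm.trans hc)
          · rintro rfl
            exact ⟨hc, htop⟩
        have w1 : Runs (.assign 42 (sc 33) (.lit 1)) σ3 4 fun σ' => σ' = σ3.write 42 v 1 :=
          .flat rfl (by simp [Prog.time, sc, Expr.cost])
            (by simp [Prog.act, sc, Expr.eval, i33])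
        refine (w1.seq (T' := n * 23 + 20 + (200 * size adj + (n * 27 + 20))) fun σ4 h4 => ?_).mono
          (by omega) fun _ h => h
        have f4 : ∀ a, a ≠ 42 → σ4 a = σ3 a := fun a ha => by rw [h4, Store.write_ne _ _ _ ha]
        have B4 : Base adj k S σ4 := B3.of_frame fun a ha => f4 a (by omega)
        refine (runs_fill (a := 24) (e := .get 36 (sc 26)) (f := σ4 36) B4 (by decide) (by decide)
          fun u _ τ h h26 _ => ?_).seq fun σ5 ⟨f5, g5⟩ => ?_
        · simp only [Expr.eval, sc, h26, h 36 (by decide) (by decide)]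
        have B5 : Base adj k S σ5 := B4.of_frame fun a ha => f5 a (by omega) (by omega)
        have h24 : vs n (σ5 24) = vs n (σ1 10) := by
          rw [← i36, ← f4 36 (by decide)]
          exact vs_congr fun u hu => by rw [g5 u hu]
        refine (runs_nbr hadj B5).frame.seq fun σ6 ⟨h6, f6⟩ => ?_
        have B6 : Base adj k S σ6 := B5.of_frame fun a ha => f6 a (by interval_cases a <;> decide)
        refine (runs_fill (a := 41) (e := .add (.get 41 (sc 26)) (.get 23 (sc 26)))
          (f := fun u => σ6 41 u + σ6 23 u) B6 (by decide) (by decide)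
          fun u _ τ h h26 h41 => ?_).mono (by simp [sc, Expr.cost]) ?_
        · simp only [Expr.eval, sc, h26, h41, h 23 (by decide) (by decide)]
        · rintro σ7 ⟨f7, g7⟩
          have j41 : σ6 41 = σ 41 := by
            rw [f6 41 (by decide), f5 41 (by decide) (by decide), f4 41 (by decide), i41]
          constructor
          · rw [f7 42 (by decide) (by decide), f6 42 (by decide), f5 42 (by decide) (by decide), h4,
              Store.write_same, vs_update one_ne_zero, i42]
            ext u
            simp only [Set.mem_insert_iff, Set.mem_union, Set.mem_ofPred_eq, hgood, exists_eq, and_true]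
            tauto
          · ext u
            rw [mem_vs, g7 u u.2, j41]
            simp only [Set.mem_union, Set.mem_ofPred_eq, hgood, exists_eq_left, ← h24, ← h6, mem_vs]
            omega
      · have htop : ¬ IsTop G p S v (vs n (σ1 10)) (2 ^ (2 * p)) := fun h => h3.2 h hb'
        have hgood : ∀ C, ¬ Good G p S v (σ 34 0) C := by
          rintro C ⟨hC, h⟩
          rw [Option.some.inj (hC.symm.trans hc)] at h
          exact htop h
        simp [Prog.act, i41, i42, hgood]
    · simp only [sc, Expr.cost]
      omega
  · have hok : σ1 30 0 ≠ 1 := fun h => eval_isOk.2 h hb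
    have hc : candidate G p S v (σ 34 0) = none := by
      rcases h1 with h1 | h1
      · exact absurd h1.1 hok
      · exact h1.2
    simp [Prog.act, e41, e42, Good, hc]
  · simp only [isOk, Expr.neg, sc, Expr.cost]
    omega

/-! ### The loop over roots and guesses, and correctness of the output -/

/-- The program that computes `chipBag`. -/
def main : Prog :=
  tables ⨾ forTo 33 (sc 0) (forTo 34 (.get 7 (sc 6)) process) ⨾
  fill 4 (.add (.neg (.get 42 (sc 26))) (.get 41 (sc 26)))

/-- The pairs of a vertex and a guess before `(i, j)`. -/
def Done (N i j u r : ℕ) : Prop := (u < i ∧ r < N) ∨ (u = i ∧ r < j)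

/-- The results collected before the pair `(i, j)` is processed. -/
def MainState (G : SimpleGraph (Fin n)) (p : ℕ) (S : Set (Fin n)) (i j : ℕ) (τ : Store) : Prop :=
  vs n (τ 42) = {u : Fin n | ∃ r C, Done (2 ^ (2 * p)) i j u r ∧ Good G p S u r C} ∧
  vs n (τ 41) = {x | ∃ (u : Fin n) (r : ℕ) (C : Set (Fin n)), Done (2 ^ (2 * p)) i j u r ∧
    Good G p S u r C ∧ x ∈ nbhd G C}

theorem runs_vertex (hadj : IsAdjList G adj) (hσ : Base adj k S σ) {v : Fin n} {p : ℕ}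
    (hv : σ 33 0 = v) (ht : Tables p σ) (hm : MainState G p S v 0 σ) :
    Runs (forTo 34 (.get 7 (sc 6)) process) σ
      (2 ^ (2 * p) * (2 ^ (2 * p) * (2 * guessTime p (size adj) + 900 * size adj)))
      (MainState G p S (v + 1) 0) := by
  refine (Runs.forTo_const (m := 2 ^ (2 * p))
    (c := 2 ^ (2 * p) * (2 * guessTime p (size adj) + 800 * size adj))
    (I := fun j τ => Base adj k S τ ∧ Tables p τ ∧ τ 33 0 = v ∧ MainState G p S v j τ)
    ?_ ?_ ?_).mono ?_ ?_
  · rintro j τ ⟨-, ⟨-, h6, h7⟩, -⟩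
    simp [Expr.eval, sc, h6, h7]
  · refine ⟨hσ.write (by decide), ht.congr ?_ ?_ ?_, ?_, ?_⟩
    · rw [Store.write_ne _ _ _ (by decide)]
    · rw [Store.write_ne _ _ _ (by decide)]
    · rw [Store.write_ne _ _ _ (by decide)]
    · rw [Store.write_ne _ _ _ (by decide), hv]
    · unfold MainState at hm ⊢
      rwa [Store.write_ne _ _ _ (by decide), Store.write_ne _ _ _ (by decide)]
  · rintro j hj τ hτ ⟨a1, a2, a3, a4, a5⟩
    refine (runs_process (G := G) hadj a1 a3 a2).frame.mono le_rfl ?_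
    rintro ρ ⟨⟨h1, h2⟩, hf⟩
    have hf' : ∀ a ∈ [0, 1, 2, 3, 5, 6, 7, 33, 34], ρ a = τ a := fun a ha => hf a (process_mods a ha)
    refine ⟨by rw [hf' 34 (by decide), hτ],
      (a1.of_frame fun a ha => hf' a (by interval_cases a <;> decide)).write (by decide),
      a2.congr ?_ ?_ ?_, ?_, ?_, ?_⟩
    · rw [Store.write_ne _ _ _ (by decide), hf' _ (by decide)]
    · rw [Store.write_ne _ _ _ (by decide), hf' _ (by decide)]
    · rw [Store.write_ne _ _ _ (by decide), hf' _ (by decide)]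
    · rw [Store.write_ne _ _ _ (by decide), hf' _ (by decide), a3]
    · rw [Store.write_ne _ _ _ (by decide), h1, a4, hτ]
      ext u
      simp only [Set.mem_union, Set.mem_ofPred_eq]
      constructor
      · rintro (⟨r, C, hd, hg⟩ | ⟨rfl, C, hg⟩)
        · exact ⟨r, C, hd.imp id fun h => ⟨h.1, by omega⟩, hg⟩
        · exact ⟨j, C, .inr ⟨rfl, by omega⟩, hg⟩
      · rintro ⟨r, C, hd, hg⟩
        rcases hd with hd | ⟨hu, hr⟩
        · exact .inl ⟨r, C, .inl hd, hg⟩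
        · rcases Nat.lt_succ_iff_lt_or_eq.1 hr with hr | rfl
          · exact .inl ⟨r, C, .inr ⟨hu, hr⟩, hg⟩
          · cases Fin.ext hu
            exact .inr ⟨rfl, C, hg⟩
    · rw [Store.write_ne _ _ _ (by decide), h2, a5, hτ]
      ext x
      simp only [Set.mem_union, Set.mem_ofPred_eq]
      constructor
      · rintro (⟨u, r, C, hd, hg⟩ | ⟨C, hg⟩)
        · exact ⟨u, r, C, hd.imp id fun h => ⟨h.1, by omega⟩, hg⟩
        · exact ⟨v, j, C, .inr ⟨rfl, by omega⟩, hg⟩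
      · rintro ⟨u, r, C, hd, hg⟩
        rcases hd with hd | ⟨hu, hr⟩
        · exact .inl ⟨u, r, C, .inl hd, hg⟩
        · rcases Nat.lt_succ_iff_lt_or_eq.1 hr with hr | rfl
          · exact .inl ⟨u, r, C, .inr ⟨hu, hr⟩, hg⟩
          · cases Fin.ext hu
            exact .inr ⟨C, hg⟩
  · have h1 : 1 ≤ size adj := by simp only [size]; omega
    have h2 : 1 ≤ 2 ^ (2 * p) := Nat.one_le_two_pow
    simp only [sc, Expr.cost]
    generalize 2 ^ (2 * p) = N at *
    generalize guessTime p (size adj) = g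
    have : 23 ≤ N * (100 * size adj) := by nlinarith
    calc _ ≤ N * (N * (2 * g + 800 * size adj)) + N * 23 := by nlinarith
      _ ≤ N * (N * (2 * g + 800 * size adj)) + N * (N * (100 * size adj)) := by gcongr
      _ = _ := by ring
  · rintro τ ⟨-, -, -, h1, h2⟩
    -- Having finished all guesses for `v` is the same as not having begun those for `v + 1`.
    have hd : ∀ u r, Done (2 ^ (2 * p)) v (2 ^ (2 * p)) u r ↔ Done (2 ^ (2 * p)) (v + 1) 0 u r := by
      intro u r
      unfold Done
      omega
    simp only [hd] at h1 h2
    exact ⟨h1, h2⟩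

/-- All candidates are free and contain `v`, and by completeness every maximal free set through `v`
is a candidate. So maximality among the candidates is maximality among all free sets. -/
theorem good_iff {v : Fin n} {C : Set (Fin n)} :
    (∃ r < 2 ^ (2 * (3 * k)), Good G (3 * k) S v r C) ↔ C ∈ maxChips G k S ∧ v ∈ C := by
  rw [maxChips_eq]
  have hcand : ∀ r C, candidate G (3 * k) S v r = some C → v ∈ C ∧ IsFree G S (3 * k) C := by
    intro r C h
    rw [candidate] at h
    split at h
    · cases h
    · next hvS =>
      obtain ⟨h1, h2⟩ := enum_sound (Conn.singleton v) (Set.disjoint_singleton_left.2 hvS) h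
      exact ⟨h1 rfl, h2⟩
  have hex : ∀ C, Maximal (IsFree G S (3 * k)) C → v ∈ C →
      ∃ r < 2 ^ (2 * (3 * k)), candidate G (3 * k) S v r = some C := by
    intro C hC hvC
    obtain ⟨r, hr, h⟩ := exists_enum_eq hC hvC
    exact ⟨r, hr, by rw [candidate, if_neg (Set.disjoint_left.1 hC.1.2.1 hvC), h]⟩
  constructor
  · rintro ⟨r, hr, hc, htop⟩
    obtain ⟨hvC, hfree⟩ := hcand r C hc
    obtain ⟨D, hCD, hD⟩ := exists_maximal_isFree hfree
    obtain ⟨r', hr', hc'⟩ := hex D hD (hCD hvC)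
    have : C = D := by
      by_contra hne
      exact htop r' hr' D hc' (hCD.ssubset_of_ne hne)
    exact ⟨this ▸ hD, hvC⟩
  · rintro ⟨hC, hvC⟩
    obtain ⟨r, hr, hc⟩ := hex C hC hvC
    exact ⟨r, hr, hc, fun r' _ C' hc' hss => hss.2 (hC.2 (hcand r' C' hc').2 hss.1)⟩

theorem MainState.chipBag {τ : Store} (h : MainState G (3 * k) S n 0 τ) (u : Fin n) :
    u ∈ chipBag G k S ↔ τ 42 u = 0 ∨ τ 41 u ≠ 0 := by
  have hd : ∀ (u : Fin n) r, Done (2 ^ (2 * (3 * k))) n 0 u r ↔ r < 2 ^ (2 * (3 * k)) := by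
    intro u r
    have := u.2
    unfold Done
    omega
  obtain ⟨h1, h2⟩ := h
  simp only [hd] at h1 h2
  have g : ∀ (u : Fin n) C, (∃ r < 2 ^ (2 * (3 * k)), Good G (3 * k) S u r C) ↔
      C ∈ maxChips G k S ∧ u ∈ C := fun u C => good_iff
  have e1 : τ 42 u ≠ 0 ↔ ∃ C ∈ maxChips G k S, u ∈ C := by
    rw [← mem_vs, h1]
    simp only [Set.mem_ofPred_eq]
    constructor
    · rintro ⟨r, C, hr, hC⟩
      exact ⟨C, ((g u C).1 ⟨r, hr, hC⟩)⟩
    · rintro ⟨C, hC, huC⟩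
      obtain ⟨r, hr, h⟩ := (g u C).2 ⟨hC, huC⟩
      exact ⟨r, C, hr, h⟩
  have e2 : τ 41 u ≠ 0 ↔ ∃ C ∈ maxChips G k S, u ∈ nbhd G C := by
    rw [← mem_vs, h2]
    simp only [Set.mem_ofPred_eq]
    constructor
    · rintro ⟨w, r, C, hr, hC, hu⟩
      exact ⟨C, ((g w C).1 ⟨r, hr, hC⟩).1, hu⟩
    · rintro ⟨C, hC, hu⟩
      -- A chip is found from any root inside it, for instance from a neighbour `w` of `u`.
      obtain ⟨-, w, hw, -⟩ := id hu
      obtain ⟨r, hr, h⟩ := (g w C).2 ⟨hC, hw⟩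
      exact ⟨w, r, C, hr, h, hu⟩
  rw [mem_chipBag_iff, e2, ← not_ne_iff, e1]
  push Not
  rfl

theorem runs_main (hadj : IsAdjList G adj) :
    Runs main (inputStore adj k S) (200 * k + 50 + (n * (2 ^ (2 * (3 * k)) * (2 ^ (2 * (3 * k)) *
      (2 * guessTime (3 * k) (size adj) + 900 * size adj)) + 12) + 9 + (n * 40 + 20)))
      fun σ' => outputSet n σ' = chipBag G k S := by
  have hσ : Base adj k S (inputStore adj k S) := fun _ _ => rfl
  refine (runs_tables hσ).frame.seq fun σ1 ⟨h1, f1⟩ => ?_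
  have B1 : Base adj k S σ1 := hσ.of_frame fun a ha => f1 a (by interval_cases a <;> decide)
  have z41 : ∀ x, σ1 41 x = 0 := fun x => by rw [f1 41 (by decide)]; rfl
  have z42 : ∀ x, σ1 42 x = 0 := fun x => by rw [f1 42 (by decide)]; rfl
  refine ((Runs.forTo_const (m := n) (c := 2 ^ (2 * (3 * k)) * (2 ^ (2 * (3 * k)) *
    (2 * guessTime (3 * k) (size adj) + 900 * size adj)))
    (I := fun i τ => Base adj k S τ ∧ Tables (3 * k) τ ∧
    MainState G (3 * k) S i 0 τ) ?_ ?_ ?_).mono ?_ fun _ h => h).seq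
    fun σ2 ⟨B2, _, h2⟩ => (runs_fill (a := 4) (f := fun u => (1 - σ2 42 u) + σ2 41 u) B2 (by decide)
      (by decide) fun u _ τ h h26 _ => ?_).mono ?_ ?_
  · exact fun i τ h => h.1.size
  · refine ⟨B1.write (by decide), h1.congr ?_ ?_ ?_, ?_, ?_⟩
    · rw [Store.write_ne _ _ _ (by decide)]
    · rw [Store.write_ne _ _ _ (by decide)]
    · rw [Store.write_ne _ _ _ (by decide)]
    · rw [Store.write_ne _ _ _ (by decide)]
      ext u
      simp [mem_vs, z42, Done]
    · rw [Store.write_ne _ _ _ (by decide)]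
      ext u
      simp [mem_vs, z41, Done]
  · rintro i hi τ hτ ⟨a1, a2, a3⟩
    refine (runs_vertex (v := ⟨i, hi⟩) hadj a1 hτ a2 a3).frame.mono le_rfl ?_
    rintro ρ ⟨h, hf⟩
    refine ⟨by rw [hf 33 (by decide), hτ],
      (a1.of_frame fun a ha => hf a (by interval_cases a <;> decide)).write (by decide),
      a2.congr ?_ ?_ ?_, ?_⟩
    · rw [Store.write_ne _ _ _ (by decide), hf _ (by decide)]
    · rw [Store.write_ne _ _ _ (by decide), hf _ (by decide)]
    · rw [Store.write_ne _ _ _ (by decide), hf _ (by decide)]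
    · unfold MainState at h ⊢
      rwa [Store.write_ne _ _ _ (by decide), Store.write_ne _ _ _ (by decide)]
  · simp [sc, Expr.cost]
  · simp only [Expr.neg, Expr.eval, sc, h26, h 41 (by decide) (by decide), h 42 (by decide) (by decide)]
  · simp only [Expr.neg, sc, Expr.cost]
    omega
  · rintro σ3 ⟨-, g3⟩
    ext u
    rw [h2.chipBag u]
    change σ3 4 u ≠ 0 ↔ _
    rw [g3 u u.2]
    omega

/-! ### Total running time -/

theorem sum_length_eq (hadj : IsAdjList G adj) :
    ∑ u, (adj u).length = 2 * G.edgeSet.ncard := by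
  classical
  have h : ∀ u, (adj u).length = G.degree u := by
    intro u
    rw [← SimpleGraph.card_neighborFinset_eq_degree, ← List.toFinset_card_of_nodup (hadj u).1]
    congr 1
    ext w
    simp [(hadj u).2]
  simp only [h]
  rw [SimpleGraph.sum_degrees_eq_twice_card_edges, Set.ncard_eq_toFinset_card']
  rfl

/-- With `N = 4^{3k}`, two factors `N` come from the nested loops over guesses and one from a crude
bound on the polynomial in `k` for a single guess, in all `2^{18k}`. The hypothesis `n ≤ m + 1`
turns `n(n + 2m + 1)` into a multiple of `nm + 1`. -/
theorem main_time_le (k n m : ℕ) (hn : 1 ≤ n) (hm : n ≤ m + 1) :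
    200 * k + 50 + (n * (2 ^ (2 * (3 * k)) * (2 ^ (2 * (3 * k)) *
      (2 * guessTime (3 * k) (n + 2 * m + 1) + 900 * (n + 2 * m + 1))) + 12) + 9 + (n * 40 + 20)) ≤
    1000000 * 2 ^ (1000000 * k) * (n * m + 1) := by
  set p := 3 * k with hp
  set M := n + 2 * m + 1 with hM
  set N := 2 ^ (2 * p) with hN
  set Y := 2 ^ p with hY
  have hYp : p + 1 ≤ Y := Nat.lt_two_pow_self
  have hNY : N = Y * Y := by rw [hN, two_mul, pow_add]
  have hN1 : 1 ≤ N := Nat.one_le_two_pow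
  have hg : guessTime p M ≤ 12000 * (N * M) := by
    unfold guessTime
    calc (2 * p + 2) * ((p + 2) * (3000 * M)) ≤ (2 * Y) * ((2 * Y) * (3000 * M)) := by
          gcongr <;> omega
      _ = 12000 * (N * M) := by rw [hNY]; ring
  have hMN : M ≤ N * M := Nat.le_mul_of_pos_left _ hN1
  have hin : 2 * guessTime p M + 900 * M ≤ 24900 * (N * M) := by omega
  have hnM : n * M ≤ 5 * (n * m + 1) := by
    rw [hM]
    nlinarith
  have hN3 : 1 ≤ N * N * N := Nat.one_le_iff_ne_zero.2 (by positivity)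
  have hmain : n * (N * (N * (2 * guessTime p M + 900 * M))) ≤ 124500 * (N * N * N * (n * m + 1)) := by
    calc _ ≤ n * (N * (N * (24900 * (N * M)))) := by gcongr
      _ = 24900 * (N * N * N) * (n * M) := by ring
      _ ≤ 24900 * (N * N * N) * (5 * (n * m + 1)) := by gcongr
      _ = _ := by ring
  have hk : k + 1 ≤ N * N * N := by
    have h1 : Y ≤ N := by rw [hNY]; exact Nat.le_mul_of_pos_left _ (by omega)
    have h2 : N ≤ N * N * N := by rw [mul_assoc]; exact Nat.le_mul_of_pos_right _ (by positivity)
    omega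
  have hpow : N * N * N ≤ 2 ^ (1000000 * k) := by
    rw [hN, ← pow_add, ← pow_add]
    exact Nat.pow_le_pow_right (by omega) (by omega)
  have hn' : n ≤ 2 * (n * m + 1) := by nlinarith
  have hW1 : N * N * N ≤ N * N * N * (n * m + 1) := Nat.le_mul_of_pos_right _ (by omega)
  have hW2 : n * m + 1 ≤ N * N * N * (n * m + 1) := Nat.le_mul_of_pos_left _ (by omega)
  calc _ = n * (N * (N * (2 * guessTime p M + 900 * M))) + 52 * n + 200 * k + 79 := by ring
    _ ≤ 1000000 * (N * N * N * (n * m + 1)) := by omega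
    _ ≤ 1000000 * (2 ^ (1000000 * k) * (n * m + 1)) := by gcongr
    _ = _ := by ring

end Main

end LocalDecomp

open LocalDecomp in
theorem theorem3p3 :
    ∃ (P : Prog) (c : ℕ),
      ∀ (n : ℕ) (G : SimpleGraph (Fin n)) (adj : Fin n → List (Fin n)) (k : ℕ)
        (S : Finset (Fin n)),
        G.Connected → IsAdjList G adj → IsUnbreakable G (2 * k) k (S : Set (Fin n)) →
        ∃ (t : ℕ) (σ : Store) (A : Set (Fin n)),
          Exec P (inputStore adj k S) t σ ∧
          t ≤ c * 2 ^ (c * k) * (n * G.edgeSet.ncard + 1) ∧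
          outputSet n σ = A ∧
          A = chipBag G k (S : Set (Fin n)) ∧
          (S : Set (Fin n)) ⊆ A ∧
          (∀ D : (G.induce Aᶜ).ConnectedComponent,
            (nbhd G (Subtype.val '' D.supp)).ncard ≤ eta k) ∧
          IsUnbreakable G (tau k) k A ∧
          (3 * k < S.card → (G.induce (S : Set (Fin n))ᶜ).Connected →
            nbhd G (S : Set (Fin n))ᶜ = (S : Set (Fin n)) → (S : Set (Fin n)) ≠ A) := by
  refine ⟨main, 1000000, fun n G adj k S hG hadj hS => ?_⟩
  obtain ⟨t, σ, he, ht, hout⟩ := runs_main (k := k) (S := S) hadj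
  have hN := fun v => ncard_maxChips_mem_le (H := G) k (S : Set (Fin n)) v
  refine ⟨t, σ, _, he, ?_, hout, rfl, subset_chipBag k _, ?_, ?_, ?_⟩
  · have hpos : 1 ≤ n := by
      obtain ⟨v⟩ := hG.nonempty
      exact v.pos
    have hm : n ≤ G.edgeSet.ncard + 1 := by
      have := hG.card_vert_le_card_edgeSet_add_one
      rwa [Nat.card_eq_fintype_card, Fintype.card_fin] at this
    refine ht.trans ?_
    rw [size, sum_length_eq hadj]
    exact main_time_le k n _ hpos hm
  · exact fun D => ncard_nbhd_component_le hN D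
  · intro X Y hXY hk
    -- There is slack: the counting gives `3k² · 4^{3k} + 2k`.
    have hle : k * 4 ^ (3 * k) * (3 * k) + 2 * k ≤ tau k := by
      unfold tau
      have : 4 ^ (3 * k) ≤ 8 ^ (3 * k) := Nat.pow_le_pow_left (by omega) _
      have h := Nat.mul_le_mul (Nat.le_refl (k * k)) this
      calc _ = 3 * (k * k * 4 ^ (3 * k)) + 2 * k := by ring
        _ ≤ 9 * (k * k * 8 ^ (3 * k)) + 2 * k := by omega
        _ = _ := by ring
    exact (isUnbreakable_chipBag hN hS X Y hXY hk).imp (fun h => h.trans hle) fun h => h.trans hle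
  · intro h1 h2 h3
    exact ne_chipBag (by rwa [Set.ncard_coe_finset]) (induce_connected_iff.1 h2) h3
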